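/- All logarithms are to base $2$. For a finite graph $G$ write $\Delta(G)$, $\delta(G)$ and $d(G)$ for its maximum, minimum and average degree, and for $U\subseteq V(G)$ let $N_G(U)$ be the set of vertices outside $U$ with at least one neighbour in $U$. An $n$-vertex graph $G$ is an $(\varepsilon_0,c,s)$-expander if for every $U\subseteq V(G)$ and $E_0\subseteq E(G)$ with $1\le |U|\le \frac23 n$ and $|E_0|\le s|U|$ we have $|N_{G-E_0}(U)|\ge \frac{\varepsilon_0}{(\log n)^c}|U|$. A subdivision of a graph $F$ is a graph obtained by replacing each edge $uv$ of $F$ with a path with ends $u$ and $v$, such that the sets of internal vertices of these paths are pairwise disjoint and disjoint from $V(F)$. Lemma. For every $c>0$ there is $n_0=n_0(c)$ such that the following holds for all $n\ge n_0$. Let $\varepsilon,d,s$ be real numbers with $0<\varepsilon\le (\log n)^{-4}$, $d\ge (\log n)^{10c+51}$ and $s\ge \frac{d}{4(\log n)^c}$. Let $H$ be an $n$-vertex $(\frac18,c,s)$-expander with $\Delta(H)\le d$, $d(H)\ge d(1-\varepsilon)$ and $\delta(H)\ge \frac{d(H)}{2}$. Then: (i) for every graph $F$ with at least one edge and at most $\frac{\sqrt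 d}{(\log n)^2}$ vertices, $H$ contains a subgraph which is a subdivision of $F$ and covers all but at most $\frac{n}{\log n}$ vertices of $H$; (ii) in particular ($F$ a triangle), $H$ contains a cycle covering all but at most $\frac{n}{\log n}$ vertices of $H$. -/

import Mathlib

namespace SimpleGraph

/-- The average degree `d(G)` of a finite graph. -/
noncomputable def avgDegree {V : Type*} [Fintype V] (G : SimpleGraph V) [DecidableRel G.Adj] : ℝ :=
  (∑ v : V, (G.degree v : ℝ)) / (Fintype.card V : ℝ)

/-- The external neighbourhood `N_G(U)`: the vertices outside `U` that are adjacent to at least one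
vertex of `U`. -/
def extNeighborSet {V : Type*} (G : SimpleGraph V) (U : Set V) : Set V :=
  {v | v ∉ U ∧ ∃ u ∈ U, G.Adj u v}

/-- `(ε, c, s)`-expanders: for every vertex set `U` with `1 ≤ |U| ≤ (2/3) n` and every set `F` of at
most `s |U|` edges, `|N_{G - F}(U)| ≥ ε / (log n) ^ c * |U|`, where `n` is the number of vertices
and the logarithm is to base 2. -/
def IsRobustExpander {V : Type*} [Fintype V] (G : SimpleGraph V) (ε c s : ℝ) : Prop :=
  ∀ (U : Finset V) (F : Finset (Sym2 V)),
    1 ≤ U.card → (U.card : ℝ) ≤ 2 / 3 * (Fintype.card V : ℝ) →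
    (F : Set (Sym2 V)) ⊆ G.edgeSet → (F.card : ℝ) ≤ s * (U.card : ℝ) →
    ε / (Real.logb 2 (Fintype.card V : ℝ)) ^ c * (U.card : ℝ) ≤
      ((((G.deleteEdges (F : Set (Sym2 V))).extNeighborSet (U : Set V)).ncard : ℕ) : ℝ)

/-- The subgraph `K` of `G` is a subdivision of `F`: there are distinct branch vertices `b w` of `G`,
one for each vertex `w` of `F`, and for each edge `uv` of `F` a path `P` of `G` from `b u` to `b v`
(the same path, reversed, for `vu`), such that no path has a branch vertex in its interior, the
interiors of the paths of two distinct edges are disjoint, and `K` consists exactly of the branch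
vertices and of the vertices and edges of these paths. -/
def Subgraph.IsSubdivisionOf {V W : Type*} {G : SimpleGraph V} (K : G.Subgraph)
    (F : SimpleGraph W) : Prop :=
  ∃ (b : W → V) (P : ∀ ⦃u v : W⦄, F.Adj u v → G.Walk (b u) (b v)),
    Function.Injective b ∧
    (∀ ⦃u v : W⦄ (h : F.Adj u v), (P h).IsPath) ∧
    (∀ ⦃u v : W⦄ (h : F.Adj u v), P h.symm = (P h).reverse) ∧
    (∀ ⦃u v : W⦄ (h : F.Adj u v) (w : W), b w ∈ (P h).support → w = u ∨ w = v) ∧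
    (∀ ⦃u v u' v' : W⦄ (h : F.Adj u v) (h' : F.Adj u' v'), s(u, v) ≠ s(u', v') →
      ∀ x : V, x ∈ (P h).support → x ∈ (P h').support → x ∈ Set.range b) ∧
    (∀ x : V, x ∈ K.verts ↔
      x ∈ Set.range b ∨ ∃ (u v : W) (h : F.Adj u v), x ∈ (P h).support) ∧
    (∀ x y : V, K.Adj x y ↔ ∃ (u v : W) (h : F.Adj u v), s(x, y) ∈ (P h).edges)

end SimpleGraph

namespace ExpanderCycle
open Finset
open scoped Classical

/-! The expansion hypothesis enters only through edges. If the boundary of U had at most s|U| edges,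
deleting them would leave U without external neighbours (`lt_sum_dg_compl_of_isRobustExpander`).
With D the maximum degree, X about log n and Y about (log n)^c, this yields boundaries of at least
D|U|/(4Y). `RegularExpander` collects this together with near-regularity and D ≥ X^50 Y^10.

In the subdivision one edge u₀v₀ of F becomes a path through almost all of the graph, and every
other edge becomes a path with at most 40X² vertices. Four ingredients are needed.

Reservoirs (`exists_reservoir_paths`): a sparse set R through which any two vertices, or two large
sets, are joined by a short path that avoids a prescribed small set Z. R is a union of random sets.
Starting from N(A), the set reached from A grows by a factor 1 + 1/(16Y) per random set, with
failure probability exponentially small in |N(A)|. When |N(A)| is large compared with |A| and |Z|,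
this beats the number of pairs (A, Z), so one R serves all of them. Once two reached sets exceed
2n/3, a last random set contains a common vertex of both.

Path cover (`exists_path_cover`): vertices are put at random into l layers with probability
proportional to degree. The weights 1/(d(x)d(y)) on edges then form an almost perfect fractional
matching between consecutive layers. Hall's theorem with deficiency and composition of matchings
give disjoint paths with l vertices each that cover nearly everything.

Merging (`exists_merged_path`): depth-first search on these paths, where two count as adjacent if
the end of one can be linked to the beginning of the other through the unused reservoir. Since large
families are always linked, the stack finally contains almost all the paths, and only their ends are
lost.

Linkage (`exists_linkage`): a subset maximising density divided by a slowly growing function of its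
size has good minimum degree and expansion. The short paths are found in it greedily.

Assembly (`RegularExpander.exists_spanning_subdivision`): reservoirs R and a much sparser R' are
fixed; branch vertices and short paths are placed outside both; the rest is covered and merged
through R \ R'; and R' joins the ends of the long path to u₀ and v₀. For a triangle the result is a
cycle. -/

/-- The number of neighbours of `v` in `W`. -/
noncomputable def dg {V : Type*} (G : SimpleGraph V) (v : V) (W : Finset V) : ℕ :=
  #{w ∈ W | G.Adj v w}

/-- The vertices with at least one neighbour in `A`. -/
noncomputable def nbrs {V : Type*} [Fintype V] (G : SimpleGraph V) (A : Finset V) : Finset V :=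
  {v | ∃ a ∈ A, G.Adj a v}

/-! ### Concentration for uniform random colourings, stated by counting colourings. -/

section Probability

variable {V C : Type*} [Fintype V] [Fintype C]

lemma sum_prod_apply (g : V → C → ℝ) :
    ∑ χ : V → C, ∏ v, g v (χ v) = ∏ v, ∑ c, g v c := by
  rw [Finset.prod_univ_sum, Fintype.piFinset_univ]

/-- Uses |e^y - 1 - y| ≤ y² for |y| ≤ 1, together with x² ≤ x on [0,1], which makes the bound linear
in x so that it can be averaged. -/
lemma exp_mul_le {l x : ℝ} (hl : |l| ≤ 1) (h0 : 0 ≤ x) (h1 : x ≤ 1) :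
    Real.exp (l * x) ≤ 1 + (l + l ^ 2) * x := by
  have h : |l * x| ≤ 1 := by
    rw [abs_mul, abs_of_nonneg h0]
    nlinarith [abs_nonneg l]
  have := (abs_le.1 (Real.abs_exp_sub_one_sub_id_le h)).2
  have h2 : (l * x) ^ 2 ≤ l ^ 2 * x := by
    nlinarith [sq_nonneg l, mul_nonneg (sq_nonneg l) (mul_nonneg h0 (sub_nonneg.2 h1))]
  nlinarith

/-- Markov's inequality for the exponential moment, which factorises because the coordinates of a
uniform colouring are independent. The sign of l is free, so both tails follow from it. -/
lemma card_exp_bound [Nonempty C] (X : V → C → ℝ) (h0 : ∀ v c, 0 ≤ X v c) (h1 : ∀ v c, X v c ≤ 1)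
    {l : ℝ} (hl : |l| ≤ 1) (b : ℝ) :
    (#{χ : V → C | b ≤ l * ∑ v, X v (χ v)} : ℝ) ≤
      (Fintype.card C : ℝ) ^ Fintype.card V *
        Real.exp (-b + (l + l ^ 2) * ∑ v, (∑ c, X v c) / Fintype.card C) := by
  have hC : (0 : ℝ) < Fintype.card C := by exact_mod_cast Fintype.card_pos
  have key : ∑ χ : V → C, Real.exp (l * ∑ v, X v (χ v)) ≤ (Fintype.card C : ℝ) ^ Fintype.card V *
      Real.exp ((l + l ^ 2) * ∑ v, (∑ c, X v c) / Fintype.card C) := by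
    have e : ∀ χ : V → C, Real.exp (l * ∑ v, X v (χ v)) = ∏ v, Real.exp (l * X v (χ v)) := by
      intro χ
      rw [Finset.mul_sum, Real.exp_sum]
    simp_rw [e]
    rw [sum_prod_apply (fun v c => Real.exp (l * X v c)), Finset.mul_sum, Real.exp_sum,
      ← Finset.card_univ (α := V), ← Finset.prod_const, ← Finset.prod_mul_distrib]
    refine Finset.prod_le_prod (fun v _ => Finset.sum_nonneg fun c _ => (Real.exp_pos _).le)
      fun v _ => ?_
    calc ∑ c, Real.exp (l * X v c) ≤ ∑ c, (1 + (l + l ^ 2) * X v c) :=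
          Finset.sum_le_sum fun c _ => exp_mul_le hl (h0 v c) (h1 v c)
      _ = Fintype.card C * (1 + (l + l ^ 2) * ((∑ c, X v c) / Fintype.card C)) := by
          rw [Finset.sum_add_distrib, ← Finset.mul_sum]
          simp only [sum_const, card_univ, nsmul_eq_mul, mul_one]
          field_simp
      _ ≤ _ := by
          refine mul_le_mul_of_nonneg_left ?_ hC.le
          rw [add_comm]
          exact Real.add_one_le_exp _
  have h2 : (#{χ : V → C | b ≤ l * ∑ v, X v (χ v)} : ℝ) * Real.exp b ≤
      ∑ χ : V → C, Real.exp (l * ∑ v, X v (χ v)) := by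
    rw [← nsmul_eq_mul]
    refine (Finset.card_nsmul_le_sum _ _ _ ?_).trans
      (Finset.sum_le_sum_of_subset_of_nonneg (Finset.filter_subset _ _)
        fun _ _ _ => (Real.exp_pos _).le)
    intro χ hχ
    exact Real.exp_le_exp.2 (Finset.mem_filter.1 hχ).2
  rw [Real.exp_add, Real.exp_neg]
  have hb := Real.exp_pos b
  calc (#{χ : V → C | b ≤ l * ∑ v, X v (χ v)} : ℝ)
      = (#{χ : V → C | b ≤ l * ∑ v, X v (χ v)} : ℝ) * Real.exp b * (Real.exp b)⁻¹ := by
        field_simp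
    _ ≤ _ := by
        refine (mul_le_mul_of_nonneg_right (h2.trans key) (inv_nonneg.2 hb.le)).trans (le_of_eq ?_)
        ring

lemma card_upper_tail [Nonempty C] (X : V → C → ℝ) (h0 : ∀ v c, 0 ≤ X v c)
    (h1 : ∀ v c, X v c ≤ 1) {μ a : ℝ} (hμ : μ = ∑ v, (∑ c, X v c) / Fintype.card C)
    (hμ0 : 0 < μ) (ha : 0 ≤ a) (ha2 : a ≤ 2 * μ) :
    (#{χ : V → C | μ + a ≤ ∑ v, X v (χ v)} : ℝ) ≤
      (Fintype.card C : ℝ) ^ Fintype.card V * Real.exp (-(a ^ 2 / (4 * μ))) := by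
  have hl : |a / (2 * μ)| ≤ 1 := by
    rw [abs_of_nonneg (by positivity)]
    exact (div_le_one (by positivity)).2 ha2
  -- The tilt a/(2μ) minimises -la + l²μ, with value -a²/(4μ); the condition a ≤ 2μ keeps it at most
  -- 1.
  have := card_exp_bound X h0 h1 hl (a / (2 * μ) * (μ + a))
  rw [← hμ] at this
  refine le_trans ?_ (this.trans (le_of_eq ?_))
  · norm_cast
    refine Finset.card_le_card fun χ hχ => ?_
    simp only [mem_filter, mem_univ, true_and] at hχ ⊢
    exact mul_le_mul_of_nonneg_left hχ (by positivity)
  · congr 2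
    field_simp
    ring

lemma card_lower_tail [Nonempty C] (X : V → C → ℝ) (h0 : ∀ v c, 0 ≤ X v c)
    (h1 : ∀ v c, X v c ≤ 1) {μ a : ℝ} (hμ : μ = ∑ v, (∑ c, X v c) / Fintype.card C)
    (hμ0 : 0 < μ) (ha : 0 ≤ a) (ha2 : a ≤ 2 * μ) :
    (#{χ : V → C | ∑ v, X v (χ v) ≤ μ - a} : ℝ) ≤
      (Fintype.card C : ℝ) ^ Fintype.card V * Real.exp (-(a ^ 2 / (4 * μ))) := by
  have hl : |-(a / (2 * μ))| ≤ 1 := by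
    rw [abs_neg, abs_of_nonneg (by positivity)]
    exact (div_le_one (by positivity)).2 ha2
  have := card_exp_bound X h0 h1 hl (-(a / (2 * μ)) * (μ - a))
  rw [← hμ] at this
  refine le_trans ?_ (this.trans (le_of_eq ?_))
  · norm_cast
    refine Finset.card_le_card fun χ hχ => ?_
    simp only [mem_filter, mem_univ, true_and] at hχ ⊢
    exact mul_le_mul_of_nonpos_left hχ (neg_nonpos.2 (by positivity))
  · congr 2
    field_simp
    ring

/-- The proportion of colourings in which a set avoids colour `0`. -/
lemma card_avoid {M : ℕ} [NeZero M] (N : Finset V) :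
    (#{χ : V → Fin M | ∀ v ∈ N, χ v ≠ 0} : ℝ) ≤
      (M : ℝ) ^ Fintype.card V * Real.exp (-((#N : ℝ) / M)) := by
  have hM : (0 : ℝ) < M := by exact_mod_cast Nat.pos_of_ne_zero (NeZero.ne M)
  have e : (#{χ : V → Fin M | ∀ v ∈ N, χ v ≠ 0} : ℝ) =
      ∑ χ : V → Fin M, ∏ v, (if v ∈ N ∧ χ v = 0 then (0 : ℝ) else 1) := by
    rw [Finset.card_filter]
    push_cast
    refine Finset.sum_congr rfl fun χ _ => ?_
    split_ifs with h
    · symm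
      refine Finset.prod_eq_one fun v _ => if_neg fun hv => h v hv.1 hv.2
    · push Not at h
      obtain ⟨v, hv, h0⟩ := h
      symm
      exact Finset.prod_eq_zero (Finset.mem_univ v) (if_pos ⟨hv, h0⟩)
  rw [e, sum_prod_apply (fun v (c : Fin M) => if v ∈ N ∧ c = 0 then (0 : ℝ) else 1)]
  have h2 : ∀ v, ∑ c : Fin M, (if v ∈ N ∧ c = 0 then (0 : ℝ) else 1) ≤
      M * (if v ∈ N then Real.exp (-(1 / M)) else 1) := by
    intro v
    by_cases hv : v ∈ N
    · have h3 : ∀ c : Fin M, (if v ∈ N ∧ c = 0 then (0 : ℝ) else 1) = 1 - if c = 0 then 1 else 0 := by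
        intro c
        by_cases hc : c = 0 <;> simp [hv, hc]
      simp only [h3, if_pos hv, Finset.sum_sub_distrib, Finset.sum_ite_eq', mem_univ, if_true,
        sum_const, card_univ, Fintype.card_fin, nsmul_eq_mul, mul_one]
      have := Real.add_one_le_exp (-(1 / (M : ℝ)))
      calc (M : ℝ) - 1 = M * (-(1 / M) + 1) := by field_simp; ring
        _ ≤ _ := mul_le_mul_of_nonneg_left this hM.le
    · simp [hv]
  refine (Finset.prod_le_prod (fun v _ => Finset.sum_nonneg fun c _ => by split_ifs <;> norm_num)
    fun v _ => h2 v).trans (le_of_eq ?_)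
  rw [Finset.prod_mul_distrib, Finset.prod_const, Finset.card_univ, Finset.prod_ite_mem,
    Finset.univ_inter, Finset.prod_const, ← Real.exp_nat_mul]
  congr 2
  ring

end Probability

/-! ### Degrees into sets and greedy covering. -/

section Covering

variable {V : Type*} (G : SimpleGraph V)

lemma sum_dg_comm (A B : Finset V) : ∑ a ∈ A, dg G a B = ∑ b ∈ B, dg G b A := by
  unfold dg
  have := Finset.sum_card_bipartiteAbove_eq_sum_card_bipartiteBelow (s := A) (t := B) G.Adj
  simpa [Finset.bipartiteAbove, Finset.bipartiteBelow, G.adj_comm] using this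

lemma dg_mono (v : V) {A B : Finset V} (h : A ⊆ B) : dg G v A ≤ dg G v B :=
  Finset.card_le_card (Finset.filter_subset_filter _ h)

lemma dg_union (v : V) {A B : Finset V} (h : Disjoint A B) :
    dg G v (A ∪ B) = dg G v A + dg G v B := by
  unfold dg
  rw [Finset.filter_union, Finset.card_union_of_disjoint (Finset.disjoint_filter_filter h)]

lemma dg_sdiff_add (v : V) {A B : Finset V} (h : B ⊆ A) :
    dg G v (A \ B) + dg G v B = dg G v A := by
  rw [← dg_union G v Finset.sdiff_disjoint, Finset.sdiff_union_of_subset h]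

variable [Fintype V]

lemma mem_nbrs {A : Finset V} {v : V} : v ∈ nbrs G A ↔ ∃ a ∈ A, G.Adj a v := by
  simp [nbrs]

lemma card_nbrs_singleton (v : V) : #(nbrs G {v}) = dg G v univ := by
  unfold nbrs dg
  simp

lemma sum_dg_le {D : ℕ} (hD : ∀ v, dg G v univ ≤ D) (A B : Finset V) :
    ∑ a ∈ A, dg G a B ≤ D * #A := by
  refine (Finset.sum_le_card_nsmul _ _ D fun a _ =>
    (dg_mono G a (Finset.subset_univ B)).trans (hD a)).trans (le_of_eq ?_)
  simp [mul_comm]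

/-- Greedy choice of a few vertices of `P` whose neighbourhoods in `Y` are large. -/
lemma exists_greedy_cover {D K : ℕ} (hD : ∀ v, dg G v univ ≤ D) (Y P : Finset V)
    (hP : ∀ w ∈ P, 2 * K ≤ dg G w Y) :
    ∃ Q ⊆ P, K * #Q ≤ #(nbrs G Q ∩ Y) ∧ ∑ w ∈ P, dg G w Y ≤ 2 * D * #(nbrs G Q ∩ Y) := by
  have hne : ((P.powerset).filter fun Q => K * #Q ≤ #(nbrs G Q ∩ Y)).Nonempty :=
    ⟨∅, by simp⟩
  obtain ⟨Q, hQ, hmax⟩ := Finset.exists_max_image _ (fun Q => #(nbrs G Q ∩ Y) + #Q) hne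
  simp only [mem_filter, mem_powerset] at hQ hmax
  refine ⟨Q, hQ.1, hQ.2, ?_⟩
  by_contra! hlt
  set N := nbrs G Q ∩ Y with hN
  -- At most D|N| edges lead from P to the covered set N, so if N is small some w has more than half
  -- of its neighbours in Y uncovered, hence at least K of them. Adding this w keeps the constraint
  -- and contradicts maximality.
  have h1 : ∑ w ∈ P, 2 * dg G w N < ∑ w ∈ P, dg G w Y := by
    rw [← Finset.mul_sum, sum_dg_comm]
    have := sum_dg_le G hD N P
    nlinarith
  obtain ⟨w, hwP, hw⟩ := Finset.exists_lt_of_sum_lt h1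
  have hNY : N ⊆ Y := Finset.inter_subset_right
  have h2 := dg_sdiff_add G w hNY
  have h3 : K ≤ dg G w (Y \ N) := by have := hP w hwP; omega
  have h4 : 0 < dg G w (Y \ N) := by omega
  have hwQ : w ∉ Q := by
    intro hwQ
    have : dg G w (Y \ N) = 0 := by
      unfold dg
      rw [Finset.card_eq_zero, Finset.filter_eq_empty_iff]
      intro y hy hwy
      rw [Finset.mem_sdiff] at hy
      exact hy.2 (Finset.mem_inter.2 ⟨(mem_nbrs G).2 ⟨w, hwQ, hwy⟩, hy.1⟩)
    omega
  have h5 : N ∪ {y ∈ Y \ N | G.Adj w y} ⊆ nbrs G (insert w Q) ∩ Y := by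
    intro y hy
    simp only [mem_union, mem_filter, mem_sdiff, hN, mem_inter, mem_nbrs, mem_insert] at hy ⊢
    rcases hy with ⟨⟨a, ha, hay⟩, hy⟩ | ⟨⟨hy, -⟩, hwy⟩
    · exact ⟨⟨a, Or.inr ha, hay⟩, hy⟩
    · exact ⟨⟨w, Or.inl rfl, hwy⟩, hy⟩
  have h6 : #N + dg G w (Y \ N) ≤ #(nbrs G (insert w Q) ∩ Y) := by
    rw [dg, ← Finset.card_union_of_disjoint]
    · exact Finset.card_le_card h5
    · exact Finset.disjoint_of_subset_right (Finset.filter_subset _ _) Finset.disjoint_sdiff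
  have h7 : #(insert w Q) = #Q + 1 := Finset.card_insert_of_notMem hwQ
  have := hmax (insert w Q) ⟨Finset.insert_subset hwP hQ.1, by rw [h7]; nlinarith [hQ.2]⟩
  omega

end Covering

end ExpanderCycle

namespace ExpanderCycle
open Finset
open scoped Classical

/-! ### One random round: a random sparse part of a set already has many outside neighbours. -/

section Round

variable {V : Type*} [Fintype V] (G : SimpleGraph V)

/-- The vertices of colour `0`. -/
noncomputable def zeroClass {M : ℕ} [NeZero M] (χ : V → Fin M) : Finset V := {v | χ v = 0}

lemma mem_zeroClass {M : ℕ} [NeZero M] {χ : V → Fin M} {v : V} : v ∈ zeroClass χ ↔ χ v = 0 := by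
  simp [zeroClass]

lemma sum_pow_card (r : ℝ) : ∑ Q : Finset V, r ^ #Q = (1 + r) ^ Fintype.card V := by
  have := Fintype.sum_pow_mul_eq_add_pow V r 1
  simpa [add_comm] using this

lemma one_add_pow_le_three {r : ℝ} (hr : 0 ≤ r) (h : Fintype.card V * r ≤ 1) :
    (1 + r) ^ Fintype.card V ≤ 3 := by
  calc (1 + r) ^ Fintype.card V ≤ Real.exp r ^ Fintype.card V := by
        refine pow_le_pow_left₀ (by linarith) ?_ _
        rw [add_comm]; exact Real.add_one_le_exp r
    _ = Real.exp (Fintype.card V * r) := by rw [← Real.exp_nat_mul]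
    _ ≤ Real.exp 1 := Real.exp_le_exp.2 h
    _ ≤ 3 := by linarith [Real.exp_one_lt_d9]

/-- The number of edges from S ∩ R to L concentrates around its mean E/M, where R is colour class 0
and E counts the edges from S to L. Each vertex of L absorbs at most 2K of them, so at least half
the mean forces many distinct neighbours. With 3KM ≤ D the constants give a contradiction because
8/3 < 3. -/
lemma card_bad_low {D K M Y u : ℕ} [NeZero M] (hD : 0 < D) (hY : 0 < Y) (hu : 0 < u)
    (hG : ∀ v, dg G v univ ≤ D)
    (hDK : 3 * K * M ≤ D) (S L : Finset V) (hL : ∀ w ∈ L, dg G w S ≤ 2 * K)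
    (hE : 3 * D * u ≤ 32 * Y * ∑ y ∈ S, dg G y L) :
    (#{χ : V → Fin M | 16 * Y * #(nbrs G (S ∩ zeroClass χ) ∩ L) < u} : ℝ) ≤
      (M : ℝ) ^ Fintype.card V * Real.exp (-((u : ℝ) / (256 * M * Y))) := by
  have hM : (0 : ℝ) < M := by exact_mod_cast Nat.pos_of_ne_zero (NeZero.ne M)
  have hD' : (0 : ℝ) < D := by exact_mod_cast hD
  have hY' : (0 : ℝ) < Y := by exact_mod_cast hY
  have hu' : (0 : ℝ) < u := by exact_mod_cast hu
  set E : ℕ := ∑ y ∈ S, dg G y L with hEdef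
  have hE' : (3 * D * u : ℝ) ≤ 32 * Y * E := by exact_mod_cast hE
  have hEpos : (0 : ℝ) < E := by
    have : (0 : ℝ) < 3 * D * u := by positivity
    by_contra h
    have : (32 * Y * E : ℝ) ≤ 0 := mul_nonpos_of_nonneg_of_nonpos (by positivity) (not_lt.1 h)
    linarith
  let X : V → Fin M → ℝ := fun v c => if c = 0 ∧ v ∈ S then (dg G v L : ℝ) / D else 0
  have h0 : ∀ v c, 0 ≤ X v c := by
    intro v c; dsimp [X]; split_ifs <;> positivity
  have h1 : ∀ v c, X v c ≤ 1 := by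
    intro v c; dsimp [X]; split_ifs
    · rw [div_le_one hD']
      exact_mod_cast (dg_mono G v (subset_univ L)).trans (hG v)
    · norm_num
  have hμ : (E : ℝ) / (D * M) = ∑ v, (∑ c, X v c) / Fintype.card (Fin M) := by
    have : ∀ v, (∑ c, X v c) = if v ∈ S then (dg G v L : ℝ) / D else 0 := by
      intro v
      by_cases hv : v ∈ S <;> simp [X, hv]
    simp only [this, Fintype.card_fin]
    rw [← Finset.sum_div, Finset.sum_ite_mem, Finset.univ_inter, ← Finset.sum_div, hEdef]
    push_cast
    field_simp
  have hμ0 : (0 : ℝ) < E / (D * M) := by positivity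
  have := card_lower_tail X h0 h1 hμ hμ0 (a := E / (D * M) / 2) (by positivity) (by linarith)
  rw [Fintype.card_fin] at this
  refine le_trans ?_ (this.trans ?_)
  · refine Nat.cast_le.2 (Finset.card_le_card fun χ hχ => ?_)
    simp only [mem_filter, mem_univ, true_and] at hχ ⊢
    set R : Finset V := zeroClass χ with hR
    have hsum : ∑ v, X v (χ v) = (∑ y ∈ S ∩ R, dg G y L : ℕ) / D := by
      push_cast
      rw [Finset.sum_div, ← Finset.univ_inter (S ∩ R), ← Finset.sum_ite_mem]
      refine Finset.sum_congr rfl fun v _ => ?_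
      simp only [X, hR, mem_inter, mem_zeroClass]
      simp only [and_comm]
    rw [hsum]
    by_contra! hlt
    have h2 : ∑ y ∈ S ∩ R, dg G y L ≤ 2 * K * #(nbrs G (S ∩ R) ∩ L) := by
      rw [sum_dg_comm]
      have : ∑ b ∈ L, dg G b (S ∩ R) = ∑ b ∈ nbrs G (S ∩ R) ∩ L, dg G b (S ∩ R) := by
        symm
        refine Finset.sum_subset Finset.inter_subset_right fun b hb hbn => ?_
        unfold dg
        rw [Finset.card_eq_zero, Finset.filter_eq_empty_iff]
        intro y hy hby
        exact hbn (Finset.mem_inter.2 ⟨(mem_nbrs G).2 ⟨y, hy, hby.symm⟩, hb⟩)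
      rw [this]
      refine (Finset.sum_le_card_nsmul _ _ (2 * K) fun b hb => ?_).trans (le_of_eq ?_)
      · exact (dg_mono G b Finset.inter_subset_left).trans (hL b (Finset.mem_inter.1 hb).2)
      · simp [mul_comm]
    set hits := #(nbrs G (S ∩ R) ∩ L)
    have h3 : ((∑ y ∈ S ∩ R, dg G y L : ℕ) : ℝ) ≤ 2 * K * hits := by exact_mod_cast h2
    have h4 : (16 * Y * hits : ℝ) < u := by exact_mod_cast hχ
    have h5 : (3 * K * M : ℝ) ≤ D := by exact_mod_cast hDK
    rw [lt_div_iff₀ hD'] at hlt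
    have h6 : (E : ℝ) / (D * M) - E / (D * M) / 2 = E / (2 * D * M) := by field_simp; ring
    rw [h6] at hlt
    have h7 : (E : ℝ) / (2 * D * M) * D = E / (2 * M) := by field_simp
    rw [h7, div_lt_iff₀ (by positivity)] at hlt
    have h8 : (E : ℝ) < 4 * K * M * hits := by nlinarith
    have h9 : (3 * D * u : ℝ) < 32 * Y * (4 * K * M * hits) := by
      refine hE'.trans_lt (mul_lt_mul_of_pos_left h8 (by positivity))
    have h10 : (32 * Y * (4 * K * M * hits) : ℝ) ≤ 8 * (K * M) * u := by
      have : (0 : ℝ) ≤ K * M := by positivity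
      nlinarith
    nlinarith
  · refine mul_le_mul_of_nonneg_left (Real.exp_le_exp.2 (neg_le_neg ?_)) (by positivity)
    have : (E / (D * M) / 2 : ℝ) ^ 2 / (4 * (E / (D * M))) = E / (16 * D * M) := by
      field_simp; ring
    rw [this, div_le_div_iff₀ (by positivity) (by positivity)]
    have h5 : (0 : ℝ) ≤ D * M * u := by positivity
    nlinarith [mul_le_mul_of_nonneg_left hE' hM.le]

/-- If few vertices of P are hit, the unhit ones still send many edges to S, and the greedy cover
extracts a small Q of unhit vertices whose neighbourhood in S is large and avoids colour 0. A union
bound over Q finishes, since that neighbourhood has at least K|Q| vertices. -/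
lemma card_bad_high {D K M Y u : ℕ} [NeZero M] (hD : 0 < D) (hY : 0 < Y)
    (hG : ∀ v, dg G v univ ≤ D)
    (hK : Fintype.card V * Real.exp (-((K : ℝ) / (2 * M))) ≤ 1) (S P : Finset V)
    (hP : ∀ w ∈ P, 2 * K ≤ dg G w S)
    (hE : 3 * D * u ≤ 32 * Y * ∑ w ∈ P, dg G w S) :
    (#{χ : V → Fin M | 16 * Y * #(nbrs G (S ∩ zeroClass χ) ∩ P) < u} : ℝ) ≤
      (M : ℝ) ^ Fintype.card V * (3 * Real.exp (-((u : ℝ) / (256 * M * Y)))) := by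
  have hM : (0 : ℝ) < M := by exact_mod_cast Nat.pos_of_ne_zero (NeZero.ne M)
  have hY' : (0 : ℝ) < Y := by exact_mod_cast hY
  let I : Finset (Finset V) := {Q | K * #Q ≤ #(nbrs G Q ∩ S) ∧ u ≤ 64 * Y * #(nbrs G Q ∩ S)}
  have hsub : ({χ : V → Fin M | 16 * Y * #(nbrs G (S ∩ zeroClass χ) ∩ P) < u} :
      Finset (V → Fin M)) ⊆ I.biUnion fun Q => {χ | ∀ v ∈ nbrs G Q ∩ S, χ v ≠ 0} := by
    intro χ hχ
    simp only [mem_filter, mem_univ, true_and] at hχ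
    set R : Finset V := zeroClass χ with hR
    set N := nbrs G (S ∩ R) with hN
    have h1 : ∑ w ∈ P, dg G w S ≤ ∑ w ∈ P \ N, dg G w S + D * #(N ∩ P) := by
      have e : P = (P \ N) ∪ (N ∩ P) := by
        rw [Finset.inter_comm]; exact (Finset.sdiff_union_inter P N).symm
      have hd : Disjoint (P \ N) (N ∩ P) :=
        Finset.disjoint_of_subset_right Finset.inter_subset_left Finset.sdiff_disjoint
      conv_lhs => rw [e, Finset.sum_union hd]
      exact Nat.add_le_add_left (sum_dg_le G hG _ _) _
    obtain ⟨Q, hQP, hQ1, hQ2⟩ := exists_greedy_cover G hG S (P \ N)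
      (fun w hw => hP w (Finset.mem_sdiff.1 hw).1)
    rw [Finset.mem_biUnion]
    refine ⟨Q, ?_, ?_⟩
    · simp only [I, mem_filter, mem_univ, true_and]
      refine ⟨hQ1, ?_⟩
      have h2 : D * u ≤ D * (64 * Y * #(nbrs G Q ∩ S)) := by
        have h3 : 32 * Y * ∑ w ∈ P, dg G w S ≤
            32 * Y * (2 * D * #(nbrs G Q ∩ S) + D * #(N ∩ P)) :=
          Nat.mul_le_mul_left _ (h1.trans (Nat.add_le_add_right hQ2 _))
        have h4 : D * (16 * Y * #(N ∩ P)) ≤ D * u := Nat.mul_le_mul_left _ hχ.le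
        nlinarith
      exact Nat.le_of_mul_le_mul_left h2 hD
    · simp only [mem_filter, mem_univ, true_and]
      intro v hv hv0
      rw [Finset.mem_inter, mem_nbrs] at hv
      obtain ⟨⟨q, hq, hqv⟩, hvS⟩ := hv
      have := (Finset.mem_sdiff.1 (hQP hq)).2
      exact this ((mem_nbrs G).2 ⟨v, Finset.mem_inter.2 ⟨hvS, by rw [hR, mem_zeroClass, hv0]⟩, hqv.symm⟩)
  have h1 : (#{χ : V → Fin M | 16 * Y * #(nbrs G (S ∩ zeroClass χ) ∩ P) < u} : ℝ) ≤
      ∑ Q ∈ I, (M : ℝ) ^ Fintype.card V * Real.exp (-(((#(nbrs G Q ∩ S) : ℕ) : ℝ) / M)) := by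
    refine le_trans ?_ (Finset.sum_le_sum fun Q _ => card_avoid (nbrs G Q ∩ S))
    exact_mod_cast (Finset.card_le_card hsub).trans Finset.card_biUnion_le
  refine h1.trans ?_
  rw [← Finset.mul_sum]
  refine mul_le_mul_of_nonneg_left ?_ (by positivity)
  -- Half of the exponent supplies the claimed bound in u; the other half, at least K|Q|/(2M), pays
  -- for the number of choices of Q.
  have h2 : ∀ Q ∈ I, Real.exp (-(((#(nbrs G Q ∩ S) : ℕ) : ℝ) / M)) ≤
      Real.exp (-((u : ℝ) / (256 * M * Y))) * Real.exp (-((K : ℝ) / (2 * M))) ^ #Q := by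
    intro Q hQ
    simp only [I, mem_filter, mem_univ, true_and] at hQ
    have ha : (K * #Q : ℝ) ≤ #(nbrs G Q ∩ S) := by exact_mod_cast hQ.1
    have hb : (u : ℝ) ≤ 64 * Y * #(nbrs G Q ∩ S) := by exact_mod_cast hQ.2
    rw [← Real.exp_nat_mul, ← Real.exp_add, Real.exp_le_exp]
    set N : ℝ := ((#(nbrs G Q ∩ S) : ℕ) : ℝ)
    have hN : 0 ≤ N := by positivity
    have e1 : (u : ℝ) / (256 * M * Y) ≤ N / (2 * M) := by
      rw [div_le_div_iff₀ (by positivity) (by positivity)]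
      nlinarith [mul_le_mul_of_nonneg_left hb hM.le, mul_nonneg hM.le (mul_nonneg hY'.le hN)]
    have e2 : (#Q : ℝ) * -((K : ℝ) / (2 * M)) = -((K * #Q : ℝ) / (2 * M)) := by ring
    have e3 : (K * #Q : ℝ) / (2 * M) ≤ N / (2 * M) :=
      div_le_div_of_nonneg_right ha (by positivity)
    have e4 : N / M = N / (2 * M) + N / (2 * M) := by field_simp; ring
    rw [e2, e4]
    linarith
  refine (Finset.sum_le_sum h2).trans ?_
  rw [← Finset.mul_sum, mul_comm]
  refine mul_le_mul_of_nonneg_right ?_ (Real.exp_pos _).le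
  refine (Finset.sum_le_sum_of_subset_of_nonneg (Finset.subset_univ I)
    fun _ _ _ => pow_nonneg (Real.exp_pos _).le _).trans ?_
  rw [sum_pow_card]
  exact one_add_pow_le_three (Real.exp_pos _).le hK

/-- A graph of maximum degree at most `D` in which sets of at most two thirds of the vertices have
edge boundary at least `D / (4 Y)` times their size. -/
structure EdgeExpander (D Y : ℕ) : Prop where
  pos_degree : 0 < D
  pos_ratio : 3 ≤ Y
  degree_le : ∀ v, dg G v univ ≤ D
  boundary : ∀ U : Finset V, 3 * #U ≤ 2 * Fintype.card V →
    D * #U ≤ 4 * Y * ∑ u ∈ U, dg G u Uᶜ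

variable {G}

/-- Removing Z costs at most D|Z| edges, a quarter of the guaranteed boundary of U. The remaining
edges are split by whether their outer end has at least 2K neighbours in U \ Z, and one of the two
kinds carries half of them. -/
lemma card_bad_round {D K M Y : ℕ} [NeZero M] (hG : EdgeExpander G D Y)
    (hK : Fintype.card V * Real.exp (-((K : ℝ) / (2 * M))) ≤ 1) (hDK : 3 * K * M ≤ D)
    (U Z : Finset V) (hU : U.Nonempty) (hU2 : 3 * #U ≤ 2 * Fintype.card V)
    (hZ : 16 * Y * #Z ≤ #U) :
    (#{χ : V → Fin M | 16 * Y * #(nbrs G ((U \ Z) ∩ zeroClass χ) \ U) < #U} : ℝ) ≤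
      (M : ℝ) ^ Fintype.card V * (3 * Real.exp (-((#U : ℝ) / (256 * M * Y)))) := by
  have hY : 0 < Y := by have := hG.pos_ratio; omega
  set S := U \ Z with hS
  have hE : 3 * D * #U ≤ 16 * Y * ∑ w ∈ Uᶜ, dg G w S := by
    have h1 := hG.boundary U hU2
    have h2 : ∑ u ∈ U, dg G u Uᶜ ≤ ∑ w ∈ Uᶜ, dg G w S + D * #Z := by
      rw [sum_dg_comm G Uᶜ S]
      have e : U ⊆ S ∪ Z := by rw [hS]; simp
      refine (Finset.sum_le_sum_of_subset e).trans ?_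
      have := Finset.sum_union_inter (s₁ := S) (s₂ := Z) (f := fun u => dg G u Uᶜ)
      have h3 := sum_dg_le G hG.degree_le Z Uᶜ
      omega
    have h3 : D * (16 * Y * #Z) ≤ D * #U := Nat.mul_le_mul_left _ hZ
    nlinarith [Nat.mul_le_mul_left (16 * Y) h2]
  set P := Uᶜ.filter fun w => 2 * K ≤ dg G w S with hP
  set L := Uᶜ.filter fun w => ¬ 2 * K ≤ dg G w S with hL
  have hsplit : ∑ w ∈ P, dg G w S + ∑ w ∈ L, dg G w S = ∑ w ∈ Uᶜ, dg G w S :=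
    Finset.sum_filter_add_sum_filter_not _ _ _
  have hmono : ∀ W ⊆ Uᶜ, (#{χ : V → Fin M | 16 * Y * #(nbrs G (S ∩ zeroClass χ) \ U) < #U} : ℝ) ≤
      #{χ : V → Fin M | 16 * Y * #(nbrs G (S ∩ zeroClass χ) ∩ W) < #U} := by
    intro W hW
    norm_cast
    refine Finset.card_le_card fun χ hχ => ?_
    simp only [mem_filter, mem_univ, true_and] at hχ ⊢
    refine lt_of_le_of_lt (Nat.mul_le_mul_left _ (Finset.card_le_card fun v hv => ?_)) hχ
    rw [Finset.mem_inter] at hv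
    exact Finset.mem_sdiff.2 ⟨hv.1, Finset.mem_compl.1 (hW hv.2)⟩
  by_cases hc : 3 * D * #U ≤ 32 * Y * ∑ w ∈ P, dg G w S
  · exact (hmono P (Finset.filter_subset _ _)).trans
      (card_bad_high G hG.pos_degree hY hG.degree_le hK S P
        (fun w hw => (Finset.mem_filter.1 hw).2) hc)
  · have hc2 : 3 * D * #U ≤ 32 * Y * ∑ w ∈ L, dg G w S := by
      rw [← hsplit] at hE
      nlinarith
    rw [sum_dg_comm] at hc2
    refine (hmono L (Finset.filter_subset _ _)).trans
      ((card_bad_low G hG.pos_degree hY hU.card_pos hG.degree_le hDK S L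
        (fun w hw => (not_le.1 (Finset.mem_filter.1 hw).2).le) hc2).trans ?_)
    refine mul_le_mul_of_nonneg_left ?_ (by positivity)
    linarith [Real.exp_pos (-((#U : ℝ) / (256 * M * Y)))]

end Round
end ExpanderCycle

namespace ExpanderCycle
open Finset
open scoped Classical

/-! ### Iterated rounds: reservoirs for a fixed family of sets. -/

section Reservoir

variable {V : Type*} {G : SimpleGraph V}

/-- `v` is reached from `A` by a walk of length at most `j` with interior in `Q`. -/
def ReachIn (G : SimpleGraph V) (A Q : Finset V) (j : ℕ) (v : V) : Prop :=
  ∃ a ∈ A, ∃ p : G.Walk a v, p.length ≤ j ∧ ∀ x ∈ p.support, x = a ∨ x = v ∨ x ∈ Q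

lemma ReachIn.mono {A Q Q' : Finset V} {j j' : ℕ} {v : V} (h : ReachIn G A Q j v) (hQ : Q ⊆ Q')
    (hj : j ≤ j') : ReachIn G A Q' j' v := by
  obtain ⟨a, ha, p, hp, hs⟩ := h
  refine ⟨a, ha, p, hp.trans hj, fun x hx => ?_⟩
  rcases hs x hx with h | h | h
  exacts [Or.inl h, Or.inr (Or.inl h), Or.inr (Or.inr (hQ h))]

lemma ReachIn.step {A Q : Finset V} {j : ℕ} {u v : V} (h : ReachIn G A Q j u) (hu : u ∈ Q)
    (huv : G.Adj u v) : ReachIn G A Q (j + 1) v := by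
  obtain ⟨a, ha, p, hp, hs⟩ := h
  refine ⟨a, ha, p.concat huv, by rw [SimpleGraph.Walk.length_concat]; omega, fun x hx => ?_⟩
  rw [SimpleGraph.Walk.support_concat, List.mem_append,
    List.mem_singleton] at hx
  rcases hx with hx | hx
  · rcases hs x hx with h | h | h
    exacts [Or.inl h, Or.inr (Or.inr (h ▸ hu)), Or.inr (Or.inr h)]
  · exact Or.inr (Or.inl hx)

variable [Fintype V]

lemma reachIn_one {A Q : Finset V} {v : V} (h : v ∈ nbrs G A) : ReachIn G A Q 1 v := by
  obtain ⟨a, ha, hav⟩ := (mem_nbrs G).1 h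
  exact ⟨a, ha, hav.toWalk, by simp, fun x hx => by simpa [or_assoc] using Or.inl hx⟩

lemma exists_of_card_lt_univ {Ω : Type*} [Fintype Ω] (B : Finset Ω)
    (h : (#B : ℝ) < Fintype.card Ω) : ∃ ω, ω ∉ B := by
  by_contra! hB
  have : B = univ := Finset.eq_univ_iff_forall.2 hB
  rw [this, Finset.card_univ] at h
  exact lt_irrefl _ h

lemma sum_indicator_zeroClass {M : ℕ} [NeZero M] (U : Finset V) (χ : V → Fin M) :
    ∑ v, (if χ v = 0 ∧ v ∈ U then (1 : ℝ) else 0) = #(U ∩ zeroClass χ) := by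
  rw [Finset.sum_boole]
  congr 2
  ext v
  simp [mem_zeroClass, and_comm]

lemma mean_indicator_zeroClass {M : ℕ} [NeZero M] (U : Finset V) :
    (#U : ℝ) / M = ∑ v, (∑ c : Fin M, if c = 0 ∧ v ∈ U then (1 : ℝ) else 0) /
      Fintype.card (Fin M) := by
  have : ∀ v, (∑ c : Fin M, if c = 0 ∧ v ∈ U then (1 : ℝ) else 0) = if v ∈ U then 1 else 0 := by
    intro v
    by_cases hv : v ∈ U <;> simp [hv]
  simp only [this, Fintype.card_fin]
  rw [← Finset.sum_div]
  simp

lemma card_zeroClass_upper {M : ℕ} [NeZero M] [Nonempty V] {a : ℝ} (ha : 0 ≤ a)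
    (ha2 : a ≤ 2 * (Fintype.card V / M)) :
    (#{χ : V → Fin M | (Fintype.card V : ℝ) / M + a ≤ #(zeroClass χ)} : ℝ) ≤
      (M : ℝ) ^ Fintype.card V * Real.exp (-(a ^ 2 / (4 * (Fintype.card V / M)))) := by
  have hM : (0 : ℝ) < M := by exact_mod_cast Nat.pos_of_ne_zero (NeZero.ne M)
  have hn : (0 : ℝ) < Fintype.card V := by exact_mod_cast Fintype.card_pos
  have := card_upper_tail (V := V) (fun v (c : Fin M) => if c = 0 ∧ v ∈ univ then (1 : ℝ) else 0)
    (fun _ _ => by split_ifs <;> norm_num) (fun _ _ => by split_ifs <;> norm_num)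
    (mean_indicator_zeroClass univ) (by rw [Finset.card_univ]; positivity) ha
    (by rwa [Finset.card_univ])
  simp only [sum_indicator_zeroClass, Finset.univ_inter, Finset.card_univ, Fintype.card_fin] at this
  exact this

lemma card_zeroClass_lower {M : ℕ} [NeZero M] (U : Finset V) (hU : U.Nonempty) {a : ℝ}
    (ha : 0 ≤ a) (ha2 : a ≤ 2 * (#U / M)) :
    (#{χ : V → Fin M | (#(U ∩ zeroClass χ) : ℝ) ≤ #U / M - a} : ℝ) ≤
      (M : ℝ) ^ Fintype.card V * Real.exp (-(a ^ 2 / (4 * (#U / M)))) := by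
  have hM : (0 : ℝ) < M := by exact_mod_cast Nat.pos_of_ne_zero (NeZero.ne M)
  have hn : (0 : ℝ) < #U := by exact_mod_cast hU.card_pos
  have := card_lower_tail (V := V) (fun v (c : Fin M) => if c = 0 ∧ v ∈ U then (1 : ℝ) else 0)
    (fun _ _ => by split_ifs <;> norm_num) (fun _ _ => by split_ifs <;> norm_num)
    (mean_indicator_zeroClass U) (by positivity) ha ha2
  simp only [sum_indicator_zeroClass, Fintype.card_fin] at this
  exact this

variable {ι : Type*} [Fintype ι] {D K M Y : ℕ} [NeZero M]

/-- A single sparse set through which all members of a family of sets grow. -/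
lemma exists_round (hG : EdgeExpander G D Y)
    (hK : Fintype.card V * Real.exp (-((K : ℝ) / (2 * M))) ≤ 1) (hDK : 3 * K * M ≤ D)
    (hn : 4 * M ≤ Fintype.card V)
    (U Z : ι → Finset V) (hU : ∀ i, (U i).Nonempty) (hZ : ∀ i, 16 * Y * #(Z i) ≤ #(U i))
    (hsum : ∑ i, Real.exp (-((#(U i) : ℝ) / (256 * M * Y))) ≤ 1 / 8) :
    ∃ R : Finset V, M * #R ≤ 2 * Fintype.card V ∧ ∀ i, 3 * #(U i) ≤ 2 * Fintype.card V →
      #(U i) ≤ 16 * Y * #(nbrs G ((U i \ Z i) ∩ R) \ U i) := by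
  have hM : (0 : ℝ) < M := by exact_mod_cast Nat.pos_of_ne_zero (NeZero.ne M)
  have hMn : (4 * M : ℝ) ≤ Fintype.card V := by exact_mod_cast hn
  have hn0 : (0 : ℝ) < Fintype.card V := by linarith
  have : Nonempty V := Fintype.card_pos_iff.1 (by exact_mod_cast hn0)
  let B1 : Finset (V → Fin M) :=
    {χ | (Fintype.card V : ℝ) / M + Fintype.card V / M ≤ #(zeroClass χ)}
  let J : Finset ι := {i | 3 * #(U i) ≤ 2 * Fintype.card V}
  let B2 : ι → Finset (V → Fin M) := fun i =>
    {χ | 16 * Y * #(nbrs G ((U i \ Z i) ∩ zeroClass χ) \ U i) < #(U i)}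
  have h1 : (#B1 : ℝ) ≤ (M : ℝ) ^ Fintype.card V * (1 / 2) := by
    refine (card_zeroClass_upper (by positivity)
      (by have : (0 : ℝ) ≤ Fintype.card V / M := by positivity
          linarith)).trans (mul_le_mul_of_nonneg_left ?_ (by positivity))
    have e : ((Fintype.card V : ℝ) / M) ^ 2 / (4 * (Fintype.card V / M)) =
        Fintype.card V / M / 4 := by field_simp
    have e2 : (4 : ℝ) ≤ Fintype.card V / M := by rwa [le_div_iff₀ hM]
    rw [e]
    calc Real.exp (-((Fintype.card V : ℝ) / M / 4)) ≤ Real.exp (-1) :=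
          Real.exp_le_exp.2 (by linarith)
      _ ≤ 1 / 2 := by linarith [Real.exp_neg_one_lt_d9]
  have h2 : (#(J.biUnion B2) : ℝ) ≤ (M : ℝ) ^ Fintype.card V * (3 / 8) := by
    calc (#(J.biUnion B2) : ℝ) ≤ ∑ i ∈ J, (#(B2 i) : ℝ) := by exact_mod_cast Finset.card_biUnion_le
      _ ≤ ∑ i ∈ J, (M : ℝ) ^ Fintype.card V *
            (3 * Real.exp (-((#(U i) : ℝ) / (256 * M * Y)))) :=
          Finset.sum_le_sum fun i hi => card_bad_round hG hK hDK (U i) (Z i) (hU i)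
            (Finset.mem_filter.1 hi).2 (hZ i)
      _ = (M : ℝ) ^ Fintype.card V *
            (3 * ∑ i ∈ J, Real.exp (-((#(U i) : ℝ) / (256 * M * Y)))) := by
          rw [Finset.mul_sum, Finset.mul_sum]
      _ ≤ _ := by
          refine mul_le_mul_of_nonneg_left ?_ (by positivity)
          have := Finset.sum_le_sum_of_subset_of_nonneg (Finset.subset_univ J)
            (fun i _ _ => (Real.exp_pos (-((#(U i) : ℝ) / (256 * M * Y)))).le)
          linarith
  -- Failure proportions: 1/2 for an oversized class and 3·(1/8) for the family, together less than
  -- 1.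
  obtain ⟨χ, hχ⟩ := exists_of_card_lt_univ (B1 ∪ J.biUnion B2) (by
    have h3 : (#(B1 ∪ J.biUnion B2) : ℝ) ≤ #B1 + #(J.biUnion B2) := by
      exact_mod_cast Finset.card_union_le _ _
    have h4 : (0 : ℝ) < (M : ℝ) ^ Fintype.card V := by positivity
    simp only [Fintype.card_fun, Fintype.card_fin, Nat.cast_pow]
    linarith)
  rw [Finset.mem_union, not_or] at hχ
  refine ⟨zeroClass χ, ?_, fun i hi => ?_⟩
  · have := hχ.1
    simp only [B1, mem_filter, mem_univ, true_and, not_le] at this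
    have h5 : (M * #(zeroClass χ) : ℝ) < 2 * Fintype.card V := by
      calc (M * #(zeroClass χ) : ℝ) < M * (Fintype.card V / M + Fintype.card V / M) :=
            mul_lt_mul_of_pos_left this hM
        _ = _ := by field_simp; ring
    exact_mod_cast h5.le
  · by_contra! hlt
    exact hχ.2 (Finset.mem_biUnion.2 ⟨i, by simpa [J] using hi, by simpa [B2] using hlt⟩)

/-- A sparse set which meets each of a family of large sets in more than half of its elements. -/
lemma exists_majority (hY : 3 ≤ Y) (hn : 6000 * M ≤ Fintype.card V)
    (U : ι → Finset V) (hU : ∀ i, 2 * Fintype.card V < 3 * #(U i))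
    (hsum : ∑ i, Real.exp (-((#(U i) : ℝ) / (256 * M * Y))) ≤ 1 / 8) :
    ∃ R : Finset V, 12 * M * #R ≤ 13 * Fintype.card V ∧
      ∀ i, 7 * Fintype.card V ≤ 12 * M * #(U i ∩ R) := by
  have hM : (0 : ℝ) < M := by exact_mod_cast Nat.pos_of_ne_zero (NeZero.ne M)
  have hMn : (6000 * M : ℝ) ≤ Fintype.card V := by exact_mod_cast hn
  have hn0 : (0 : ℝ) < Fintype.card V := by linarith
  have hY' : (3 : ℝ) ≤ Y := by exact_mod_cast hY
  have : Nonempty V := Fintype.card_pos_iff.1 (by exact_mod_cast hn0)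
  set n : ℝ := (Fintype.card V : ℝ) with hndef
  let B1 : Finset (V → Fin M) := {χ | n / M + n / (12 * M) ≤ #(zeroClass χ)}
  let B2 : ι → Finset (V → Fin M) := fun i =>
    {χ | (#(U i ∩ zeroClass χ) : ℝ) ≤ #(U i) / M - n / (12 * M)}
  have hq : n / (12 * M) ≤ 2 * (n / M) := by
    rw [← mul_div_assoc, div_le_div_iff₀ (by positivity) hM]
    nlinarith
  have h1 : (#B1 : ℝ) ≤ (M : ℝ) ^ Fintype.card V * (1 / 2) := by
    refine (card_zeroClass_upper (by positivity) hq).trans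
      (mul_le_mul_of_nonneg_left ?_ (by positivity))
    have e : (n / (12 * M)) ^ 2 / (4 * (n / M)) = n / M / 576 := by field_simp; norm_num
    -- The tail exponent is n/(576M), so 6000M ≤ n comfortably makes it at least 1.
    have e2 : (6000 : ℝ) ≤ n / M := by rwa [le_div_iff₀ hM]
    rw [← hndef, e]
    calc Real.exp (-(n / M / 576)) ≤ Real.exp (-1) := Real.exp_le_exp.2 (by linarith)
      _ ≤ 1 / 2 := by linarith [Real.exp_neg_one_lt_d9]
  have hUn : ∀ i, (#(U i) : ℝ) ≤ n := fun i => by rw [hndef]; exact_mod_cast Finset.card_le_univ (U i)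
  have hU3 : ∀ i, 2 * n < 3 * #(U i) := fun i => by rw [hndef]; exact_mod_cast hU i
  have h2 : (#(univ.biUnion B2) : ℝ) ≤ (M : ℝ) ^ Fintype.card V * (1 / 8) := by
    calc (#(univ.biUnion B2) : ℝ) ≤ ∑ i, (#(B2 i) : ℝ) := by exact_mod_cast Finset.card_biUnion_le
      _ ≤ ∑ i, (M : ℝ) ^ Fintype.card V * Real.exp (-((#(U i) : ℝ) / (256 * M * Y))) := by
          refine Finset.sum_le_sum fun i _ => ?_
          have hu0 : (0 : ℝ) < #(U i) := by have := hU3 i; linarith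
          refine (card_zeroClass_lower (U i) (Finset.card_pos.1 (by exact_mod_cast hu0))
            (a := n / (12 * M)) (by positivity) ?_).trans
            (mul_le_mul_of_nonneg_left (Real.exp_le_exp.2 (neg_le_neg ?_)) (by positivity))
          · rw [← mul_div_assoc, div_le_div_iff₀ (by positivity) hM]
            nlinarith [hU3 i]
          · have e : (n / (12 * M)) ^ 2 / (4 * (#(U i) / M)) = n ^ 2 / (576 * M * #(U i)) := by
              field_simp; norm_num
            rw [e, div_le_div_iff₀ (by positivity) (by positivity)]
            have h4 : (#(U i) : ℝ) ^ 2 ≤ n ^ 2 := pow_le_pow_left₀ hu0.le (hUn i) 2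
            -- This is where Y ≥ 3 matters: 576 ≤ 256Y lets the same exponential sum control this
            -- final set.
            have h5 : n ^ 2 * 3 ≤ n ^ 2 * Y := mul_le_mul_of_nonneg_left hY' (by positivity)
            have h6 : (576 * (#(U i) : ℝ) ^ 2) * M ≤ (256 * (n ^ 2 * Y)) * M :=
              mul_le_mul_of_nonneg_right (by nlinarith) hM.le
            nlinarith
      _ = (M : ℝ) ^ Fintype.card V * ∑ i, Real.exp (-((#(U i) : ℝ) / (256 * M * Y))) := by
          rw [Finset.mul_sum]
      _ ≤ _ := mul_le_mul_of_nonneg_left hsum (by positivity)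
  obtain ⟨χ, hχ⟩ := exists_of_card_lt_univ (B1 ∪ univ.biUnion B2) (by
    have h3 : (#(B1 ∪ univ.biUnion B2) : ℝ) ≤ #B1 + #(univ.biUnion B2) := by
      exact_mod_cast Finset.card_union_le _ _
    have h4 : (0 : ℝ) < (M : ℝ) ^ Fintype.card V := by positivity
    simp only [Fintype.card_fun, Fintype.card_fin, Nat.cast_pow]
    linarith)
  rw [Finset.mem_union, not_or] at hχ
  refine ⟨zeroClass χ, ?_, fun i => ?_⟩
  · have := hχ.1
    simp only [B1, mem_filter, mem_univ, true_and, not_le] at this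
    have h5 : (12 * M * #(zeroClass χ) : ℝ) < 13 * n := by
      calc (12 * M * #(zeroClass χ) : ℝ) < 12 * M * (n / M + n / (12 * M)) :=
            mul_lt_mul_of_pos_left this (by positivity)
        _ = _ := by field_simp; ring
    rw [hndef] at h5
    exact_mod_cast h5.le
  · have : ¬ χ ∈ B2 i := fun h => hχ.2 (Finset.mem_biUnion.2 ⟨i, mem_univ i, h⟩)
    simp only [B2, mem_filter, mem_univ, true_and, not_le] at this
    have h5 : (7 * n : ℝ) < 12 * M * #(U i ∩ zeroClass χ) := by
      calc (7 * n : ℝ) ≤ 12 * M * (#(U i) / M - n / (12 * M)) := by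
            have : 12 * M * (#(U i) / M - n / (12 * M)) = 12 * #(U i) - n := by field_simp
            rw [this]; linarith [hU3 i]
        _ < _ := mul_lt_mul_of_pos_left this (by positivity)
    rw [hndef] at h5
    exact_mod_cast h5.le

/-- The reached sets only grow, so the summability hypothesis persists and each round may draw a
fresh sparse set. Walks are extended only from vertices outside `Z i`, which keeps their interiors
in R \ Z. A set that has passed 2n/3 stops being followed. -/
lemma exists_rounds (hG : EdgeExpander G D Y)
    (hK : Fintype.card V * Real.exp (-((K : ℝ) / (2 * M))) ≤ 1) (hDK : 3 * K * M ≤ D)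
    (hn : 4 * M ≤ Fintype.card V)
    (A Z : ι → Finset V) (hA : ∀ i, (nbrs G (A i)).Nonempty)
    (hZ : ∀ i, 16 * Y * #(Z i) ≤ #(nbrs G (A i)))
    (hsum : ∑ i, Real.exp (-((#(nbrs G (A i)) : ℝ) / (256 * M * Y))) ≤ 1 / 8) (T : ℕ) :
    ∃ (R : Finset V) (U : ι → Finset V), M * #R ≤ T * (2 * Fintype.card V) ∧
      (∀ i, nbrs G (A i) ⊆ U i) ∧ (∀ i, ∀ v ∈ U i, ReachIn G (A i) (R \ Z i) (T + 1) v) ∧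
      ∀ i, 2 * Fintype.card V < 3 * #(U i) ∨ (16 * Y + 1) ^ T ≤ (16 * Y) ^ T * #(U i) := by
  induction T with
  | zero =>
    refine ⟨∅, fun i => nbrs G (A i), by simp, fun i => subset_rfl, fun i v hv => reachIn_one hv,
      fun i => Or.inr ?_⟩
    simpa using (hA i).card_pos
  | succ T ih =>
    obtain ⟨R, U, hR, hAU, hreach, hU⟩ := ih
    have hcard : ∀ i, #(nbrs G (A i)) ≤ #(U i) := fun i => Finset.card_le_card (hAU i)
    have hsum2 : ∑ i, Real.exp (-((#(U i) : ℝ) / (256 * M * Y))) ≤ 1 / 8 := by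
      refine le_trans (Finset.sum_le_sum fun i _ => Real.exp_le_exp.2 (neg_le_neg ?_)) hsum
      exact div_le_div_of_nonneg_right (by exact_mod_cast hcard i) (by positivity)
    obtain ⟨S, hS, hgrow⟩ := exists_round hG hK hDK hn U Z (fun i => (hA i).mono (hAU i))
      (fun i => (hZ i).trans (hcard i)) hsum2
    refine ⟨R ∪ S, fun i => U i ∪ nbrs G ((U i \ Z i) ∩ S), ?_, fun i =>
      (hAU i).trans Finset.subset_union_left, fun i v hv => ?_, fun i => ?_⟩
    · have := Finset.card_union_le R S
      nlinarith
    · have hsub : R \ Z i ⊆ (R ∪ S) \ Z i := Finset.sdiff_subset_sdiff Finset.subset_union_left le_rfl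
      rcases Finset.mem_union.1 hv with hv | hv
      · exact (hreach i v hv).mono hsub (by omega)
      · obtain ⟨u, hu, huv⟩ := (mem_nbrs G).1 hv
        simp only [mem_inter, mem_sdiff] at hu
        exact ((hreach i u hu.1.1).mono hsub le_rfl).step
          (Finset.mem_sdiff.2 ⟨Finset.mem_union_right _ hu.2, hu.1.2⟩) huv
    · have hle : #(U i) ≤ #(U i ∪ nbrs G ((U i \ Z i) ∩ S)) :=
        Finset.card_le_card Finset.subset_union_left
      rcases hU i with h | h
      · left; dsimp only; omega
      · by_cases hc : 3 * #(U i) ≤ 2 * Fintype.card V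
        · right
          have h1 := hgrow i hc
          have h2 : #(U i ∪ nbrs G ((U i \ Z i) ∩ S)) =
              #(U i) + #(nbrs G ((U i \ Z i) ∩ S) \ U i) := by
            rw [← Finset.card_union_of_disjoint Finset.disjoint_sdiff, Finset.union_sdiff_self_eq_union]
          rw [h2, pow_succ, pow_succ]
          calc (16 * Y + 1) ^ T * (16 * Y + 1) ≤ (16 * Y) ^ T * #(U i) * (16 * Y + 1) :=
                Nat.mul_le_mul_right _ h
            _ = (16 * Y) ^ T * (16 * Y * #(U i) + #(U i)) := by ring
            _ ≤ (16 * Y) ^ T * (16 * Y * #(U i) +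
                  16 * Y * #(nbrs G ((U i \ Z i) ∩ S) \ U i)) :=
                Nat.mul_le_mul_left _ (Nat.add_le_add_left h1 _)
            _ = _ := by ring
        · left; dsimp only; omega

/-- Bernoulli gives (1 + 1/k)^k ≥ 2, so kX rounds of growth by 1 + 1/k multiply the size by at least
2^X. Stated without division to stay in the natural numbers. -/
lemma two_pow_le_growth {k X : ℕ} (hk : 0 < k) : 2 ^ X * k ^ (k * X) ≤ (k + 1) ^ (k * X) := by
  rw [pow_mul, pow_mul, ← mul_pow]
  refine Nat.pow_le_pow_left ?_ X
  have h := one_add_mul_le_pow (R := ℚ) (a := 1 / k) (by have : (0 : ℚ) ≤ 1 / k := by positivity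
                                                         linarith) k
  have hk' : (0 : ℚ) < k := by exact_mod_cast hk
  have h2 : (2 : ℚ) * k ^ k ≤ (k + 1) ^ k := by
    have e : (1 + (k : ℚ) * (1 / k)) = 2 := by field_simp; norm_num
    have e2 : (1 + 1 / (k : ℚ)) ^ k = (k + 1) ^ k / k ^ k := by
      rw [← div_pow]; congr 1; field_simp
    rw [e, e2, le_div_iff₀ (by positivity)] at h
    exact h
  exact_mod_cast h2

/-- A sparse reservoir through which any two sets of a given family are joined by short walks. -/
lemma exists_reservoir_family (hG : EdgeExpander G D Y)
    (hK : Fintype.card V * Real.exp (-((K : ℝ) / (2 * M))) ≤ 1) (hDK : 3 * K * M ≤ D)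
    (hn : 6000 * M ≤ Fintype.card V) {X : ℕ} (hX : Fintype.card V ≤ 2 ^ X)
    (A Z : ι → Finset V) (hA : ∀ i, (nbrs G (A i)).Nonempty)
    (hZ : ∀ i, 16 * Y * #(Z i) ≤ #(nbrs G (A i))) (hZM : ∀ i, 12 * M * #(Z i) < Fintype.card V)
    (hsum : ∑ i, Real.exp (-((#(nbrs G (A i)) : ℝ) / (256 * M * Y))) ≤ 1 / 8) :
    ∃ R : Finset V, M * #R ≤ (16 * Y * X + 1) * (2 * Fintype.card V) ∧
      ∀ i j, ∃ w ∈ R \ Z i, ReachIn G (A i) (R \ Z i) (16 * Y * X + 1) w ∧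
        ReachIn G (A j) (R \ Z j) (16 * Y * X + 1) w := by
  obtain ⟨R, U, hR, hAU, hreach, hU⟩ := exists_rounds hG hK hDK (by omega) A Z hA hZ hsum
    (16 * Y * X)
  have hY : 0 < 16 * Y := by have := hG.pos_ratio; omega
  have hM0 : 0 < M := Nat.pos_of_ne_zero (NeZero.ne M)
  have hlarge : ∀ i, 2 * Fintype.card V < 3 * #(U i) := by
    intro i
    rcases hU i with h | h
    · exact h
    · have h1 := two_pow_le_growth (k := 16 * Y) (X := X) hY
      have h2 : (16 * Y) ^ (16 * Y * X) * 2 ^ X ≤ (16 * Y) ^ (16 * Y * X) * #(U i) := by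
        rw [mul_comm]; exact h1.trans h
      have h3 := Nat.le_of_mul_le_mul_left h2 (by positivity)
      have : 0 < Fintype.card V := by omega
      omega
  have hsum2 : ∑ i, Real.exp (-((#(U i) : ℝ) / (256 * M * Y))) ≤ 1 / 8 := by
    refine le_trans (Finset.sum_le_sum fun i _ => Real.exp_le_exp.2 (neg_le_neg ?_)) hsum
    exact div_le_div_of_nonneg_right (by exact_mod_cast Finset.card_le_card (hAU i)) (by positivity)
  obtain ⟨S, hS, hmaj⟩ := exists_majority (M := M) hG.pos_ratio hn U hlarge hsum2
  refine ⟨R ∪ S, ?_, fun i j => ?_⟩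
  · have := Finset.card_union_le R S
    have h1 : M * #S ≤ 2 * Fintype.card V := by nlinarith
    nlinarith
  -- In units of n/(12M), two subsets of S of size at least 7, inside a set of size at most 13,
  -- share at least 1, which exceeds |Z|.
  · have h1 : 12 * M * #(Z i) < 12 * M * #((U i ∩ S) ∩ (U j ∩ S)) := by
      have h2 := Finset.card_union_add_card_inter (U i ∩ S) (U j ∩ S)
      have h3 : #((U i ∩ S) ∪ (U j ∩ S)) ≤ #S :=
        Finset.card_le_card (Finset.union_subset Finset.inter_subset_right Finset.inter_subset_right)
      have h4 := hmaj i
      have h5 := hmaj j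
      have h6 := hZM i
      nlinarith
    have h2 : #(Z i) < #((U i ∩ S) ∩ (U j ∩ S)) := Nat.lt_of_mul_lt_mul_left h1
    obtain ⟨w, hw, hwZ⟩ := Finset.exists_mem_notMem_of_card_lt_card h2
    simp only [mem_inter] at hw
    refine ⟨w, Finset.mem_sdiff.2 ⟨Finset.mem_union_right _ hw.1.2, hwZ⟩, ?_, ?_⟩
    · exact (hreach i w hw.1.1).mono
        (Finset.sdiff_subset_sdiff Finset.subset_union_left le_rfl) le_rfl
    · exact (hreach j w hw.2.1).mono
        (Finset.sdiff_subset_sdiff Finset.subset_union_left le_rfl) le_rfl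

end Reservoir
end ExpanderCycle

namespace ExpanderCycle
open Finset
open scoped Classical

/-! ### Paths recorded by their vertex sets. -/

section PathOn

variable {V : Type*} {G : SimpleGraph V}

/-- There is a path from `a` to `b` whose vertex set is `S`. -/
def PathOn (G : SimpleGraph V) (a b : V) (S : Finset V) : Prop :=
  ∃ p : G.Walk a b, p.IsPath ∧ p.support.toFinset = S

lemma PathOn.left_mem {a b : V} {S : Finset V} (h : PathOn G a b S) : a ∈ S := by
  obtain ⟨p, -, rfl⟩ := h
  simp

lemma PathOn.right_mem {a b : V} {S : Finset V} (h : PathOn G a b S) : b ∈ S := by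
  obtain ⟨p, -, rfl⟩ := h
  simp

lemma PathOn.symm {a b : V} {S : Finset V} (h : PathOn G a b S) : PathOn G b a S := by
  obtain ⟨p, hp, rfl⟩ := h
  exact ⟨p.reverse, hp.reverse, by simp⟩

lemma PathOn.refl (a : V) : PathOn G a a {a} :=
  ⟨.nil, by simp, by simp⟩

lemma PathOn.of_adj {a b : V} (h : G.Adj a b) : PathOn G a b {a, b} :=
  ⟨h.toWalk, by simp [h.ne], by simp⟩

lemma PathOn.trans {a b c : V} {S T : Finset V} (h : PathOn G a b S) (h' : PathOn G b c T)
    (hST : ∀ x ∈ S, x ∈ T → x = b) : PathOn G a c (S ∪ T) := by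
  obtain ⟨p, hp, rfl⟩ := h
  obtain ⟨q, hq, rfl⟩ := h'
  refine ⟨p.append q, ?_, ?_⟩
  · rw [SimpleGraph.Walk.isPath_def, SimpleGraph.Walk.support_append, List.nodup_append]
    have hq' := hq.support_nodup
    rw [← SimpleGraph.Walk.cons_tail_support, List.nodup_cons] at hq'
    refine ⟨hp.support_nodup, hq'.2, fun x hx y hy hxy => ?_⟩
    subst hxy
    have := hST x (by simpa using hx) (by simpa using List.mem_of_mem_tail hy)
    exact hq'.1 (this ▸ hy)
  · ext x
    simp [SimpleGraph.Walk.mem_support_append_iff]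

lemma exists_pathOn_of_walk {a b : V} (p : G.Walk a b) :
    ∃ S : Finset V, PathOn G a b S ∧ #S ≤ p.length + 1 ∧ ∀ x ∈ S, x ∈ p.support := by
  refine ⟨p.bypass.support.toFinset, ⟨p.bypass, p.bypass_isPath, rfl⟩, ?_, fun x hx => ?_⟩
  · refine (List.toFinset_card_le _).trans ?_
    rw [SimpleGraph.Walk.length_support]
    exact Nat.add_le_add_right p.length_bypass_le_length 1
  · exact p.support_bypass_subset_support (List.mem_toFinset.1 hx)

end PathOn

/-! ### Universal reservoirs: one sparse set for all source sets and all small obstacles. -/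

section Reservoir

variable {V : Type*} [Fintype V] {G : SimpleGraph V} {D K M Y : ℕ} [NeZero M]

/-- Applies the family version to all admissible pairs (A, Z) at once. Half of the exponent
|N(A)|/(256MY) pays for the choice of A and half for the choice of Z, whence the 512 in the
hypotheses. The sum over pairs factorises into two binomial sums. -/
lemma exists_reservoir (hG : EdgeExpander G D Y)
    (hK : Fintype.card V * Real.exp (-((K : ℝ) / (2 * M))) ≤ 1) (hDK : 3 * K * M ≤ D)
    (hn : 6000 * M ≤ Fintype.card V) {X : ℕ} (hX : Fintype.card V ≤ 2 ^ X) {k z : ℕ} (hk0 : 0 < k)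
    (hk : Fintype.card V * Real.exp (-((k : ℝ) / (512 * M * Y))) ≤ 1 / 200)
    (hz : Fintype.card V * Real.exp (-((z : ℝ) / (512 * M * Y))) ≤ 1)
    (hzY : 16 * Y ≤ z) (hzM : 12 * M < z) :
    ∃ R : Finset V, M * #R ≤ (16 * Y * X + 1) * (2 * Fintype.card V) ∧
      ∀ A B Z : Finset V, A.Nonempty → B.Nonempty → k * #A ≤ #(nbrs G A) →
        k * #B ≤ #(nbrs G B) → z * #Z ≤ #(nbrs G A) → z * #Z ≤ #(nbrs G B) →
        ∃ a ∈ A, ∃ b ∈ B, ∃ p : G.Walk a b, p.length ≤ 2 * (16 * Y * X + 1) ∧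
          ∀ x ∈ p.support, x = a ∨ x = b ∨ x ∈ R \ Z := by
  let P : Finset V × Finset V → Prop := fun i =>
    i.1.Nonempty ∧ k * #i.1 ≤ #(nbrs G i.1) ∧ z * #i.2 ≤ #(nbrs G i.1)
  let ι := {i : Finset V × Finset V // P i}
  have hM0 : 0 < M := Nat.pos_of_ne_zero (NeZero.ne M)
  have hM : (0 : ℝ) < M := by exact_mod_cast hM0
  have hY : (0 : ℝ) < Y := by have := hG.pos_ratio; exact_mod_cast (by omega : 0 < Y)
  have hA : ∀ i : ι, (nbrs G i.1.1).Nonempty := by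
    rintro ⟨⟨A, Z⟩, h1, h2, h3⟩
    rw [← Finset.card_pos]
    exact (Nat.mul_pos hk0 h1.card_pos).trans_le h2
  have hsum : ∑ i : ι, Real.exp (-((#(nbrs G i.1.1) : ℝ) / (256 * M * Y))) ≤ 1 / 8 := by
    set r := Real.exp (-((k : ℝ) / (512 * M * Y))) with hr
    set s := Real.exp (-((z : ℝ) / (512 * M * Y))) with hs
    have hr0 : 0 < r := Real.exp_pos _
    have hs0 : 0 < s := Real.exp_pos _
    let g : Finset V × Finset V → ℝ := fun i => (if i.1 = ∅ then 0 else r ^ #i.1) * s ^ #i.2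
    have hg0 : ∀ i, 0 ≤ g i := fun i => by dsimp [g]; split_ifs <;> positivity
    have h1 : ∀ i : ι, Real.exp (-((#(nbrs G i.1.1) : ℝ) / (256 * M * Y))) ≤ g i.1 := by
      rintro ⟨⟨A, Z⟩, h1, h2, h3⟩
      dsimp only at h1 h2 h3
      simp only [g, h1.ne_empty, if_false]
      rw [hr, hs, ← Real.exp_nat_mul, ← Real.exp_nat_mul, ← Real.exp_add, Real.exp_le_exp]
      have e2 : (k * #A : ℝ) ≤ #(nbrs G A) := by exact_mod_cast h2
      have e3 : (z * #Z : ℝ) ≤ #(nbrs G A) := by exact_mod_cast h3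
      have : (#A : ℝ) * -((k : ℝ) / (512 * M * Y)) + #Z * -((z : ℝ) / (512 * M * Y)) =
          -((k * #A + z * #Z) / (512 * M * Y)) := by ring
      rw [this, neg_le_neg_iff, div_le_div_iff₀ (by positivity) (by positivity)]
      have : (0 : ℝ) ≤ M * Y := by positivity
      nlinarith
    calc ∑ i : ι, Real.exp (-((#(nbrs G i.1.1) : ℝ) / (256 * M * Y))) ≤ ∑ i : ι, g i.1 :=
          Finset.sum_le_sum fun i _ => h1 i
      _ = ∑ i ∈ univ.filter P, g i := by
          rw [Finset.sum_subtype (univ.filter P) (p := P) (by simp)]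
      _ ≤ ∑ i, g i := Finset.sum_le_sum_of_subset_of_nonneg (Finset.subset_univ _)
          fun i _ _ => hg0 i
      _ = (∑ A : Finset V, if A = ∅ then 0 else r ^ #A) * ∑ Z : Finset V, s ^ #Z := by
          rw [Fintype.sum_prod_type, Finset.sum_mul_sum]
      _ ≤ (1 / 50) * 3 := by
          refine mul_le_mul ?_ ?_ (Finset.sum_nonneg fun _ _ => by positivity) (by norm_num)
          -- Excluding A = ∅ is essential: its term alone is 1, whereas (1 + r)^n - 1 is small.
          · have e : ∑ A : Finset V, (if A = ∅ then (0 : ℝ) else r ^ #A) =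
                ∑ A : Finset V, r ^ #A - 1 := by
              rw [eq_sub_iff_add_eq, ← Finset.add_sum_erase univ _ (Finset.mem_univ ∅),
                ← Finset.add_sum_erase univ (fun A => r ^ #A) (Finset.mem_univ ∅)]
              simp only [if_true, Finset.card_empty, pow_zero]
              have : ∑ x ∈ univ.erase (∅ : Finset V), (if x = ∅ then (0 : ℝ) else r ^ #x) =
                  ∑ x ∈ univ.erase (∅ : Finset V), r ^ #x :=
                Finset.sum_congr rfl fun x hx => if_neg (Finset.ne_of_mem_erase hx)
              rw [this]; ring
            rw [e, sum_pow_card]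
            have h2 : (1 + r) ^ Fintype.card V ≤ Real.exp (Fintype.card V * r) := by
              rw [Real.exp_nat_mul]
              refine pow_le_pow_left₀ (by positivity) ?_ _
              rw [add_comm]; exact Real.add_one_le_exp r
            have h3 : Real.exp (Fintype.card V * r) ≤ Real.exp (1 / 200) := Real.exp_le_exp.2 hk
            have h4 := (abs_le.1 (Real.abs_exp_sub_one_sub_id_le (x := 1 / 200)
              (by norm_num [abs_of_pos]))).2
            norm_num at h4
            linarith
          · rw [sum_pow_card]
            exact one_add_pow_le_three hs0.le hz
      _ ≤ 1 / 8 := by norm_num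
  obtain ⟨R, hR, hconn⟩ := exists_reservoir_family (ι := ι) hG hK hDK hn hX (fun i => i.1.1)
    (fun i => i.1.2) hA
    (fun i => (Nat.mul_le_mul_right _ hzY).trans i.2.2.2)
    (fun i => by
      have h1 := (i.2.2.2).trans (Finset.card_le_univ _)
      rcases Nat.eq_zero_or_pos #i.1.2 with h | h
      · rw [h]; omega
      · exact (Nat.mul_lt_mul_of_pos_right hzM h).trans_le h1) hsum
  refine ⟨R, hR, fun A B Z hA0 hB0 hkA hkB hzA hzB => ?_⟩
  obtain ⟨w, hw, ⟨a, ha, p, hp, hps⟩, ⟨b, hb, q, hq, hqs⟩⟩ :=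
    hconn ⟨(A, Z), hA0, hkA, hzA⟩ ⟨(B, Z), hB0, hkB, hzB⟩
  dsimp only at hw ha hb hps hqs
  refine ⟨a, ha, b, hb, p.append q.reverse, ?_, fun x hx => ?_⟩
  · rw [SimpleGraph.Walk.length_append, SimpleGraph.Walk.length_reverse]; omega
  · rw [SimpleGraph.Walk.mem_support_append_iff, SimpleGraph.Walk.support_reverse,
      List.mem_reverse] at hx
    rcases hx with hx | hx
    · rcases hps x hx with h | h | h
      exacts [Or.inl h, Or.inr (Or.inr (h ▸ hw)), Or.inr (Or.inr h)]
    · rcases hqs x hx with h | h | h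
      exacts [Or.inr (Or.inl h), Or.inr (Or.inr (h ▸ hw)), Or.inr (Or.inr h)]

/-- A reservoir joins any two vertices, and any two large sets, while avoiding a small set. -/
lemma exists_reservoir_paths (hG : EdgeExpander G D Y)
    (hK : Fintype.card V * Real.exp (-((K : ℝ) / (2 * M))) ≤ 1) (hDK : 3 * K * M ≤ D)
    (hn : 6000 * M ≤ Fintype.card V) {X : ℕ} (hX : Fintype.card V ≤ 2 ^ X) {k z : ℕ} (hk0 : 0 < k)
    (hk : Fintype.card V * Real.exp (-((k : ℝ) / (512 * M * Y))) ≤ 1 / 200)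
    (hz : Fintype.card V * Real.exp (-((z : ℝ) / (512 * M * Y))) ≤ 1)
    (hzY : 16 * Y ≤ z) (hzM : 12 * M < z)
    (hδ : ∀ v, D ≤ 3 * dg G v univ) (hkD : 6 * k ≤ D) :
    ∃ R : Finset V, M * #R ≤ (16 * Y * X + 1) * (2 * Fintype.card V) ∧
      (∀ x y Z, 3 * z * #Z ≤ D → ∃ S, PathOn G x y S ∧ #S ≤ 2 * (16 * Y * X + 1) + 1 ∧
        ∀ v ∈ S, v = x ∨ v = y ∨ v ∈ R \ Z) ∧
      ∀ A B Z : Finset V, A.Nonempty → B.Nonempty → 6 * z * #Z ≤ #A → 6 * z * #Z ≤ #B →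
        ∃ a ∈ A, ∃ b ∈ B, ∃ S, PathOn G a b S ∧ #S ≤ 2 * (16 * Y * X + 1) + 1 ∧
          ∀ x ∈ S, x = a ∨ x = b ∨ x ∈ R \ Z := by
  obtain ⟨R, hR, hconn⟩ := exists_reservoir hG hK hDK hn hX hk0 hk hz hzY hzM
  have hpath : ∀ {a b : V} {Z : Finset V} (p : G.Walk a b), p.length ≤ 2 * (16 * Y * X + 1) →
      (∀ x ∈ p.support, x = a ∨ x = b ∨ x ∈ R \ Z) →
      ∃ S, PathOn G a b S ∧ #S ≤ 2 * (16 * Y * X + 1) + 1 ∧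
          ∀ x ∈ S, x = a ∨ x = b ∨ x ∈ R \ Z := by
    intro a b Z p hp hs
    obtain ⟨S, hS, hcard, hsub⟩ := exists_pathOn_of_walk p
    exact ⟨S, hS, by omega, fun x hx => hs x (hsub x hx)⟩
  refine ⟨R, hR, fun x y Z hZ => ?_, fun A B Z hA hB hZA hZB => ?_⟩
  · have h1 : ∀ v, k * #{v} ≤ #(nbrs G {v}) ∧ z * #Z ≤ #(nbrs G {v}) := by
      intro v
      rw [card_nbrs_singleton, Finset.card_singleton]
      have := hδ v
      constructor
      · omega
      · nlinarith
    obtain ⟨a, ha, b, hb, p, hp, hs⟩ := hconn {x} {y} Z (by simp) (by simp) (h1 x).1 (h1 y).1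
      (h1 x).2 (h1 y).2
    rw [Finset.mem_singleton] at ha hb
    subst ha hb
    exact hpath p hp hs
  -- A itself need not expand by the factor k. The greedy cover gives a subset Q that does and still
  -- sees at least |A|/6 vertices.
  · have h1 : ∀ A : Finset V, A.Nonempty → 6 * z * #Z ≤ #A → ∃ Q ⊆ A, Q.Nonempty ∧
        k * #Q ≤ #(nbrs G Q) ∧ z * #Z ≤ #(nbrs G Q) := by
      intro A hA hZA
      obtain ⟨Q, hQ, h2, h3⟩ := exists_greedy_cover (K := k) G hG.degree_le univ A
        (fun w _ => by have := hδ w; omega)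
      rw [Finset.inter_univ] at h2 h3
      have h4 : D * #A ≤ 3 * ∑ w ∈ A, dg G w univ := by
        rw [Finset.mul_sum, mul_comm, ← smul_eq_mul]
        exact Finset.card_nsmul_le_sum _ _ _ fun w _ => hδ w
      have h5 : #A ≤ 6 * #(nbrs G Q) := by
        have : D * #A ≤ D * (6 * #(nbrs G Q)) := by nlinarith
        exact Nat.le_of_mul_le_mul_left this hG.pos_degree
      refine ⟨Q, hQ, ?_, h2, by nlinarith⟩
      rw [Finset.nonempty_iff_ne_empty]
      rintro rfl
      have : nbrs G (∅ : Finset V) = ∅ := by simp [nbrs]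
      rw [this, Finset.card_empty] at h5
      have := hA.card_pos
      omega
    obtain ⟨A', hA', hA0, hkA, hzA⟩ := h1 A hA hZA
    obtain ⟨B', hB', hB0, hkB, hzB⟩ := h1 B hB hZB
    obtain ⟨a, ha, b, hb, p, hp, hs⟩ := hconn A' B' Z hA0 hB0 hkA hkB hzA hzB
    exact ⟨a, hA' ha, b, hB' hb, hpath p hp hs⟩

end Reservoir
end ExpanderCycle

namespace ExpanderCycle
open Finset
open scoped Classical

/-! ### Random layers with degree-proportional membership. -/

section Layers

variable {V : Type*} [Fintype V] {G : SimpleGraph V}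

/-- Realises probability d/(lD) by uniform colours: the first coordinate names the layer and the
second thins in proportion to d. -/
lemma card_layer_colours {l D d i : ℕ} (hi : i < l) (hd : d ≤ D) :
    #{c : Fin l × Fin D | c.1.val = i ∧ c.2.val < d} = d := by
  have : ({c : Fin l × Fin D | c.1.val = i ∧ c.2.val < d} : Finset _) =
      ({⟨i, hi⟩} : Finset (Fin l)) ×ˢ ({j : Fin D | j.val < d} : Finset (Fin D)) := by
    ext c
    simp only [mem_filter, mem_univ, true_and, mem_product, mem_singleton, Fin.ext_iff]
  rw [this, Finset.card_product, Finset.card_singleton, one_mul, Fin.card_filter_val_lt]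
  exact min_eq_right hd

/-- A layering in which each vertex `v` of `N` sees each layer in proportion to its degree, where
the neighbours are weighted by their inverse degrees. -/
lemma exists_layers {D l : ℕ} {η : ℝ} (hl : 0 < l) (hD0 : 0 < D) (hη0 : 0 < η) (hη1 : η ≤ 1)
    (N : Finset V) (hN : N.Nonempty) (hD : ∀ v ∈ N, dg G v N ≤ D)
    (hδ : ∀ v ∈ N, D ≤ 3 * dg G v N)
    (hexp : 2 * (l * (Fintype.card V + 1)) * Real.exp (-(η ^ 2 * D / (36 * l))) < 1) :
    ∃ L : ℕ → Finset V, (∀ i, L i ⊆ N) ∧ (∀ i j, i ≠ j → Disjoint (L i) (L j)) ∧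
      (∀ v ∈ N, ∀ i < l, (1 - η) * (dg G v N / (D * l)) ≤ ∑ u ∈ L i with G.Adj v u, 1 / (dg G u N : ℝ) ∧
        ∑ u ∈ L i with G.Adj v u, 1 / (dg G u N : ℝ) ≤ (1 + η) * (dg G v N / (D * l))) ∧
      ∀ i < l, (1 - η) * ((∑ v ∈ N, dg G v N : ℕ) / (D * l)) ≤ #(L i) ∧
        #(L i) ≤ (1 + η) * (((∑ v ∈ N, dg G v N : ℕ) : ℝ) / (D * l)) := by
  have hl' : (0 : ℝ) < l := by exact_mod_cast hl
  have hD' : (0 : ℝ) < D := by exact_mod_cast hD0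
  have hdpos : ∀ v ∈ N, (0 : ℝ) < dg G v N := fun v hv => by
    have := hδ v hv; exact_mod_cast (by omega : 0 < dg G v N)
  have hδ' : ∀ v ∈ N, (D : ℝ) ≤ 3 * dg G v N := fun v hv => by exact_mod_cast hδ v hv
  let C := Fin l × Fin D
  have : Nonempty C := ⟨(⟨0, hl⟩, ⟨0, hD0⟩)⟩
  have hC : (Fintype.card C : ℝ) = l * D := by simp [C]
  -- A vertex u enters a given layer with probability d(u)/(Dl), so a neighbour of weight 1/d(u) has
  -- expected contribution exactly 1/(Dl), independent of u. In `X` the weight is multiplied by D/3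
  -- to lie in [0,1], since D ≤ 3d(u).
  let L : (V → C) → ℕ → Finset V := fun χ i => {u ∈ N | (χ u).1.val = i ∧ (χ u).2.val < dg G u N}
  let X : V → ℕ → V → C → ℝ := fun v i u c =>
    if (u ∈ N ∧ G.Adj v u) ∧ (c.1.val = i ∧ c.2.val < dg G u N) then D / (3 * dg G u N) else 0
  let Y : ℕ → V → C → ℝ := fun i u c =>
    if u ∈ N ∧ (c.1.val = i ∧ c.2.val < dg G u N) then 1 else 0
  have hX0 : ∀ v i u c, 0 ≤ X v i u c := fun v i u c => by dsimp [X]; split_ifs <;> positivity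
  have hX1 : ∀ v i u c, X v i u c ≤ 1 := fun v i u c => by
    dsimp [X]; split_ifs with h
    · have := hdpos u h.1.1
      rw [div_le_one (by positivity)]
      exact hδ' u h.1.1
    · norm_num
  have hXs : ∀ v i χ, ∑ u, X v i u (χ u) = D / 3 * ∑ u ∈ L χ i with G.Adj v u, 1 / (dg G u N : ℝ) := by
    intro v i χ
    rw [Finset.mul_sum, ← Finset.sum_filter]
    refine Finset.sum_congr ?_ fun u hu => ?_
    · ext u; simp only [L, mem_filter, mem_univ, true_and]; tauto
    · field_simp
  have hXm : ∀ v ∈ N, ∀ i < l, (dg G v N : ℝ) / (3 * l) =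
      ∑ u, (∑ c, X v i u c) / Fintype.card C := by
    intro v hv i hi
    have h1 : ∀ u, (∑ c, X v i u c) / Fintype.card C =
        if u ∈ N ∧ G.Adj v u then 1 / (3 * l : ℝ) else 0 := by
      intro u
      by_cases hu : u ∈ N ∧ G.Adj v u
      · simp only [X, hu, if_true, true_and]
        rw [← Finset.sum_filter, Finset.sum_const, card_layer_colours hi (hD u hu.1), hC]
        have := hdpos u hu.1
        rw [nsmul_eq_mul]
        field_simp
      · simp [X, hu]
    simp only [h1]
    rw [← Finset.sum_filter, Finset.sum_const, nsmul_eq_mul]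
    have : #{u : V | u ∈ N ∧ G.Adj v u} = dg G v N := by
      unfold dg; congr 1; ext u; simp
    rw [this]; ring
  have hY0 : ∀ i u c, 0 ≤ Y i u c := fun i u c => by dsimp [Y]; split_ifs <;> positivity
  have hY1 : ∀ i u c, Y i u c ≤ 1 := fun i u c => by dsimp [Y]; split_ifs <;> norm_num
  have hYs : ∀ i χ, ∑ u, Y i u (χ u) = #(L χ i) := by
    intro i χ
    rw [Finset.sum_boole]
    congr 2
    ext u; simp [L]
  set σ : ℝ := ((∑ v ∈ N, dg G v N : ℕ) : ℝ) / (D * l) with hσ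
  have hYm : ∀ i < l, σ = ∑ u, (∑ c, Y i u c) / Fintype.card C := by
    intro i hi
    have h1 : ∀ u, (∑ c, Y i u c) / Fintype.card C =
        if u ∈ N then (dg G u N : ℝ) / (D * l) else 0 := by
      intro u
      by_cases hu : u ∈ N
      · simp only [Y, hu, if_true, true_and]
        rw [← Finset.sum_filter, Finset.sum_const, card_layer_colours hi (hD u hu), hC]
        rw [nsmul_eq_mul, mul_one, mul_comm (l : ℝ)]
      · simp [Y, hu]
    simp only [h1]
    rw [← Finset.sum_filter, hσ]
    push_cast
    rw [Finset.sum_div]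
    refine Finset.sum_congr (by ext; simp) fun _ _ => rfl
  have hσD : (D : ℝ) / (9 * l) ≤ σ := by
    obtain ⟨v0, hv0⟩ := hN
    have h1 : D ≤ 3 * #N := (hδ v0 hv0).trans (Nat.mul_le_mul_left _ (Finset.card_filter_le _ _))
    have h2 : D * #N ≤ 3 * ∑ v ∈ N, dg G v N := by
      rw [Finset.mul_sum, mul_comm, ← smul_eq_mul]
      exact Finset.card_nsmul_le_sum _ _ _ hδ
    have h3 : D * D ≤ 9 * ∑ v ∈ N, dg G v N := by nlinarith
    have h3' : (D * D : ℝ) ≤ 9 * (∑ v ∈ N, dg G v N : ℕ) := by exact_mod_cast h3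
    rw [hσ, div_le_div_iff₀ (by positivity) (by positivity)]
    nlinarith
  have hσ0 : 0 < σ := lt_of_lt_of_le (by positivity) hσD
  set e := Real.exp (-(η ^ 2 * D / (36 * l))) with he
  -- Every mean considered, both the weighted degrees and the layer sizes, is at least D/(9l), so a
  -- single exponential bound serves the whole union bound.
  have tail : ∀ {μ : ℝ}, (D : ℝ) / (9 * l) ≤ μ → Real.exp (-((η * μ) ^ 2 / (4 * μ))) ≤ e := by
    intro μ hμ
    have hμ0 : 0 < μ := lt_of_lt_of_le (by positivity) hμ
    rw [he, Real.exp_le_exp, neg_le_neg_iff]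
    have e1 : (η * μ) ^ 2 / (4 * μ) = η ^ 2 / 4 * μ := by field_simp
    have e2 : η ^ 2 * D / (36 * l) = η ^ 2 / 4 * (D / (9 * l)) := by field_simp; norm_num
    rw [e1, e2]
    exact mul_le_mul_of_nonneg_left hμ (by positivity)
  set Tot : ℝ := (Fintype.card C : ℝ) ^ Fintype.card V with hTot
  have hTot0 : 0 < Tot := by
    have : 0 < (Fintype.card C : ℝ) := by rw [hC]; positivity
    positivity
  let μ : V → ℝ := fun v => (dg G v N : ℝ) / (3 * l)
  have hμD : ∀ v ∈ N, (D : ℝ) / (9 * l) ≤ μ v := by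
    intro v hv
    dsimp only [μ]
    rw [div_le_div_iff₀ (by positivity) (by positivity)]
    nlinarith [hδ' v hv]
  let B1 : V × ℕ → Finset (V → C) := fun a =>
    ({χ | μ a.1 + η * μ a.1 ≤ ∑ u, X a.1 a.2 u (χ u)} : Finset (V → C)) ∪
    ({χ | ∑ u, X a.1 a.2 u (χ u) ≤ μ a.1 - η * μ a.1} : Finset (V → C))
  let B2 : ℕ → Finset (V → C) := fun i =>
    ({χ | σ + η * σ ≤ ∑ u, Y i u (χ u)} : Finset (V → C)) ∪
    ({χ | ∑ u, Y i u (χ u) ≤ σ - η * σ} : Finset (V → C))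
  have hB1 : ∀ a ∈ N ×ˢ range l, (#(B1 a) : ℝ) ≤ 2 * (Tot * e) := by
    rintro ⟨v, i⟩ ha
    rw [Finset.mem_product, Finset.mem_range] at ha
    have hμ0 : 0 < μ v := lt_of_lt_of_le (by positivity) (hμD v ha.1)
    have h1 := card_upper_tail (X v i) (hX0 v i) (hX1 v i) (hXm v ha.1 i ha.2) hμ0
      (a := η * μ v) (by positivity) (by change η * μ v ≤ 2 * μ v; nlinarith)
    have h2 := card_lower_tail (X v i) (hX0 v i) (hX1 v i) (hXm v ha.1 i ha.2) hμ0
      (a := η * μ v) (by positivity) (by change η * μ v ≤ 2 * μ v; nlinarith)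
    have h3 := mul_le_mul_of_nonneg_left (tail (hμD v ha.1)) hTot0.le
    have h4 : (#(B1 (v, i)) : ℝ) ≤ _ := Nat.cast_le.2 (Finset.card_union_le _ _)
    push_cast at h4
    refine h4.trans ((add_le_add h1 h2).trans ?_)
    dsimp only [μ] at h3
    linarith
  have hB2 : ∀ i ∈ range l, (#(B2 i) : ℝ) ≤ 2 * (Tot * e) := by
    intro i hi
    rw [Finset.mem_range] at hi
    have h1 := card_upper_tail (Y i) (hY0 i) (hY1 i) (hYm i hi) hσ0
      (a := η * σ) (by positivity) (by nlinarith)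
    have h2 := card_lower_tail (Y i) (hY0 i) (hY1 i) (hYm i hi) hσ0
      (a := η * σ) (by positivity) (by nlinarith)
    have h3 := mul_le_mul_of_nonneg_left (tail hσD) hTot0.le
    have h4 : (#(B2 i) : ℝ) ≤ _ := Nat.cast_le.2 (Finset.card_union_le _ _)
    push_cast at h4
    refine h4.trans ((add_le_add h1 h2).trans ?_)
    linarith
  obtain ⟨χ, hχ⟩ := exists_of_card_lt_univ ((N ×ˢ range l).biUnion B1 ∪ (range l).biUnion B2) (by
    have h1 : (#((N ×ˢ range l).biUnion B1) : ℝ) ≤ #N * l * (2 * (Tot * e)) := by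
      have : (#((N ×ˢ range l).biUnion B1) : ℝ) ≤ ∑ a ∈ N ×ˢ range l, (#(B1 a) : ℝ) := by
        exact_mod_cast Finset.card_biUnion_le
      refine this.trans ((Finset.sum_le_card_nsmul _ _ _ hB1).trans (le_of_eq ?_))
      rw [Finset.card_product, Finset.card_range, nsmul_eq_mul]
      push_cast; ring
    have h2 : (#((range l).biUnion B2) : ℝ) ≤ l * (2 * (Tot * e)) := by
      have : (#((range l).biUnion B2) : ℝ) ≤ ∑ a ∈ range l, (#(B2 a) : ℝ) := by
        exact_mod_cast Finset.card_biUnion_le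
      refine this.trans ((Finset.sum_le_card_nsmul _ _ _ hB2).trans (le_of_eq ?_))
      rw [Finset.card_range, nsmul_eq_mul]
    have h3 : (#((N ×ˢ range l).biUnion B1 ∪ (range l).biUnion B2) : ℝ) ≤
        #((N ×ˢ range l).biUnion B1) + #((range l).biUnion B2) := by
      exact_mod_cast Finset.card_union_le _ _
    have h4 : (#N : ℝ) ≤ Fintype.card V := by exact_mod_cast Finset.card_le_univ N
    have h5 : (Fintype.card (V → C) : ℝ) = Tot := by
      rw [Fintype.card_fun, Nat.cast_pow]
    rw [h5]
    have he0 : 0 < e := Real.exp_pos _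
    calc _ ≤ #N * l * (2 * (Tot * e)) + l * (2 * (Tot * e)) := by linarith
      _ ≤ Fintype.card V * l * (2 * (Tot * e)) + l * (2 * (Tot * e)) := by gcongr
      _ = Tot * (2 * (l * (Fintype.card V + 1)) * e) := by ring
      _ < Tot * 1 := mul_lt_mul_of_pos_left hexp hTot0
      _ = Tot := mul_one _)
  rw [Finset.mem_union, not_or] at hχ
  refine ⟨L χ, fun i => Finset.filter_subset _ _, fun i j hij => ?_, fun v hv i hi => ?_,
    fun i hi => ?_⟩
  · rw [Finset.disjoint_left]
    intro u hu hu'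
    simp only [L, mem_filter] at hu hu'
    exact hij (hu.2.1.symm.trans hu'.2.1)
  · have h : χ ∉ B1 (v, i) := fun h => hχ.1 (Finset.mem_biUnion.2 ⟨(v, i), by simp [hv, hi], h⟩)
    simp only [B1, mem_union, mem_filter, mem_univ, true_and, not_or, not_le, hXs, μ] at h
    have e1 : (dg G v N : ℝ) / (3 * l) = D / 3 * (dg G v N / (D * l)) := by field_simp
    have hD3 : (0 : ℝ) < D / 3 := by positivity
    constructor
    · refine le_of_mul_le_mul_left ?_ hD3
      have := h.2; rw [e1] at this; linarith
    · refine le_of_mul_le_mul_left ?_ hD3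
      have := h.1; rw [e1] at this; linarith
  · have h : χ ∉ B2 i := fun h => hχ.2 (Finset.mem_biUnion.2 ⟨i, by simp [hi], h⟩)
    simp only [B2, mem_union, mem_filter, mem_univ, true_and, not_or, not_le, hYs] at h
    constructor
    · have := h.2; linarith
    · have := h.1; linarith

end Layers

/-! ### Matching consecutive layers to obtain many disjoint paths. -/

section PathCover

variable {V : Type*} [Fintype V] {G : SimpleGraph V}

/-- Hall's theorem with deficiency. -/
lemma exists_matching_of_deficiency (A B : Finset V) {δ : ℕ}
    (h : ∀ S ⊆ A, #S ≤ #(nbrs G S ∩ B) + δ) :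
    ∃ A' ⊆ A, ∃ f : V → V, Set.InjOn f A' ∧ (∀ a ∈ A', f a ∈ B ∧ G.Adj a (f a)) ∧
      #A ≤ #A' + δ := by
  -- Adding δ dummy vertices joined to all of A restores Hall's condition; at most δ vertices are
  -- then matched to dummies.
  let t : A → Finset (V ⊕ Fin δ) := fun a => (nbrs G {a.1} ∩ B).disjSum univ
  have hall : ∀ S : Finset A, #S ≤ #(S.biUnion t) := by
    intro S
    rcases S.eq_empty_or_nonempty with rfl | hS
    · simp
    have h1 := h (S.map (Function.Embedding.subtype _)) (fun x hx => by
      obtain ⟨a, -, rfl⟩ := Finset.mem_map.1 hx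
      exact a.2)
    rw [Finset.card_map] at h1
    have h2 : (nbrs G (S.map (Function.Embedding.subtype _)) ∩ B).disjSum (univ : Finset (Fin δ)) ⊆
        S.biUnion t := by
      intro x hx
      rw [Finset.mem_biUnion]
      rcases x with x | x
      · rw [Finset.inl_mem_disjSum, Finset.mem_inter, mem_nbrs] at hx
        obtain ⟨⟨a, ha, hax⟩, hxB⟩ := hx
        obtain ⟨a, haS, rfl⟩ := Finset.mem_map.1 ha
        exact ⟨a, haS, Finset.inl_mem_disjSum.2
          (Finset.mem_inter.2 ⟨(mem_nbrs G).2 ⟨a.1, by simp, hax⟩, hxB⟩)⟩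
      · obtain ⟨a, ha⟩ := hS
        exact ⟨a, ha, Finset.inr_mem_disjSum.2 (mem_univ _)⟩
    have h3 := Finset.card_le_card h2
    rw [Finset.card_disjSum, Finset.card_univ, Fintype.card_fin] at h3
    omega
  obtain ⟨g, hg, hgt⟩ := (Finset.all_card_le_biUnion_card_iff_exists_injective t).1 hall
  let A1 : Finset A := {a | (g a).isLeft}
  let F : V → V := fun v => if hv : v ∈ A then (g ⟨v, hv⟩).elim id (fun _ => v) else v
  have hF : ∀ a : A, ∀ y, g a = Sum.inl y → F a = y := by
    intro a y hy
    simp [F, hy]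
  refine ⟨A1.map (Function.Embedding.subtype _), fun x hx => ?_, F, ?_, fun a ha => ?_, ?_⟩
  · obtain ⟨a, -, rfl⟩ := Finset.mem_map.1 hx
    exact a.2
  · intro x hx y hy hxy
    obtain ⟨a, ha, rfl⟩ := Finset.mem_map.1 hx
    obtain ⟨b, hb, rfl⟩ := Finset.mem_map.1 hy
    simp only [A1, mem_filter, mem_univ, true_and] at ha hb
    obtain ⟨a', ha'⟩ := Sum.isLeft_iff.1 ha
    obtain ⟨b', hb'⟩ := Sum.isLeft_iff.1 hb
    have e1 := hF a a' ha'
    have e2 := hF b b' hb'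
    have : a' = b' := by rw [← e1, ← e2]; exact hxy
    rw [hg (ha'.trans ((congrArg Sum.inl this).trans hb'.symm))]
  · obtain ⟨a, ha1, rfl⟩ := Finset.mem_map.1 ha
    simp only [A1, mem_filter, mem_univ, true_and] at ha1
    obtain ⟨y, hy⟩ := Sum.isLeft_iff.1 ha1
    have h1 := hgt a
    rw [hy] at h1
    simp only [t, Finset.inl_mem_disjSum, Finset.mem_inter, mem_nbrs, Finset.mem_singleton,
      exists_eq_left] at h1
    change F a ∈ B ∧ G.Adj a (F a)
    rw [hF a y hy]
    exact ⟨h1.2, h1.1⟩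
  · rw [Finset.card_map]
    have h1 : #A1 + #{a : A | ¬ (g a).isLeft} = #A := by
      rw [Finset.card_filter_add_card_filter_not, Finset.card_univ, Fintype.card_coe]
    have h2 : #{a : A | ¬ (g a).isLeft} ≤ δ := by
      have h3 : #(({a : A | ¬ (g a).isLeft} : Finset A).map ⟨g, hg⟩) ≤
          #((univ : Finset (Fin δ)).map ⟨(Sum.inr : Fin δ → V ⊕ Fin δ), Sum.inr_injective⟩) := by
        refine Finset.card_le_card fun x hx => ?_
        obtain ⟨a, ha, rfl⟩ := Finset.mem_map.1 hx
        simp only [mem_filter, mem_univ, true_and, Sum.not_isLeft] at ha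
        obtain ⟨j, hj⟩ := Sum.isRight_iff.1 ha
        exact Finset.mem_map.2 ⟨j, mem_univ _, hj.symm⟩
      simpa using h3
    omega

/-- Matchings between consecutive layers are composed, and each of the j steps interrupts at most δ
chains. Chains are indexed by their vertex in layer 0. -/
lemma exists_chains (L : ℕ → Finset V) {δ : ℕ} (j : ℕ)
    (h : ∀ i < j, ∀ S ⊆ L i, #S ≤ #(nbrs G S ∩ L (i + 1)) + δ) :
    ∃ (I : Finset V) (p : V → ℕ → V), #(L 0) ≤ #I + j * δ ∧
      (∀ v ∈ I, ∀ k ≤ j, p v k ∈ L k) ∧ (∀ k ≤ j, ∀ v ∈ I, ∀ w ∈ I, p v k = p w k → v = w) ∧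
      ∀ v ∈ I, ∀ k < j, G.Adj (p v k) (p v (k + 1)) := by
  induction j with
  | zero =>
    refine ⟨L 0, fun v _ => v, by simp, fun v hv k hk => ?_, fun _ _ _ _ _ _ h => h,
      fun v _ k hk => absurd hk (by omega)⟩
    rw [Nat.le_zero.1 hk]; exact hv
  | succ j ih =>
    obtain ⟨I, p, hI, hp, hinj, hadj⟩ := ih fun i hi => h i (by omega)
    let A := I.image fun v => p v j
    have hcard : #A = #I := Finset.card_image_of_injOn fun v hv w hw => hinj j le_rfl v hv w hw
    have hAL : A ⊆ L j := fun x hx => by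
      obtain ⟨v, hv, rfl⟩ := Finset.mem_image.1 hx
      exact hp v hv j le_rfl
    obtain ⟨A', hA', f, hf, hfB, hc⟩ := exists_matching_of_deficiency (G := G) A (L (j + 1))
      (δ := δ) fun S hS => h j (by omega) S (hS.trans hAL)
    let I' : Finset V := {v ∈ I | p v j ∈ A'}
    let q : V → ℕ → V := fun v k => if k ≤ j then p v k else f (p v j)
    have hq : ∀ v k, k ≤ j → q v k = p v k := fun v k hk => if_pos hk
    have hq' : ∀ v, q v (j + 1) = f (p v j) := fun v => if_neg (by omega)
    have hI' : #A' ≤ #I' := by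
      have : A' ⊆ I'.image fun v => p v j := by
        intro x hx
        obtain ⟨v, hv, rfl⟩ := Finset.mem_image.1 (hA' hx)
        exact Finset.mem_image.2 ⟨v, Finset.mem_filter.2 ⟨hv, hx⟩, rfl⟩
      exact (Finset.card_le_card this).trans Finset.card_image_le
    refine ⟨I', q, ?_, fun v hv k hk => ?_, fun k hk v hv w hw hvw => ?_, fun v hv k hk => ?_⟩
    · rw [add_mul, one_mul]; omega
    · rw [Finset.mem_filter] at hv
      rcases Nat.lt_or_ge j k with hjk | hjk
      · obtain rfl : k = j + 1 := by omega
        rw [hq']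
        exact (hfB _ hv.2).1
      · rw [hq v k hjk]
        exact hp v hv.1 k hjk
    · rw [Finset.mem_filter] at hv hw
      rcases Nat.lt_or_ge j k with hjk | hjk
      · obtain rfl : k = j + 1 := by omega
        rw [hq', hq'] at hvw
        exact hinj j le_rfl v hv.1 w hw.1 (hf hv.2 hw.2 hvw)
      · rw [hq v k hjk, hq w k hjk] at hvw
        exact hinj k hjk v hv.1 w hw.1 hvw
    · rw [Finset.mem_filter] at hv
      rcases Nat.lt_or_ge k j with hjk | hjk
      · rw [hq v k hjk.le, hq v (k + 1) hjk]
        exact hadj v hv.1 k hjk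
      · obtain rfl : k = j := by omega
        rw [hq v k le_rfl, hq']
        exact (hfB _ hv.2).2

/-- Deleting vertices of low degree from a nearly regular graph. -/
lemma exists_min_degree_subset {D : ℕ} {ε : ℝ} (hD : ∀ v, dg G v univ ≤ D)
    (U : Finset V) (hU : (1 - ε) * (D * #U) ≤ (∑ v ∈ U, dg G v U : ℕ)) :
    ∃ N ⊆ U, (∀ v ∈ N, D ≤ 3 * dg G v N) ∧
      (1 - 3 * ε) * (D * #U) ≤ (∑ v ∈ N, dg G v N : ℕ) := by
  -- Deleting v changes the objective by 2D - 6d(v), so a maximiser has minimum degree at least D/3.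
  -- Comparison with U, together with Σd ≤ D|N|, shows that only a defect 3ε arises.
  obtain ⟨N, hN, hmax⟩ := Finset.exists_max_image U.powerset
    (fun N => 3 * ((∑ v ∈ N, dg G v N : ℕ) : ℤ) - 2 * D * #N) ⟨U, by simp⟩
  rw [Finset.mem_powerset] at hN
  refine ⟨N, hN, fun v hv => ?_, ?_⟩
  · have h1 := hmax (N.erase v) (Finset.mem_powerset.2 ((Finset.erase_subset _ _).trans hN))
    have h2 : ∑ w ∈ N, dg G w N = ∑ w ∈ N.erase v, dg G w (N.erase v) + 2 * dg G v N := by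
      have hNe : N = N.erase v ∪ {v} := by
        rw [Finset.union_comm]; exact (Finset.insert_erase hv).symm
      have hdis : Disjoint (N.erase v) {v} := by simp
      have e1 : ∀ w, dg G w N = dg G w (N.erase v) + dg G w {v} := fun w => by
        conv_lhs => rw [hNe]
        exact dg_union G w hdis
      have e2 : dg G v {v} = 0 := by
        unfold dg; simp
      have e3 : ∑ w ∈ N.erase v, dg G w {v} = dg G v (N.erase v) := by
        rw [sum_dg_comm]; simp
      rw [← Finset.add_sum_erase N _ hv]
      have e4 : ∑ w ∈ N.erase v, dg G w N =
          ∑ w ∈ N.erase v, dg G w (N.erase v) + dg G v (N.erase v) := by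
        rw [← e3, ← Finset.sum_add_distrib]
        exact Finset.sum_congr rfl fun w _ => e1 w
      have e5 := e1 v
      omega
    have h3 := Finset.card_erase_add_one hv
    have h4 : (#N : ℤ) = #(N.erase v) + 1 := by exact_mod_cast h3.symm
    rw [h2, h4] at h1
    push_cast at h1
    have : (D : ℤ) ≤ 3 * dg G v N := by linarith
    exact_mod_cast this
  · have h1 := hmax U (by simp)
    have h2 := sum_dg_le G hD N N
    have h1' : 3 * ((∑ v ∈ U, dg G v U : ℕ) : ℝ) - 2 * D * #U ≤
        3 * ((∑ v ∈ N, dg G v N : ℕ) : ℝ) - 2 * D * #N := by exact_mod_cast h1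
    have h2' : ((∑ v ∈ N, dg G v N : ℕ) : ℝ) ≤ D * #N := by exact_mod_cast h2
    linarith

/-- A nearly regular graph is almost covered by disjoint paths with `l` vertices each. -/
lemma exists_path_cover {D l : ℕ} {η ε : ℝ} (hl : 0 < l) (hD0 : 0 < D) (hη0 : 0 < η) (hη1 : η ≤ 1)
    (hD : ∀ v, dg G v univ ≤ D) (U : Finset V)
    (hU : (1 - ε) * (D * #U) ≤ (∑ v ∈ U, dg G v U : ℕ)) (hε : 3 * ε < 1) (hU0 : U.Nonempty)
    (hexp : 2 * (l * (Fintype.card V + 1)) * Real.exp (-(η ^ 2 * D / (36 * l))) < 1) :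
    ∃ (I : Finset V) (p : V → ℕ → V), (∀ v ∈ I, ∀ k < l, p v k ∈ U) ∧
      (∀ v ∈ I, ∀ w ∈ I, ∀ k < l, ∀ k' < l, p v k = p w k' → v = w ∧ k = k') ∧
      (∀ v ∈ I, ∀ k, k + 1 < l → G.Adj (p v k) (p v (k + 1))) ∧
      (1 - 3 * ε - 5 * η * l) * #U ≤ #I * l := by
  obtain ⟨N, hNU, hδ, hN⟩ := exists_min_degree_subset hD U hU
  have hl' : (0 : ℝ) < l := by exact_mod_cast hl
  have hD' : (0 : ℝ) < D := by exact_mod_cast hD0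
  have hUc : (0 : ℝ) < #U := by exact_mod_cast hU0.card_pos
  have hNne : N.Nonempty := by
    rw [Finset.nonempty_iff_ne_empty]
    rintro rfl
    have : 0 < (1 - 3 * ε) * (D * #U) := mul_pos (by linarith) (by positivity)
    simp at hN
    linarith
  obtain ⟨L, hLN, hdisj, hdeg, hsize⟩ := exists_layers hl hD0 hη0 hη1 N hNne
    (fun v _ => (dg_mono G v (subset_univ N)).trans (hD v)) hδ hexp
  set σ : ℝ := ((∑ v ∈ N, dg G v N : ℕ) : ℝ) / (D * l) with hσ
  have hσ0 : 0 ≤ σ := by positivity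
  have hdpos : ∀ v ∈ N, (0 : ℝ) < dg G v N := fun v hv => by
    have := hδ v hv; exact_mod_cast (by omega : 0 < dg G v N)
  have hdef : ∀ i < l - 1, ∀ S ⊆ L i, #S ≤ #(nbrs G S ∩ L (i + 1)) + ⌊4 * η * σ⌋₊ := by
    intro i hi S hS
    set B := nbrs G S ∩ L (i + 1) with hB
    -- A fractional matching: the total weight at every vertex towards the next or previous layer is
    -- (1 ± η)/(Dl), so double counting gives |S|(1 - η) ≤ |B|(1 + η).
    let w : V → V → ℝ := fun x y =>
      if G.Adj x y then (1 / (dg G x N : ℝ)) * (1 / (dg G y N : ℝ)) else 0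
    have hw0 : ∀ x y, 0 ≤ w x y := fun x y => by dsimp [w]; split_ifs <;> positivity
    have hlow : (#S : ℝ) * ((1 - η) / (D * l)) ≤ ∑ x ∈ S, ∑ y ∈ L (i + 1), w x y := by
      rw [← nsmul_eq_mul]
      refine Finset.card_nsmul_le_sum _ _ _ fun x hx => ?_
      have hxN := hLN i (hS hx)
      have h1 := (hdeg x hxN (i + 1) (by omega)).1
      have h2 := hdpos x hxN
      have h3 : ∑ y ∈ L (i + 1), w x y =
          1 / (dg G x N : ℝ) * ∑ u ∈ L (i + 1) with G.Adj x u, 1 / (dg G u N : ℝ) := by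
        rw [Finset.mul_sum, Finset.sum_filter]
      rw [h3]
      calc (1 - η) / (D * l) = 1 / (dg G x N : ℝ) * ((1 - η) * (dg G x N / (D * l))) := by
            field_simp
        _ ≤ _ := mul_le_mul_of_nonneg_left h1 (by positivity)
    have hup : ∑ x ∈ S, ∑ y ∈ L (i + 1), w x y ≤ (#B : ℝ) * ((1 + η) / (D * l)) := by
      have h0 : ∑ x ∈ S, ∑ y ∈ L (i + 1), w x y = ∑ x ∈ S, ∑ y ∈ B, w x y := by
        refine Finset.sum_congr rfl fun x hx => ?_
        symm
        refine Finset.sum_subset Finset.inter_subset_right fun y hy hyB => if_neg fun hxy => ?_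
        exact hyB (Finset.mem_inter.2 ⟨(mem_nbrs G).2 ⟨x, hx, hxy⟩, hy⟩)
      rw [h0, Finset.sum_comm, ← nsmul_eq_mul]
      refine Finset.sum_le_card_nsmul _ _ _ fun y hy => ?_
      have hyN := hLN _ (Finset.mem_inter.1 hy).2
      have h1 := (hdeg y hyN i (by omega)).2
      have h2 := hdpos y hyN
      have h3 : ∑ x ∈ S, w x y ≤
          1 / (dg G y N : ℝ) * ∑ u ∈ L i with G.Adj y u, 1 / (dg G u N : ℝ) := by
        refine (Finset.sum_le_sum_of_subset_of_nonneg hS fun x _ _ => hw0 x y).trans (le_of_eq ?_)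
        rw [Finset.mul_sum, Finset.sum_filter]
        refine Finset.sum_congr rfl fun x _ => ?_
        simp only [w, G.adj_comm x y]
        split_ifs
        · ring
        · rfl
      refine h3.trans ((mul_le_mul_of_nonneg_left h1 (by positivity)).trans (le_of_eq ?_))
      field_simp
    have h1 : (#S : ℝ) * (1 - η) ≤ #B * (1 + η) := by
      have := hlow.trans hup
      rwa [← mul_div_assoc, ← mul_div_assoc, div_le_div_iff_of_pos_right (by positivity)] at this
    have h2 : (#S : ℝ) ≤ (1 + η) * σ := by
      refine le_trans ?_ (hsize i (by omega)).2
      exact_mod_cast Finset.card_le_card hS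
    have h3 : (#S : ℝ) - #B ≤ 4 * η * σ := by
      have : (#S : ℝ) * (1 - 2 * η) ≤ #B := by
        by_contra! hlt
        have hB0 : (0 : ℝ) ≤ #B := by positivity
        have hS0 : (0 : ℝ) ≤ #S := by positivity
        nlinarith [mul_lt_mul_of_pos_right hlt (by linarith : (0 : ℝ) < 1 + η), mul_nonneg hS0 (sq_nonneg η)]
      nlinarith [mul_le_mul_of_nonneg_left h2 hη0.le, mul_nonneg hη0.le hσ0]
    have h4 : #S - #B ≤ ⌊4 * η * σ⌋₊ := by
      rcases le_total #S #B with h | h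
      · omega
      · refine Nat.le_floor ?_
        rw [Nat.cast_sub h]; exact h3
    omega
  obtain ⟨I, p, hI, hp, hinj, hadj⟩ := exists_chains L (l - 1) hdef
  refine ⟨I, p, fun v hv k hk => hNU (hLN k (hp v hv k (by omega))),
    fun v hv w hw k hk k' hk' h => ?_, fun v hv k hk => hadj v hv k (by omega), ?_⟩
  · have hkk : k = k' := by
      by_contra hne
      exact Finset.disjoint_left.1 (hdisj k k' hne) (hp v hv k (by omega))
        (h ▸ hp w hw k' (by omega))
    subst hkk
    exact ⟨hinj k (by omega) v hv w hw h, rfl⟩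
  · have h1 : ((#(L 0) : ℕ) : ℝ) ≤ #I + (l - 1 : ℕ) * (⌊4 * η * σ⌋₊ : ℕ) := by exact_mod_cast hI
    have h2 : ((⌊4 * η * σ⌋₊ : ℕ) : ℝ) ≤ 4 * η * σ := Nat.floor_le (by positivity)
    have h3 : ((l - 1 : ℕ) : ℝ) ≤ l := by exact_mod_cast Nat.sub_le _ _
    have h4 := (hsize 0 hl).1
    have h5 : ((l - 1 : ℕ) : ℝ) * (⌊4 * η * σ⌋₊ : ℕ) ≤ l * (4 * η * σ) := by gcongr
    have hl1 : (1 : ℝ) ≤ l := by exact_mod_cast hl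
    have h6 : (1 - 5 * η * l) * σ ≤ #I := by
      have : η * σ ≤ l * (η * σ) := le_mul_of_one_le_left (by positivity) hl1
      nlinarith
    have h7 : (1 - 3 * ε) * #U ≤ σ * l := by
      have e : σ * l = ((∑ v ∈ N, dg G v N : ℕ) : ℝ) / D := by rw [hσ]; field_simp
      rw [e, le_div_iff₀ hD']
      linarith
    have h9 : σ * l ≤ #U := by
      have e : σ * l = ((∑ v ∈ N, dg G v N : ℕ) : ℝ) / D := by rw [hσ]; field_simp
      rw [e, div_le_iff₀ hD']
      have h := (sum_dg_le G hD N N).trans (Nat.mul_le_mul_left D (Finset.card_le_card hNU))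
      have h' : ((∑ v ∈ N, dg G v N : ℕ) : ℝ) ≤ D * #U := by exact_mod_cast h
      linarith
    have h8 : (1 - 5 * η * l) * (σ * l) ≤ #I * l := by
      have := mul_le_mul_of_nonneg_right h6 hl'.le
      linarith
    have h10 : 5 * η * l * (σ * l) ≤ 5 * η * l * #U :=
      mul_le_mul_of_nonneg_left h9 (by positivity)
    nlinarith

end PathCover
end ExpanderCycle

namespace ExpanderCycle
open Finset
open scoped Classical

/-! ### Expanding subsets and disjoint short paths between branch vertices. -/

section Linking

variable {V : Type*} {G : SimpleGraph V}

lemma sum_dg_union {A B : Finset V} (h : Disjoint A B) :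
    ∑ v ∈ A ∪ B, dg G v (A ∪ B) =
      ∑ v ∈ A, dg G v A + ∑ v ∈ B, dg G v B + 2 * ∑ v ∈ A, dg G v B := by
  simp only [dg_union G _ h]
  rw [Finset.sum_union h, Finset.sum_add_distrib, Finset.sum_add_distrib, sum_dg_comm G B A]
  ring

variable [Fintype V]

/-- A subset of a dense set inducing a graph with good minimum degree and edge expansion. -/
lemma exists_expanding_subset {D X : ℕ} (hX0 : 0 < X) (hX : Fintype.card V ≤ 2 ^ X)
    (A : Finset V) (hA : A.Nonempty) (hE : D * #A ≤ 2 * ∑ v ∈ A, dg G v A) :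
    ∃ W ⊆ A, W.Nonempty ∧ (∀ v ∈ W, D ≤ 8 * dg G v W) ∧
      ∀ U ⊆ W, 2 * #U ≤ #W → D * #U ≤ 8 * X * ∑ u ∈ U, dg G u (W \ U) := by
  have hX' : (0 : ℝ) < X := by exact_mod_cast hX0
  -- The penalty stays between 1 and 2 on all nonempty sets and rises by 1/X at each doubling.
  -- Maximising density over the penalty thus costs at most a factor 2, and a subset of at most half
  -- the size has density lower by at least ψ/X, which its edges to the rest must make up.
  let lam : ℕ → ℝ := fun m => 1 + Real.logb 2 m / X
  have hlam_mono : ∀ a b : ℕ, 0 < a → a ≤ b → lam a ≤ lam b := by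
    intro a b ha hab
    have : Real.logb 2 a ≤ Real.logb 2 b :=
      Real.logb_le_logb_of_le (by norm_num) (by exact_mod_cast ha) (by exact_mod_cast hab)
    dsimp only [lam]
    have := div_le_div_of_nonneg_right this hX'.le
    linarith
  have hlam1 : ∀ a : ℕ, 0 < a → 1 ≤ lam a := by
    intro a ha
    have : lam 1 = 1 := by simp [lam]
    rw [← this]
    exact hlam_mono 1 a one_pos ha
  have hlam2 : ∀ B : Finset V, B.Nonempty → lam #B ≤ 2 := by
    intro B hB
    have h1 := hlam_mono #B (2 ^ X) hB.card_pos ((Finset.card_le_univ B).trans hX)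
    refine h1.trans (le_of_eq ?_)
    dsimp only [lam]
    push_cast
    rw [Real.logb_pow, Real.logb_self_eq_one (by norm_num), mul_one, div_self hX'.ne']
    norm_num
  let E : Finset V → ℝ := fun B => ((∑ v ∈ B, dg G v B : ℕ) : ℝ)
  obtain ⟨W, hW, hmax⟩ := Finset.exists_max_image (A.powerset.filter Finset.Nonempty)
    (fun B => E B / (#B * lam #B)) ⟨A, by simp [hA]⟩
  simp only [mem_filter, mem_powerset] at hW hmax
  obtain ⟨hWA, hWne⟩ := hW
  set ψ := E W / (#W * lam #W) with hψ
  have hWc : (0 : ℝ) < #W := by exact_mod_cast hWne.card_pos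
  have hlW := hlam1 #W hWne.card_pos
  have hEW : E W = ψ * (#W * lam #W) := by
    rw [hψ, div_mul_cancel₀]
    exact (mul_pos hWc (by linarith)).ne'
  have hE' : (D * #A : ℝ) ≤ 2 * E A := by
    simp only [E]; exact_mod_cast hE
  have hψD : (D : ℝ) / 4 ≤ ψ := by
    refine le_trans ?_ (hmax A ⟨subset_rfl, hA⟩)
    have hAc : (0 : ℝ) < #A := by exact_mod_cast hA.card_pos
    have h1 := hlam1 #A hA.card_pos
    have h2 := hlam2 A hA
    rw [le_div_iff₀ (mul_pos hAc (by linarith))]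
    have h3 : (D : ℝ) * #A * lam #A ≤ D * #A * 2 := mul_le_mul_of_nonneg_left h2 (by positivity)
    nlinarith
  have hψ0 : 0 ≤ ψ := le_trans (by positivity) hψD
  have hEB : ∀ B ⊆ W, ∀ t : ℝ, (B.Nonempty → lam #B ≤ t) → E B ≤ ψ * (#B * t) := by
    intro B hB t ht
    rcases B.eq_empty_or_nonempty with rfl | hne
    · simp [E]
    · have h1 := hmax B ⟨hB.trans hWA, hne⟩
      have hBc : (0 : ℝ) < #B := by exact_mod_cast hne.card_pos
      have h2 := hlam1 #B hne.card_pos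
      rw [div_le_iff₀ (mul_pos hBc (by linarith))] at h1
      refine h1.trans (mul_le_mul_of_nonneg_left ?_ hψ0)
      exact mul_le_mul_of_nonneg_left (ht hne) hBc.le
  have hsplit : ∀ U ⊆ W, E W = E U + E (W \ U) + 2 * ((∑ u ∈ U, dg G u (W \ U) : ℕ) : ℝ) := by
    intro U hU
    have := sum_dg_union (G := G) (Finset.disjoint_sdiff (s := U) (t := W))
    rw [Finset.union_sdiff_of_subset hU] at this
    simp only [E]
    exact_mod_cast this
  have hcardsplit : ∀ U ⊆ W, (#(W \ U) : ℝ) = #W - #U := by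
    intro U hU
    rw [Finset.card_sdiff_of_subset hU, Nat.cast_sub (Finset.card_le_card hU)]
  have hcompl : ∀ U ⊆ W, E (W \ U) ≤ ψ * ((#W - #U) * lam #W) := by
    intro U hU
    rw [← hcardsplit U hU]
    exact hEB _ Finset.sdiff_subset _ fun hne =>
      hlam_mono _ _ hne.card_pos (Finset.card_le_card Finset.sdiff_subset)
  refine ⟨W, hWA, hWne, fun v hv => ?_, fun U hU hUc => ?_⟩
  · have hv' : {v} ⊆ W := by simpa using hv
    have h1 := hsplit {v} hv'
    have h2 := hcompl {v} hv'
    have h3 : E {v} = 0 := by simp [E, dg]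
    have h4 : ((∑ u ∈ ({v} : Finset V), dg G u (W \ {v}) : ℕ) : ℝ) ≤ dg G v W := by
      rw [Finset.sum_singleton]
      exact_mod_cast dg_mono G v Finset.sdiff_subset
    rw [Finset.card_singleton, Nat.cast_one] at h2
    have h5 : ψ ≤ ψ * lam #W := le_mul_of_one_le_right hψ0 hlW
    have : (D : ℝ) ≤ 8 * dg G v W := by nlinarith
    exact_mod_cast this
  · rcases U.eq_empty_or_nonempty with rfl | hne
    · simp
    have h1 := hsplit U hU
    have h2 := hcompl U hU
    have h3 := hEB U hU (lam #U) fun _ => le_rfl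
    have hUpos : (0 : ℝ) < #U := by exact_mod_cast hne.card_pos
    have h4 : lam #U + 1 / X ≤ lam #W := by
      have h5 : Real.logb 2 #U + 1 ≤ Real.logb 2 #W := by
        have : Real.logb 2 #U + 1 = Real.logb 2 (2 * #U) := by
          rw [Real.logb_mul (by norm_num) hUpos.ne', Real.logb_self_eq_one (by norm_num), add_comm]
        rw [this]
        exact Real.logb_le_logb_of_le (by norm_num) (mul_pos two_pos hUpos) (by exact_mod_cast hUc)
      dsimp only [lam]
      have := div_le_div_of_nonneg_right h5 hX'.le
      rw [add_div] at this
      linarith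
    set e : ℝ := ((∑ u ∈ U, dg G u (W \ U) : ℕ) : ℝ) with he
    have h5 : ψ * #U * (1 / X) ≤ 2 * e := by
      have h6 : ψ * #U * (1 / X) ≤ ψ * #U * (lam #W - lam #U) :=
        mul_le_mul_of_nonneg_left (by linarith) (mul_nonneg hψ0 hUpos.le)
      nlinarith
    have h6 : (D : ℝ) * #U ≤ 8 * X * e := by
      have h7 : ψ * #U ≤ 2 * e * X := by
        have := mul_le_mul_of_nonneg_right h5 hX'.le
        have e2 : ψ * #U * (1 / X) * X = ψ * #U := by
          rw [mul_assoc, one_div_mul_cancel hX'.ne', mul_one]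
        linarith
      have h8 := mul_le_mul_of_nonneg_right hψD hUpos.le
      nlinarith
    rw [he] at h6
    exact_mod_cast h6

variable {D X : ℕ} {W : Finset V}

/-- Breadth-first growth in W \ Z. The first neighbourhood has at least D/16 vertices, so 16X|Z| ≤
|U| throughout: Z destroys at most half of the expansion, leaving growth by 1 + 1/(16X) per step. -/
lemma exists_half_ball (hX0 : 0 < X) (hX : Fintype.card V ≤ 2 ^ X) (hD0 : 0 < D)
    (hD : ∀ v, dg G v univ ≤ D)
    (hdeg : ∀ v ∈ W, D ≤ 8 * dg G v W)
    (hexp : ∀ U ⊆ W, 2 * #U ≤ #W → D * #U ≤ 8 * X * ∑ u ∈ U, dg G u (W \ U))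
    {Z : Finset V} (hZ : 256 * X * #Z ≤ D) {x : V} (hx : x ∈ W) :
    ∃ U ⊆ W \ Z, #W < 2 * #U ∧ ∀ v ∈ U, ReachIn G {x} (W \ Z) (16 * X * X + 1) v := by
  have key : ∀ j : ℕ, ∃ U ⊆ W \ Z, (∀ v ∈ U, ReachIn G {x} (W \ Z) (j + 1) v) ∧ D ≤ 16 * #U ∧
      (#W < 2 * #U ∨ (16 * X + 1) ^ j ≤ (16 * X) ^ j * #U) := by
    intro j
    induction j with
    | zero =>
      have h1 : dg G x W ≤ #((nbrs G {x} ∩ W) \ Z) + #Z := by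
        have : dg G x W = #(nbrs G {x} ∩ W) := by
          unfold dg nbrs; congr 1; ext; simp [and_comm]
        rw [this]
        have := Finset.le_card_sdiff Z (nbrs G {x} ∩ W)
        omega
      have h2 : D ≤ 16 * #((nbrs G {x} ∩ W) \ Z) := by
        have := hdeg x hx
        have : 256 * #Z ≤ D := by nlinarith
        omega
      refine ⟨(nbrs G {x} ∩ W) \ Z,
        Finset.sdiff_subset_sdiff Finset.inter_subset_right le_rfl, fun v hv => ?_, h2, Or.inr ?_⟩
      · exact reachIn_one (Finset.mem_inter.1 (Finset.mem_sdiff.1 hv).1).1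
      · simp only [pow_zero, one_mul]; omega
    | succ j ih =>
      obtain ⟨U, hU, hreach, hUD, hcase⟩ := ih
      set N := (nbrs G U ∩ (W \ Z)) \ U with hN
      have hcard : #(U ∪ N) = #U + #N := Finset.card_union_of_disjoint Finset.disjoint_sdiff
      refine ⟨U ∪ N, Finset.union_subset hU
        (Finset.sdiff_subset.trans Finset.inter_subset_right), fun v hv => ?_, by omega, ?_⟩
      · rcases Finset.mem_union.1 hv with hv | hv
        · exact (hreach v hv).mono le_rfl (by omega)
        · obtain ⟨u, hu, huv⟩ := (mem_nbrs G).1 (Finset.mem_inter.1 (Finset.mem_sdiff.1 hv).1).1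
          exact (hreach u hu).step (hU hu) huv
      · rcases hcase with h | h
        · left; omega
        by_cases hc : 2 * #U ≤ #W
        · right
          have h1 := hexp U (hU.trans Finset.sdiff_subset) hc
          have h2 : ∑ u ∈ U, dg G u (W \ U) ≤ D * #N + D * #Z := by
            have h3 : ∀ u ∈ U, dg G u (W \ U) ≤ dg G u (N ∪ Z) := by
              intro u hu
              refine Finset.card_le_card fun w hw => ?_
              simp only [mem_filter, mem_sdiff, mem_union, hN, mem_inter, mem_nbrs] at hw ⊢
              refine ⟨?_, hw.2⟩
              by_cases hwZ : w ∈ Z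
              · exact Or.inr hwZ
              · exact Or.inl ⟨⟨⟨u, hu, hw.2⟩, hw.1.1, hwZ⟩, hw.1.2⟩
            refine (Finset.sum_le_sum h3).trans ?_
            rw [sum_dg_comm]
            refine (sum_dg_le G hD _ _).trans ?_
            rw [← mul_add]
            exact Nat.mul_le_mul_left _ (Finset.card_union_le _ _)
          have h4 : #U ≤ 8 * X * (#N + #Z) := by
            have : D * #U ≤ D * (8 * X * (#N + #Z)) := by
              refine h1.trans ((Nat.mul_le_mul_left _ h2).trans (le_of_eq ?_))
              ring
            exact Nat.le_of_mul_le_mul_left this hD0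
          have h5 : #U ≤ 16 * X * #N := by
            have : 16 * X * #Z ≤ #U := by nlinarith
            nlinarith
          rw [hcard, pow_succ, pow_succ]
          calc (16 * X + 1) ^ j * (16 * X + 1) ≤ (16 * X) ^ j * #U * (16 * X + 1) :=
                Nat.mul_le_mul_right _ h
            _ = (16 * X) ^ j * (16 * X * #U + #U) := by ring
            _ ≤ (16 * X) ^ j * (16 * X * #U + 16 * X * #N) :=
                Nat.mul_le_mul_left _ (Nat.add_le_add_left h5 _)
            _ = _ := by ring
        · left; omega
  obtain ⟨U, hU, hreach, -, hcase⟩ := key (16 * X * X)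
  refine ⟨U, hU, ?_, hreach⟩
  rcases hcase with h | h
  · exact h
  · have h1 := two_pow_le_growth (k := 16 * X) (X := X) (by omega)
    have h2 : (16 * X) ^ (16 * X * X) * 2 ^ X ≤ (16 * X) ^ (16 * X * X) * #U := by
      rw [mul_comm]; exact h1.trans h
    have h3 := Nat.le_of_mul_le_mul_left h2 (by positivity)
    have h4 := (Finset.card_le_univ W).trans hX
    have : 0 < 2 ^ X := by positivity
    omega

/-- Two balls, each larger than half of W, must meet. -/
lemma exists_short_path (hX0 : 0 < X) (hX : Fintype.card V ≤ 2 ^ X) (hD0 : 0 < D)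
    (hD : ∀ v, dg G v univ ≤ D)
    (hdeg : ∀ v ∈ W, D ≤ 8 * dg G v W)
    (hexp : ∀ U ⊆ W, 2 * #U ≤ #W → D * #U ≤ 8 * X * ∑ u ∈ U, dg G u (W \ U))
    {Z : Finset V} (hZ : 256 * X * #Z ≤ D) {x y : V} (hx : x ∈ W \ Z) (hy : y ∈ W \ Z) :
    ∃ S ⊆ W \ Z, PathOn G x y S ∧ #S ≤ 40 * X ^ 2 := by
  obtain ⟨A, hA, hAc, hAr⟩ := exists_half_ball hX0 hX hD0 hD hdeg hexp hZ (Finset.mem_sdiff.1 hx).1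
  obtain ⟨B, hB, hBc, hBr⟩ := exists_half_ball hX0 hX hD0 hD hdeg hexp hZ (Finset.mem_sdiff.1 hy).1
  have hne : (A ∩ B).Nonempty := by
    rw [← Finset.card_pos]
    have h1 := Finset.card_union_add_card_inter A B
    have h2 : #(A ∪ B) ≤ #W := Finset.card_le_card
      ((Finset.union_subset hA hB).trans Finset.sdiff_subset)
    omega
  obtain ⟨w, hw⟩ := hne
  rw [Finset.mem_inter] at hw
  obtain ⟨a, ha, p, hp, hps⟩ := hAr w hw.1
  obtain ⟨b, hb, q, hq, hqs⟩ := hBr w hw.2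
  rw [Finset.mem_singleton] at ha hb
  subst ha hb
  obtain ⟨S, hS, hSc, hSs⟩ := exists_pathOn_of_walk (p.append q.reverse)
  refine ⟨S, fun v hv => ?_, hS, ?_⟩
  · have := hSs v hv
    rw [SimpleGraph.Walk.mem_support_append_iff, SimpleGraph.Walk.support_reverse,
      List.mem_reverse] at this
    rcases this with h | h
    · rcases hps v h with h | h | h
      exacts [h ▸ hx, h ▸ hA hw.1, h]
    · rcases hqs v h with h | h | h
      exacts [h ▸ hy, h ▸ hA hw.1, h]
  · rw [SimpleGraph.Walk.length_append, SimpleGraph.Walk.length_reverse] at hSc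
    have : 1 ≤ X ^ 2 := Nat.one_le_pow _ _ hX0
    nlinarith

/-- Internally disjoint short paths joining prescribed pairs of branch vertices. -/
lemma exists_linkage (hX0 : 0 < X) (hX : Fintype.card V ≤ 2 ^ X) (hD0 : 0 < D)
    (hD : ∀ v, dg G v univ ≤ D)
    (hdeg : ∀ v ∈ W, D ≤ 8 * dg G v W)
    (hexp : ∀ U ⊆ W, 2 * #U ≤ #W → D * #U ≤ 8 * X * ∑ u ∈ U, dg G u (W \ U))
    {ι : Type*} [Fintype ι] (b : ι → V) (hbW : ∀ w, b w ∈ W)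
    (E : Finset (Sym2 ι))
    (hE : 256 * X * (40 * X ^ 2 * #E + Fintype.card ι) ≤ D) :
    ∃ f : Sym2 ι → Finset V, (∀ u v, s(u, v) ∈ E → PathOn G (b u) (b v) (f s(u, v))) ∧
      (∀ e ∈ E, f e ⊆ W ∧ #(f e) ≤ 40 * X ^ 2) ∧
      (∀ u v, s(u, v) ∈ E → ∀ w, b w ∈ f s(u, v) → b w = b u ∨ b w = b v) ∧
      ∀ e ∈ E, ∀ e' ∈ E, e ≠ e' → ∀ x ∈ f e, x ∈ f e' → x ∈ Set.range b := by
  induction E using Finset.induction_on with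
  | empty => exact ⟨fun _ => ∅, by simp, by simp, by simp, by simp⟩
  | insert e E he ih =>
    rw [Finset.card_insert_of_notMem he] at hE
    obtain ⟨f, h1, h2, h3, h4⟩ := ih (by
      refine le_trans (Nat.mul_le_mul_left _ ?_) hE
      nlinarith [Nat.zero_le (X ^ 2)])
    obtain ⟨u, v⟩ := e
    change s(u, v) ∉ E at he
    -- Obstacles for the next path: all earlier paths and all branch vertices other than its own
    -- ends.
    set Z := (E.biUnion f ∪ univ.image b) \ {b u, b v} with hZdef
    have hZ : 256 * X * #Z ≤ D := by
      refine le_trans (Nat.mul_le_mul_left _ ?_) hE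
      have e1 : #(E.biUnion f) ≤ #E * (40 * X ^ 2) :=
        Finset.card_biUnion_le_card_mul _ _ _ fun e he => (h2 e he).2
      have e2 : #(univ.image b) ≤ Fintype.card ι := Finset.card_image_le
      have e3 := Finset.card_union_le (E.biUnion f) (univ.image b)
      have e4 : #Z ≤ _ := Finset.card_le_card Finset.sdiff_subset
      nlinarith
    obtain ⟨S, hS, hSp, hSc⟩ := exists_short_path hX0 hX hD0 hD hdeg hexp hZ
      (x := b u) (y := b v) (Finset.mem_sdiff.2 ⟨hbW u, by simp [hZdef]⟩)
      (Finset.mem_sdiff.2 ⟨hbW v, by simp [hZdef]⟩)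
    have hSZ : ∀ x ∈ S, x ∈ E.biUnion f ∪ univ.image b → x = b u ∨ x = b v := by
      intro x hx hx2
      have := (Finset.mem_sdiff.1 (hS hx)).2
      rw [hZdef, Finset.mem_sdiff, not_and, not_not] at this
      simpa using this hx2
    have hfe : ∀ e' ∈ E, Function.update f s(u, v) S e' = f e' := fun e' he' =>
      Function.update_of_ne (fun h => he (by rw [← h]; exact he')) _ _
    have hSf : ∀ e' ∈ E, ∀ x ∈ S, x ∈ f e' → x ∈ Set.range b := by
      intro e' he' x hx hx'
      rcases hSZ x hx (Finset.mem_union_left _ (Finset.mem_biUnion.2 ⟨e', he', hx'⟩)) with h | h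
      exacts [⟨u, h.symm⟩, ⟨v, h.symm⟩]
    refine ⟨Function.update f s(u, v) S, fun x y hxy => ?_, fun e' he' => ?_,
      fun x y hxy w hw => ?_, fun e₁ he₁ e₂ he₂ hne x hx₁ hx₂ => ?_⟩
    · rcases Finset.mem_insert.1 hxy with h | h
      · change s(x, y) = s(u, v) at h
        rw [h, Function.update_self]
        rcases Sym2.eq_iff.1 h with ⟨rfl, rfl⟩ | ⟨rfl, rfl⟩
        exacts [hSp, hSp.symm]
      · rw [hfe _ h]; exact h1 x y h
    · rcases Finset.mem_insert.1 he' with h | h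
      · subst h
        change Function.update f s(u, v) S s(u, v) ⊆ W ∧ #(Function.update f s(u, v) S s(u, v)) ≤ _
        rw [Function.update_self]
        exact ⟨hS.trans Finset.sdiff_subset, hSc⟩
      · rw [hfe _ h]; exact h2 e' h
    · rcases Finset.mem_insert.1 hxy with h | h
      · change s(x, y) = s(u, v) at h
        rw [h, Function.update_self] at hw
        have := hSZ _ hw (Finset.mem_union_right _ (Finset.mem_image_of_mem b (mem_univ w)))
        rcases Sym2.eq_iff.1 h with ⟨rfl, rfl⟩ | ⟨rfl, rfl⟩
        exacts [this, this.symm]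
      · rw [hfe _ h] at hw; exact h3 x y h w hw
    · rcases Finset.mem_insert.1 he₁ with h | h <;> rcases Finset.mem_insert.1 he₂ with h' | h'
      · exact absurd (h.trans h'.symm) hne
      · rw [h] at hx₁
        change x ∈ Function.update f s(u, v) S s(u, v) at hx₁
        rw [Function.update_self] at hx₁
        rw [hfe _ h'] at hx₂
        exact hSf _ h' x hx₁ hx₂
      · rw [h'] at hx₂
        change x ∈ Function.update f s(u, v) S s(u, v) at hx₂
        rw [Function.update_self] at hx₂
        rw [hfe _ h] at hx₁
        exact hSf _ h x hx₂ hx₁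
      · rw [hfe _ h] at hx₁
        rw [hfe _ h'] at hx₂
        exact h4 _ h _ h' hne x hx₁ hx₂

end Linking
end ExpanderCycle

namespace ExpanderCycle
open Finset
open scoped Classical

/-! ### From families of path vertex sets to subdivisions, and from triangle subdivisions to cycles.
-/

section Subdivision

variable {V W : Type*} {G : SimpleGraph V} {F : SimpleGraph W}

/-- Vertex sets of internally disjoint paths between branch vertices give a subdivision. -/
lemma exists_subdivision {b : W → V} (hb : Function.Injective b) (f : Sym2 W → Finset V)
    (hpath : ∀ u v, F.Adj u v → PathOn G (b u) (b v) (f s(u, v)))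
    (hbranch : ∀ u v, F.Adj u v → ∀ w, b w ∈ f s(u, v) → b w = b u ∨ b w = b v)
    (hdisj : ∀ e ∈ F.edgeSet, ∀ e' ∈ F.edgeSet, e ≠ e' → ∀ x ∈ f e, x ∈ f e' → x ∈ Set.range b) :
    ∃ K : G.Subgraph, K.IsSubdivisionOf F ∧ ∀ u v, F.Adj u v → ∀ x ∈ f s(u, v), x ∈ K.verts := by
  -- An arbitrary order on W picks one orientation of each edge, so that the path of vu can be
  -- defined as the reverse of the path of uv.
  let _ : LinearOrder W := linearOrderOfSTO WellOrderingRel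
  let Q : ∀ ⦃u v : W⦄, F.Adj u v → G.Walk (b u) (b v) := fun u v h => (hpath u v h).choose
  have hQ : ∀ ⦃u v : W⦄ (h : F.Adj u v), (Q h).IsPath ∧ (Q h).support.toFinset = f s(u, v) :=
    fun u v h => (hpath u v h).choose_spec
  let P : ∀ ⦃u v : W⦄, F.Adj u v → G.Walk (b u) (b v) := fun u v h =>
    if u < v then Q h else (Q h.symm).reverse
  have hP : ∀ ⦃u v : W⦄ (h : F.Adj u v), (P h).IsPath ∧ ∀ x, x ∈ (P h).support ↔ x ∈ f s(u, v) := by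
    intro u v h
    dsimp only [P]
    split_ifs
    · refine ⟨(hQ h).1, fun x => ?_⟩
      rw [← (hQ h).2, List.mem_toFinset]
    · refine ⟨(hQ h.symm).1.reverse, fun x => ?_⟩
      rw [SimpleGraph.Walk.support_reverse, List.mem_reverse, Sym2.eq_swap, ← (hQ h.symm).2,
        List.mem_toFinset]
  let K : G.Subgraph :=
    { verts := {x | x ∈ Set.range b ∨ ∃ (u v : W) (h : F.Adj u v), x ∈ (P h).support}
      Adj := fun x y => ∃ (u v : W) (h : F.Adj u v), s(x, y) ∈ (P h).edges
      adj_sub := by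
        rintro x y ⟨u, v, h, hxy⟩
        exact (P h).adj_of_mem_edges hxy
      edge_vert := by
        rintro x y ⟨u, v, h, hxy⟩
        exact Or.inr ⟨u, v, h, (P h).fst_mem_support_of_mem_edges hxy⟩
      symm := ⟨fun x y => by
        rintro ⟨u, v, h, hxy⟩
        exact ⟨u, v, h, by rwa [Sym2.eq_swap]⟩⟩ }
  have hK : K.IsSubdivisionOf F := by
    refine ⟨b, P, hb, fun u v h => (hP h).1, fun u v h => ?_, fun u v h w hw => ?_,
      fun u v u' v' h h' hne x hx hx' => ?_, fun x => Iff.rfl, fun x y => Iff.rfl⟩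
    · dsimp only [P]
      rcases lt_or_gt_of_ne h.ne with hlt | hlt
      · rw [if_neg hlt.not_gt, if_pos hlt]
      · rw [if_pos hlt, if_neg hlt.not_gt, SimpleGraph.Walk.reverse_reverse]
    · rcases hbranch u v h w (((hP h).2 _).1 hw) with h | h
      exacts [Or.inl (hb h), Or.inr (hb h)]
    · exact hdisj _ h _ h' hne x (((hP h).2 x).1 hx) (((hP h').2 x).1 hx')
  exact ⟨K, hK, fun u v h x hx => Or.inr ⟨u, v, h, ((hP h).2 x).2 hx⟩⟩

/-- A subdivision of a triangle is a cycle. -/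
lemma exists_cycle_of_subdivision {K : G.Subgraph}
    (hK : K.IsSubdivisionOf (⊤ : SimpleGraph (Fin 3))) :
    ∃ (v : V) (C : G.Walk v v), C.IsCycle ∧ ∀ x ∈ K.verts, x ∈ C.support := by
  obtain ⟨b, P, hb, hpath, hsymm, hbr, hdisj, hverts, -⟩ := hK
  have h01 : (⊤ : SimpleGraph (Fin 3)).Adj 0 1 := by simp
  have h12 : (⊤ : SimpleGraph (Fin 3)).Adj 1 2 := by simp
  have h20 : (⊤ : SimpleGraph (Fin 3)).Adj 2 0 := by simp
  have hQ : ((P h01).append (P h12)).IsPath := by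
    rw [SimpleGraph.Walk.isPath_def, SimpleGraph.Walk.support_append, List.nodup_append]
    have hq := (hpath h12).support_nodup
    rw [← SimpleGraph.Walk.cons_tail_support, List.nodup_cons] at hq
    refine ⟨(hpath h01).support_nodup, hq.2, fun x hx y hy hxy => ?_⟩
    subst hxy
    have hx' := List.mem_of_mem_tail hy
    obtain ⟨w, rfl⟩ := hdisj h01 h12 (by decide) x hx hx'
    have e1 := hbr h01 w hx
    have e2 := hbr h12 w hx'
    have : w = 1 := by omega
    subst this
    exact hq.1 hy
  have hsupp : ∀ x ∈ K.verts, x ∈ (P h01).support ∨ x ∈ (P h12).support ∨ x ∈ (P h20).support := by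
    intro x hx
    rcases (hverts x).1 hx with ⟨w, rfl⟩ | ⟨u, v, h, hx⟩
    · fin_cases w
      · exact Or.inl (SimpleGraph.Walk.start_mem_support _)
      · exact Or.inl (SimpleGraph.Walk.end_mem_support _)
      · exact Or.inr (Or.inl (SimpleGraph.Walk.end_mem_support _))
    · have hs : x ∈ (P h.symm).support := by
        rw [hsymm h, SimpleGraph.Walk.support_reverse, List.mem_reverse]; exact hx
      fin_cases u <;> fin_cases v
      · exact absurd rfl h.ne
      · exact Or.inl hx
      · exact Or.inr (Or.inr hs)
      · exact Or.inl hs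
      · exact absurd rfl h.ne
      · exact Or.inr (Or.inl hx)
      · exact Or.inr (Or.inr hx)
      · exact Or.inr (Or.inl hs)
      · exact absurd rfl h.ne
  have hne : b 2 ≠ b 0 := fun h => by simpa using hb h
  have hp20 := hpath h20
  have hd01 := hdisj h20 h01 (by decide)
  have hd12 := hdisj h20 h12 (by decide)
  have hb20 := hbr h20
  generalize P h20 = p at hp20 hd01 hd12 hb20 hsupp
  obtain ⟨y, hy, q, rfl⟩ := SimpleGraph.Walk.exists_eq_cons_of_ne hne p
  rw [SimpleGraph.Walk.cons_isPath_iff] at hp20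
  have hmem : ∀ x ∈ q.support, x ∈ ((P h01).append (P h12)).support → x = b 0 := by
    intro x hxq hx
    have hx' : x ∈ (SimpleGraph.Walk.cons hy q).support := List.mem_cons_of_mem _ hxq
    have hw : x ∈ Set.range b := by
      rcases (SimpleGraph.Walk.mem_support_append_iff _ _).1 hx with h | h
      exacts [hd01 x hx' h, hd12 x hx' h]
    obtain ⟨w, rfl⟩ := hw
    rcases hb20 w hx' with rfl | rfl
    · exact absurd hxq hp20.2
    · rfl
  refine ⟨b 2, SimpleGraph.Walk.cons hy (q.append ((P h01).append (P h12))), ?_, fun x hx => ?_⟩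
  · rw [SimpleGraph.Walk.cons_isCycle_iff]
    constructor
    · rw [SimpleGraph.Walk.isPath_def, SimpleGraph.Walk.support_append, List.nodup_append]
      have hq := hQ.support_nodup
      rw [← SimpleGraph.Walk.cons_tail_support, List.nodup_cons] at hq
      refine ⟨hp20.1.support_nodup, hq.2, fun x hx z hz hxz => ?_⟩
      subst hxz
      exact hq.1 ((hmem x hx (List.mem_of_mem_tail hz)) ▸ hz)
    · intro he
      rw [SimpleGraph.Walk.edges_append, List.mem_append] at he
      rcases he with he | he
      · exact hp20.2 (q.fst_mem_support_of_mem_edges he)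
      · have hy0 := hmem y q.start_mem_support
          (SimpleGraph.Walk.snd_mem_support_of_mem_edges _ he)
        rw [hy0, SimpleGraph.Walk.edges_append, List.mem_append] at he
        rcases he with he | he
        · have := hbr h01 2 (SimpleGraph.Walk.fst_mem_support_of_mem_edges _ he)
          omega
        · have := hbr h12 0 (SimpleGraph.Walk.snd_mem_support_of_mem_edges _ he)
          omega
  · rw [SimpleGraph.Walk.support_cons, List.mem_cons, SimpleGraph.Walk.mem_support_append_iff,
      SimpleGraph.Walk.mem_support_append_iff]
    rcases hsupp x hx with h | h | h
    · exact Or.inr (Or.inr (Or.inl h))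
    · exact Or.inr (Or.inr (Or.inr h))
    · rw [SimpleGraph.Walk.support_cons, List.mem_cons] at h
      rcases h with h | h
      exacts [Or.inl h, Or.inr (Or.inl h)]

end Subdivision
end ExpanderCycle

namespace ExpanderCycle
open Finset
open scoped Classical

/-! ### Depth-first search merging a family of paths through a reservoir. -/

section Joining

variable {V ι : Type*} (G : SimpleGraph V) (p : ι → ℕ → V) (l t c : ℕ) (R : Finset V)

/-- A vertex near the end of the `i`-th path is joined to a vertex near the beginning of the `j`-th
path by a path with interior in `R \ Z`. -/
def Joined (Z : Finset V) (i j : ι) : Prop :=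
  ∃ e b S, l ≤ e + t ∧ e < l ∧ b < t ∧ PathOn G (p i e) (p j b) S ∧ #S ≤ c ∧
    ∀ x ∈ S, x = p i e ∨ x = p j b ∨ x ∈ R \ Z

/-- The paths listed in `s` are merged, up to their first and last `t` vertices, into a path that
may end at any of the last `t` vertices of the path at the head of `s`. -/
def Merged (Z : Finset V) (s : List ι) : Prop :=
  ∀ i s', s = i :: s' → ∀ e, l ≤ e + t → e < l → ∃ x S, PathOn G x (p i e) S ∧
    (∀ v ∈ S, (∃ j ∈ s, ∃ k < l, v = p j k) ∨ v ∈ Z) ∧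
    ∀ j ∈ s, ∀ k, t ≤ k → k + t < l → p j k ∈ S

variable {G p l t c R}

lemma Joined.mono {Z Z' : Finset V} {i j : ι} (h : Joined G p l t c R Z' i j) (hZ : Z ⊆ Z') :
    Joined G p l t c R Z i j := by
  obtain ⟨e, b, S, h1, h2, h3, h4, h5, h6⟩ := h
  refine ⟨e, b, S, h1, h2, h3, h4, h5, fun x hx => ?_⟩
  rcases h6 x hx with h | h | h
  exacts [Or.inl h, Or.inr (Or.inl h), Or.inr (Or.inr (Finset.sdiff_subset_sdiff le_rfl hZ h))]

lemma Merged.mono {Z Z' : Finset V} {s : List ι} (h : Merged G p l t Z s) (hZ : Z ⊆ Z') :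
    Merged G p l t Z' s := by
  intro i s' hs e he hel
  obtain ⟨x, S, h1, h2, h3⟩ := h i s' hs e he hel
  exact ⟨x, S, h1, fun v hv => (h2 v hv).imp_right fun h => hZ h, h3⟩

lemma pathOn_segment (hinj : ∀ i j k k', k < l → k' < l → p i k = p j k' → i = j ∧ k = k')
    (hadj : ∀ i k, k + 1 < l → G.Adj (p i k) (p i (k + 1))) (i : ι) (b n : ℕ) (h : b + n < l) :
    PathOn G (p i b) (p i (b + n)) ((Icc b (b + n)).image (p i)) := by
  induction n with
  | zero => simpa using PathOn.refl (p i b)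
  | succ n ih =>
    have h1 := (ih (by omega)).trans (PathOn.of_adj (hadj i (b + n) (by omega))) (fun x hx hx2 => by
      rw [Finset.mem_insert, Finset.mem_singleton] at hx2
      rcases hx2 with h | h
      · exact h
      · obtain ⟨k, hk, rfl⟩ := Finset.mem_image.1 hx
        rw [Finset.mem_Icc] at hk
        have := (hinj i i k (b + n + 1) (by omega) (by omega) h).2
        omega)
    have e : (Icc b (b + n)).image (p i) ∪ {p i (b + n), p i (b + n + 1)} =
        (Icc b (b + (n + 1))).image (p i) := by
      ext x
      simp only [mem_union, mem_image, mem_Icc, mem_insert, mem_singleton]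
      constructor
      · rintro (⟨k, hk, rfl⟩ | rfl | rfl)
        exacts [⟨k, by omega, rfl⟩, ⟨b + n, by omega, rfl⟩, ⟨b + n + 1, by omega, rfl⟩]
      · rintro ⟨k, hk, rfl⟩
        rcases Nat.lt_or_ge (b + n) k with h | h
        · obtain rfl : k = b + n + 1 := by omega
          exact Or.inr (Or.inr rfl)
        · exact Or.inl ⟨k, by omega, rfl⟩
    rwa [e] at h1

lemma merged_singleton (hinj : ∀ i j k k', k < l → k' < l → p i k = p j k' → i = j ∧ k = k')
    (hadj : ∀ i k, k + 1 < l → G.Adj (p i k) (p i (k + 1))) (Z : Finset V) (j : ι) :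
    Merged G p l t Z [j] := by
  intro i s' hs e he hel
  obtain ⟨rfl, rfl⟩ := List.cons_eq_cons.1 hs
  have h := pathOn_segment (G := G) hinj hadj j 0 e (by omega)
  rw [Nat.zero_add] at h
  refine ⟨_, _, h, fun v hv => ?_, fun j' hj k hk hkl => ?_⟩
  · obtain ⟨k, hk, rfl⟩ := Finset.mem_image.1 hv
    rw [Finset.mem_Icc] at hk
    exact Or.inl ⟨j, by simp, k, by omega, rfl⟩
  · rw [List.mem_singleton] at hj
    subst hj
    exact Finset.mem_image_of_mem _ (Finset.mem_Icc.2 (by omega))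

/-- The end e on path i was left free among the last t vertices, so it can be the vertex where the
connecting path starts. The new path enters j among its first t vertices and again leaves its own
end free, so all middle vertices are kept. -/
lemma Merged.cons (hinj : ∀ i j k k', k < l → k' < l → p i k = p j k' → i = j ∧ k = k')
    (hadj : ∀ i k, k + 1 < l → G.Adj (p i k) (p i (k + 1))) (hR : ∀ i k, k < l → p i k ∉ R)
    (ht : 2 * t ≤ l) {Z : Finset V} (hZ : Z ⊆ R) {i j : ι} {s : List ι}
    (hm : Merged G p l t Z (i :: s)) (hj : j ∉ i :: s) {e b : ℕ} {S : Finset V}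
    (he : l ≤ e + t) (hel : e < l) (hb : b < t) (hS : PathOn G (p i e) (p j b) S)
    (hSR : ∀ x ∈ S, x = p i e ∨ x = p j b ∨ x ∈ R \ Z) :
    Merged G p l t (Z ∪ (S ∩ R)) (j :: i :: s) := by
  intro j' s' hs e' he' hel'
  obtain ⟨rfl, rfl⟩ := List.cons_eq_cons.1 hs
  obtain ⟨x, Q, hQ, hQv, hQc⟩ := hm i s rfl e he hel
  have hseg := pathOn_segment (G := G) hinj hadj j b (e' - b) (by omega)
  rw [Nat.add_sub_cancel' (by omega)] at hseg
  have hjQ : ∀ k < l, p j k ∉ Q := by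
    intro k hk h
    rcases hQv _ h with ⟨j', hj', k', hk', h'⟩ | h'
    · exact hj ((hinj j j' k k' hk hk' h').1 ▸ hj')
    · exact hR j k hk (hZ h')
  have hij : i ≠ j := fun h => hj (h ▸ List.mem_cons_self)
  have h1 := hQ.trans hS (fun v hv hvS => by
    rcases hSR v hvS with h | h | h
    · exact h
    · exact absurd hv (h ▸ hjQ b (by omega))
    · rw [Finset.mem_sdiff] at h
      rcases hQv v hv with ⟨j', -, k, hk, rfl⟩ | h'
      · exact absurd h.1 (hR _ _ hk)
      · exact absurd h' h.2)
  have h2 := h1.trans hseg (fun v hv hv2 => by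
    obtain ⟨k, hk, rfl⟩ := Finset.mem_image.1 hv2
    rw [Finset.mem_Icc] at hk
    rcases Finset.mem_union.1 hv with hv | hv
    · exact absurd hv (hjQ k (by omega))
    · rcases hSR _ hv with h | h | h
      · exact absurd (hinj _ _ _ _ (by omega) hel h).1.symm hij
      · exact h
      · exact absurd (Finset.mem_sdiff.1 h).1 (hR _ _ (by omega)))
  refine ⟨x, _, h2, fun v hv => ?_, fun j' hj' k hk hkl => ?_⟩
  · rcases Finset.mem_union.1 hv with hv | hv
    · rcases Finset.mem_union.1 hv with hv | hv
      · rcases hQv v hv with ⟨j', hj', h⟩ | h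
        · exact Or.inl ⟨j', List.mem_cons_of_mem _ hj', h⟩
        · exact Or.inr (Finset.mem_union_left _ h)
      · rcases hSR v hv with h | h | h
        · exact Or.inl ⟨i, by simp, e, hel, h⟩
        · exact Or.inl ⟨j, by simp, b, by omega, h⟩
        · exact Or.inr (Finset.mem_union_right _
            (Finset.mem_inter.2 ⟨hv, (Finset.mem_sdiff.1 h).1⟩))
    · obtain ⟨k, hk, rfl⟩ := Finset.mem_image.1 hv
      rw [Finset.mem_Icc] at hk
      exact Or.inl ⟨j, by simp, k, by omega, rfl⟩
  · rcases List.mem_cons.1 hj' with rfl | hj'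
    · exact Finset.mem_union_right _
        (Finset.mem_image_of_mem _ (Finset.mem_Icc.2 (by omega)))
    · exact Finset.mem_union_left _ (Finset.mem_union_left _ (hQc j' hj' k hk hkl))

variable [Fintype ι]

/-- Depth-first search merges all but a few paths of a family into a single path. -/
lemma exists_merged_path (hinj : ∀ i j k k', k < l → k' < l → p i k = p j k' → i = j ∧ k = k')
    (hadj : ∀ i k, k + 1 < l → G.Adj (p i k) (p i (k + 1))) (hR : ∀ i k, k < l → p i k ∉ R)
    (ht0 : 0 < t) (ht : 2 * t ≤ l) {m : ℕ} (hm : 2 * m ≤ Fintype.card ι)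
    (hjoin : ∀ (A B : Finset ι) (Z : Finset V), m ≤ #A → m ≤ #B → Z ⊆ R →
      #Z ≤ c * Fintype.card ι → ∃ i ∈ A, ∃ j ∈ B, Joined G p l t c R Z i j) :
    ∃ (s : Finset ι) (x y : V) (S : Finset V), Fintype.card ι ≤ #s + 2 * m ∧ PathOn G x y S ∧
      (∀ v ∈ S, (∃ i, ∃ k < l, v = p i k) ∨ v ∈ R) ∧
      ∀ i ∈ s, ∀ k, t ≤ k → k + t < l → p i k ∈ S := by
  -- Search state: s is the stack, A the finished paths, U the unvisited ones, Z the reservoir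
  -- vertices used so far. Each step shrinks U or enlarges A by one. Z grows by at most c only when
  -- U shrinks, which bounds it by c|ι|. Every suffix of the stack stays merged, so that popping is
  -- possible.
  have key : ∀ r ≤ Fintype.card ι, ∃ (s : List ι) (A U : Finset ι) (Z : Finset V), s.Nodup ∧
      (∀ i ∈ s, i ∉ A ∧ i ∉ U) ∧ (∀ i ∈ U, i ∉ A) ∧ s.length + #A + #U = Fintype.card ι ∧
      #U + r = Fintype.card ι + #A ∧ Z ⊆ R ∧ #Z + c * #U ≤ c * Fintype.card ι ∧
      (∀ i ∈ A, ∀ j ∈ U, ¬ Joined G p l t c R Z i j) ∧ ∀ s', s' <:+ s → Merged G p l t Z s' := by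
    intro r
    induction r with
    | zero =>
      intro _
      refine ⟨[], ∅, univ, ∅, by simp, by simp, by simp, by simp, by simp, by simp, by simp, by simp,
        fun s' hs' => ?_⟩
      rw [List.suffix_nil.1 hs']
      intro i s' h
      exact absurd h (by simp)
    | succ r ih =>
      intro hr
      obtain ⟨s, A, U, Z, hnd, hsAU, hUA, hcard, hr', hZ, hZc, hno, hmerge⟩ := ih (by omega)
      have hU : 0 < #U := by omega
      rcases s with _ | ⟨i, s⟩
      · obtain ⟨j, hj⟩ := Finset.card_pos.1 hU
        have hc := Finset.card_erase_add_one hj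
        simp only [List.length_nil] at hcard
        refine ⟨[j], A, U.erase j, Z, by simp, fun i hi => ?_,
          fun i hi => hUA i (Finset.mem_of_mem_erase hi), ?_, by omega, hZ, ?_,
          fun i hi k hk => hno i hi k (Finset.mem_of_mem_erase hk), fun s' hs' => ?_⟩
        · rw [List.mem_singleton] at hi
          subst hi
          exact ⟨hUA _ hj, Finset.notMem_erase _ _⟩
        · simp only [List.length_singleton]; omega
        · exact (Nat.add_le_add_left (Nat.mul_le_mul_left _ (by omega)) _).trans hZc
        · rcases List.suffix_cons_iff.1 hs' with rfl | h
          · exact merged_singleton hinj hadj Z j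
          · exact hmerge s' h
      · simp only [List.length_cons] at hcard
        rw [List.nodup_cons] at hnd
        by_cases hJ : ∃ j ∈ U, Joined G p l t c R Z i j
        · obtain ⟨j, hj, e, b, S, he, hel, hb, hS, hSc, hSR⟩ := hJ
          have hc := Finset.card_erase_add_one hj
          have hjs : j ∉ i :: s := fun h => (hsAU j h).2 hj
          have hZ' : Z ⊆ Z ∪ (S ∩ R) := Finset.subset_union_left
          refine ⟨j :: i :: s, A, U.erase j, Z ∪ (S ∩ R), List.nodup_cons.2
            ⟨hjs, List.nodup_cons.2 hnd⟩, fun i' hi' => ?_,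
            fun i hi => hUA i (Finset.mem_of_mem_erase hi), ?_, by omega,
            Finset.union_subset hZ Finset.inter_subset_right, ?_,
            fun i' hi' k hk h => hno i' hi' k (Finset.mem_of_mem_erase hk) (h.mono hZ'),
            fun s' hs' => ?_⟩
          · rcases List.mem_cons.1 hi' with rfl | hi'
            · exact ⟨hUA _ hj, Finset.notMem_erase _ _⟩
            · exact ⟨(hsAU i' hi').1, fun h => (hsAU i' hi').2 (Finset.mem_of_mem_erase h)⟩
          · simp only [List.length_cons]; omega
          · have h1 := Finset.card_union_le Z (S ∩ R)
            have h2 : #(S ∩ R) ≤ c := (Finset.card_le_card Finset.inter_subset_left).trans hSc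
            rw [← hc, mul_add, mul_one] at hZc
            omega
          · rcases List.suffix_cons_iff.1 hs' with rfl | h
            · exact (hmerge _ List.suffix_rfl).cons hinj hadj hR ht hZ hjs he hel hb hS hSR
            · exact (hmerge s' h).mono hZ'
        -- Dead end: the top path moves to the finished set. Its reservoir vertices remain in Z,
        -- which preserves the absence of joins from A to U.
        · push Not at hJ
          have hiA := (hsAU i List.mem_cons_self).1
          have hc := Finset.card_insert_of_notMem hiA
          refine ⟨s, insert i A, U, Z, hnd.2, fun i' hi' => ?_, fun k hk => ?_, by omega, by omega,
            hZ, hZc, fun i' hi' => ?_, fun s' hs' => hmerge s' (hs'.trans (List.suffix_cons _ _))⟩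
          · have h := hsAU i' (List.mem_cons_of_mem _ hi')
            refine ⟨fun h' => ?_, h.2⟩
            rcases Finset.mem_insert.1 h' with rfl | h'
            exacts [hnd.1 hi', h.1 h']
          · intro h'
            rcases Finset.mem_insert.1 h' with rfl | h'
            exacts [(hsAU _ List.mem_cons_self).2 hk, hUA k hk h']
          · rcases Finset.mem_insert.1 hi' with rfl | hi'
            exacts [hJ, hno i' hi']
  obtain ⟨s, A, U, Z, hnd, -, -, hcard, hr, hZ, hZc, hno, hmerge⟩ := key _ le_rfl
  -- After |ι| steps |A| = |U|, and no path in A is joined to one in U, so both have fewer than m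
  -- elements.
  have hUm : #U < m := by
    by_contra! h
    obtain ⟨i, hi, j, hj, hij⟩ := hjoin A U Z (by omega) h hZ (by omega)
    exact hno i hi j hj hij
  rcases s with _ | ⟨i, s⟩
  · simp only [List.length_nil] at hcard; omega
  · obtain ⟨x, S, hS, hSv, hSc⟩ := hmerge _ List.suffix_rfl i s rfl (l - 1) (by omega) (by omega)
    refine ⟨(i :: s).toFinset, x, _, S, ?_, hS, fun v hv => ?_, fun j hj => hSc j (by simpa using hj)⟩
    · rw [List.toFinset_card_of_nodup hnd]; omega
    · rcases hSv v hv with ⟨j, -, h⟩ | h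
      exacts [Or.inl ⟨j, h⟩, Or.inr (hZ h)]

end Joining
end ExpanderCycle

namespace ExpanderCycle
open Finset
open scoped Classical

/-! ### The working hypotheses in integer parameters. -/

section Parameters

variable {V : Type*} [Fintype V] {G : SimpleGraph V} {D X Y : ℕ}

/-- A nearly regular graph with edge expansion, whose degree is large compared with powers of
`X` and `Y`; here `X` stands for the logarithm of the number of vertices. -/
structure RegularExpander (G : SimpleGraph V) (D X Y : ℕ) : Prop extends EdgeExpander G D Y where
  large : 2 ^ 100 ≤ X
  card_le : Fintype.card V ≤ 2 ^ X
  degree_large : X ^ 50 * Y ^ 10 ≤ D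
  le_degree : ∀ v, D ≤ 3 * dg G v univ
  average : (1 - 1 / (X : ℝ) ^ 2) * (D * Fintype.card V) ≤ (∑ v, dg G v univ : ℕ)

namespace RegularExpander

lemma X_pos (h : RegularExpander G D X Y) : 0 < X := lt_of_lt_of_le (by norm_num) h.large

lemma Y_pos (h : RegularExpander G D X Y) : 0 < Y := by have := h.pos_ratio; omega

lemma pow_le (h : RegularExpander G D X Y) {a b : ℕ} (ha : a ≤ 49) (hb : b ≤ 10) :
    2 ^ 100 * (X ^ a * Y ^ b) ≤ D := by
  have h1 : X ^ a ≤ X ^ 49 := Nat.pow_le_pow_right h.X_pos ha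
  have h2 : Y ^ b ≤ Y ^ 10 := Nat.pow_le_pow_right h.Y_pos hb
  calc 2 ^ 100 * (X ^ a * Y ^ b) ≤ X * (X ^ 49 * Y ^ 10) :=
        Nat.mul_le_mul h.large (Nat.mul_le_mul h1 h2)
    _ = X ^ 50 * Y ^ 10 := by ring
    _ ≤ D := h.degree_large

lemma D_le [Nonempty V] (h : RegularExpander G D X Y) : D ≤ 3 * Fintype.card V := by
  obtain ⟨v⟩ := ‹Nonempty V›
  refine (h.le_degree v).trans (Nat.mul_le_mul_left _ ?_)
  exact Finset.card_le_univ _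

lemma card_mul_exp (h : RegularExpander G D X Y) {a : ℝ} (ha : X + 6 ≤ a) :
    Fintype.card V * Real.exp (-a) ≤ 1 / 200 := by
  have h1 : (Fintype.card V : ℝ) ≤ 2 ^ X := by exact_mod_cast h.card_le
  have h2 : (2 : ℝ) ^ X ≤ Real.exp X := by
    rw [← mul_one (X : ℝ), Real.exp_nat_mul]
    exact pow_le_pow_left₀ (by norm_num) (by linarith [Real.exp_one_gt_d9]) _
  have h3 : (200 : ℝ) ≤ Real.exp 6 := by
    have : Real.exp 6 = Real.exp 1 ^ 6 := by rw [← Real.exp_nat_mul]; norm_num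
    rw [this]
    calc (200 : ℝ) ≤ 2.7 ^ 6 := by norm_num
      _ ≤ _ := pow_le_pow_left₀ (by norm_num) (by linarith [Real.exp_one_gt_d9]) _
  calc Fintype.card V * Real.exp (-a) ≤ Real.exp X * Real.exp (-(X + 6)) := by
        refine mul_le_mul (h1.trans h2) (Real.exp_le_exp.2 (neg_le_neg ha)) (Real.exp_pos _).le
          (Real.exp_pos _).le
    _ = (Real.exp 6)⁻¹ := by rw [← Real.exp_add, ← Real.exp_neg]; congr 1; ring
    _ ≤ 1 / 200 := by
        rw [one_div]
        exact inv_anti₀ (by norm_num) h3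

/-- Instantiates the thresholds with M = P, K = X²P, k = X³PY and z = X²PY. Each exponent in the
union bounds becomes a multiple of X² or X³, well above the X + 6 needed to beat the number of
vertices. -/
lemma exists_reservoir [Nonempty V] (h : RegularExpander G D X Y) {P : ℕ} (hP : 0 < P)
    (h1 : 20000 * (X ^ 2 * P ^ 2) ≤ D) (h2 : 6 * (X ^ 3 * P * Y) ≤ D) :
    ∃ R : Finset V, P * #R ≤ 34 * (X * Y) * Fintype.card V ∧
      (∀ x y Z, 3 * (X ^ 2 * P * Y) * #Z ≤ D → ∃ S, PathOn G x y S ∧ #S ≤ 35 * (X * Y) ∧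
        ∀ v ∈ S, v = x ∨ v = y ∨ v ∈ R \ Z) ∧
      ∀ A B Z : Finset V, A.Nonempty → B.Nonempty → 6 * (X ^ 2 * P * Y) * #Z ≤ #A →
        6 * (X ^ 2 * P * Y) * #Z ≤ #B →
        ∃ a ∈ A, ∃ b ∈ B, ∃ S, PathOn G a b S ∧ #S ≤ 35 * (X * Y) ∧
          ∀ x ∈ S, x = a ∨ x = b ∨ x ∈ R \ Z := by
  have : NeZero P := ⟨hP.ne'⟩
  have hX0 := h.X_pos
  have hY0 := h.Y_pos
  have hXl : 10000 ≤ X := le_trans (by norm_num) h.large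
  have hX : (10000 : ℝ) ≤ X := by exact_mod_cast hXl
  have hP' : (0 : ℝ) < P := by exact_mod_cast hP
  have hY' : (0 : ℝ) < Y := by exact_mod_cast hY0
  have hXY : 1 ≤ X * Y := Nat.mul_pos hX0 hY0
  have hP2 : P ≤ X ^ 2 * P ^ 2 := by
    have : 1 ≤ X ^ 2 * P := Nat.mul_pos (by positivity) hP
    nlinarith
  have hD := h.D_le
  have hX2 : 10000 * 10000 ≤ X ^ 2 := by nlinarith
  have hPY : P ≤ P * Y := Nat.le_mul_of_pos_right _ hY0
  have hYP : Y ≤ P * Y := Nat.le_mul_of_pos_left _ hP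
  obtain ⟨R, hR, hR1, hR2⟩ := exists_reservoir_paths (K := X ^ 2 * P) (M := P)
    (k := X ^ 3 * P * Y) (z := X ^ 2 * P * Y) h.toEdgeExpander
    (by
      refine (h.card_mul_exp ?_).trans (by norm_num)
      have : ((X ^ 2 * P : ℕ) : ℝ) / (2 * P) = X ^ 2 / 2 := by push_cast; field_simp
      rw [this]; nlinarith)
    (by nlinarith)
    (by omega) h.card_le (by positivity)
    (by
      refine h.card_mul_exp ?_
      have : ((X ^ 3 * P * Y : ℕ) : ℝ) / (512 * P * Y) = X ^ 3 / 512 := by push_cast; field_simp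
      rw [this]; nlinarith [mul_pos (lt_of_lt_of_le (by norm_num) hX) (lt_of_lt_of_le (by norm_num : (0 : ℝ) < 10000) hX)])
    (by
      refine (h.card_mul_exp ?_).trans (by norm_num)
      have : ((X ^ 2 * P * Y : ℕ) : ℝ) / (512 * P * Y) = X ^ 2 / 512 := by push_cast; field_simp
      rw [this]; nlinarith)
    (by nlinarith) (by nlinarith) h.le_degree h2
  have hc : 2 * (16 * Y * X + 1) + 1 ≤ 35 * (X * Y) := by nlinarith
  refine ⟨R, hR.trans ?_, fun x y Z hZ => ?_, fun A B Z hA hB hZA hZB => ?_⟩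
  · nlinarith
  · obtain ⟨S, hS, hSc, hSs⟩ := hR1 x y Z hZ
    exact ⟨S, hS, hSc.trans hc, hSs⟩
  · obtain ⟨a, ha, b, hb, S, hS, hSc, hSs⟩ := hR2 A B Z hA hB hZA hZB
    exact ⟨a, ha, b, hb, S, hS, hSc.trans hc, hSs⟩

lemma sum_dg_compl (h : RegularExpander G D X Y) (B : Finset V) :
    ∑ v, dg G v univ ≤ ∑ v ∈ Bᶜ, dg G v Bᶜ + 2 * (D * #B) := by
  have h1 := sum_dg_union (G := G) (disjoint_compl_left : Disjoint Bᶜ B)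
  have h2 : Bᶜ ∪ B = univ := by rw [Finset.union_comm]; exact Finset.union_compl B
  rw [h2] at h1
  have h3 : ∑ v ∈ B, dg G v B + ∑ v ∈ B, dg G v Bᶜ ≤ D * #B := by
    rw [← Finset.sum_add_distrib]
    have : ∀ v ∈ B, dg G v B + dg G v Bᶜ = dg G v univ := fun v _ => by
      rw [← dg_union G v disjoint_compl_right, Finset.union_compl]
    rw [Finset.sum_congr rfl this]
    exact sum_dg_le G h.degree_le _ _
  have h4 := sum_dg_comm G Bᶜ B
  omega

end RegularExpander
end Parameters
end ExpanderCycle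

namespace ExpanderCycle
open Finset
open scoped Classical

/-! ### Branch paths, the path cover and the long path. -/

section Core

variable {V : Type*} [Fintype V] {G : SimpleGraph V} {D X Y : ℕ}

namespace RegularExpander

/-- The complement of B still has average degree at least D/2, so it contains an expanding subset W.
Minimum degree at least D/8 there makes W large enough to host all branch vertices. -/
lemma exists_branch_paths [Nonempty V] (h : RegularExpander G D X Y) (B : Finset V)
    (hB : 8 * #B ≤ Fintype.card V) {ι : Type*} [Fintype ι] (E : Finset (Sym2 ι))
    (hE : 256 * X * (40 * X ^ 2 * #E + Fintype.card ι) ≤ D) :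
    ∃ (b : ι → V) (f : Sym2 ι → Finset V), Function.Injective b ∧ (∀ w, b w ∉ B) ∧
      (∀ u v, s(u, v) ∈ E → PathOn G (b u) (b v) (f s(u, v))) ∧
      (∀ e ∈ E, Disjoint (f e) B ∧ #(f e) ≤ 40 * X ^ 2) ∧
      (∀ u v, s(u, v) ∈ E → ∀ w, b w ∈ f s(u, v) → b w = b u ∨ b w = b v) ∧
      ∀ e ∈ E, ∀ e' ∈ E, e ≠ e' → ∀ x ∈ f e, x ∈ f e' → x ∈ Set.range b := by
  have hX0 := h.X_pos
  have hn : 0 < Fintype.card V := Fintype.card_pos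
  have hcompl : #Bᶜ = Fintype.card V - #B := Finset.card_compl B
  have hne : (Bᶜ).Nonempty := by
    rw [← Finset.card_pos]; omega
  have hdense : D * #Bᶜ ≤ 2 * ∑ v ∈ Bᶜ, dg G v Bᶜ := by
    have h1 := h.sum_dg_compl B
    have h2 : 3 * (D * Fintype.card V) ≤ 4 * ∑ v, dg G v univ := by
      have h3 := h.average
      have hXl : (2 ^ 100 : ℝ) ≤ X := by exact_mod_cast h.large
      have h4 : 1 / (X : ℝ) ^ 2 ≤ 1 / 4 :=
        one_div_le_one_div_of_le (by norm_num) (by nlinarith)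
      have h5 : (3 / 4 : ℝ) * (D * Fintype.card V) ≤ (∑ v, dg G v univ : ℕ) :=
        (mul_le_mul_of_nonneg_right (by linarith) (by positivity)).trans h3
      have h6 : 3 * ((D : ℝ) * Fintype.card V) ≤ 4 * ((∑ v, dg G v univ : ℕ) : ℝ) := by linarith
      exact_mod_cast h6
    have h3 : D * #Bᶜ ≤ D * Fintype.card V := Nat.mul_le_mul_left _ (Finset.card_le_univ _)
    have h4 : 8 * (D * #B) ≤ D * Fintype.card V := by
      calc 8 * (D * #B) = D * (8 * #B) := by ring
        _ ≤ _ := Nat.mul_le_mul_left _ hB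
    omega
  obtain ⟨W, hWB, hWne, hdeg, hexp⟩ := exists_expanding_subset hX0 h.card_le Bᶜ hne hdense
  have hcard : Fintype.card ι ≤ Fintype.card W := by
    obtain ⟨w, hw⟩ := hWne
    have h1 := hdeg w hw
    have h2 : dg G w W ≤ #W := Finset.card_filter_le _ _
    have h3 : 256 * Fintype.card ι ≤ D := by
      refine le_trans ?_ hE
      have : Fintype.card ι ≤ X * Fintype.card ι := Nat.le_mul_of_pos_left _ hX0
      nlinarith [Nat.zero_le (X * (40 * X ^ 2 * #E))]
    rw [Fintype.card_coe]
    omega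
  obtain ⟨g⟩ := Function.Embedding.nonempty_of_card_le hcard
  have hWB' : Disjoint W B := Finset.disjoint_left.2 fun x hx => Finset.mem_compl.1 (hWB hx)
  obtain ⟨f, h1, h2, h3, h4⟩ := exists_linkage hX0 h.card_le h.pos_degree h.degree_le hdeg hexp
    (fun w => (g w : V)) (fun w => (g w).2) E hE
  exact ⟨fun w => g w, f, fun _ _ hab => g.injective (Subtype.ext hab),
    fun w => Finset.disjoint_left.1 hWB' (g w).2, h1,
    fun e he => ⟨Finset.disjoint_of_subset_left (h2 e he).1 hWB', (h2 e he).2⟩, h3, h4⟩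

/-- The path length l = X¹²Y³ is long compared with the connecting paths and with the end segments
sacrificed in merging, while D remains far above l³X⁴ as the layering requires. -/
lemma exists_cover [Nonempty V] (h : RegularExpander G D X Y) (B : Finset V)
    (hB : X ^ 2 * #B ≤ 4000 * Fintype.card V) :
    ∃ (I : Finset V) (p : V → ℕ → V), (∀ v ∈ I, ∀ k < X ^ 12 * Y ^ 3, p v k ∉ B) ∧
      (∀ v ∈ I, ∀ w ∈ I, ∀ k < X ^ 12 * Y ^ 3, ∀ k' < X ^ 12 * Y ^ 3,
        p v k = p w k' → v = w ∧ k = k') ∧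
      (∀ v ∈ I, ∀ k, k + 1 < X ^ 12 * Y ^ 3 → G.Adj (p v k) (p v (k + 1))) ∧
      (1 - 30000 / (X : ℝ) ^ 2) * Fintype.card V ≤ #I * (X ^ 12 * Y ^ 3 : ℕ) := by
  have hX0 := h.X_pos
  have hY0 := h.Y_pos
  have hXl : (10 ^ 20 : ℝ) ≤ X := by
    have : 10 ^ 20 ≤ X := le_trans (by norm_num) h.large
    exact_mod_cast this
  have hX' : (0 : ℝ) < X := by linarith
  have hY' : (1 : ℝ) ≤ Y := by exact_mod_cast hY0
  have hD' : (0 : ℝ) < D := by exact_mod_cast h.pos_degree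
  have hn : (0 : ℝ) < Fintype.card V := by exact_mod_cast Fintype.card_pos
  set n : ℝ := (Fintype.card V : ℝ) with hndef
  have hX2 : (10 ^ 40 : ℝ) ≤ X ^ 2 := by nlinarith
  have hX2' : (0 : ℝ) < X ^ 2 := by positivity
  have hB' : (#B : ℝ) ≤ 4000 / X ^ 2 * n := by
    have : (X ^ 2 * #B : ℝ) ≤ 4000 * n := by rw [hndef]; exact_mod_cast hB
    rw [div_mul_eq_mul_div, le_div_iff₀ hX2']
    linarith
  have hUc : ((#Bᶜ : ℕ) : ℝ) = n - #B := by
    rw [Finset.card_compl, Nat.cast_sub (Finset.card_le_univ _)]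
  have hsmall : 30000 / (X : ℝ) ^ 2 ≤ 1 / 100 := by
    rw [div_le_div_iff₀ hX2' (by norm_num)]; linarith
  set q : ℝ := 1 / (X : ℝ) ^ 2 with hq
  have hq0 : 0 < q := by positivity
  have hdiv : ∀ a : ℝ, a / (X : ℝ) ^ 2 = a * q := fun a => by rw [hq]; ring
  rw [hdiv] at hsmall
  rw [hdiv] at hB'
  rw [hdiv]
  have hU0 : (Bᶜ).Nonempty := by
    rw [← Finset.card_pos]
    have : (0 : ℝ) < (#Bᶜ : ℕ) := by rw [hUc]; nlinarith
    exact_mod_cast this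
  -- 8001 = 1 + 2·4000: the defect in average degree plus the loss of at most 2D in the degree sum
  -- per deleted vertex.
  have havg : (1 - 8001 * q) * (D * #Bᶜ) ≤ (∑ v ∈ Bᶜ, dg G v Bᶜ : ℕ) := by
    have h1 := h.sum_dg_compl B
    have h1' : ((∑ v, dg G v univ : ℕ) : ℝ) ≤ (∑ v ∈ Bᶜ, dg G v Bᶜ : ℕ) + 2 * (D * #B) := by
      exact_mod_cast h1
    have h2 := h.average
    rw [← hndef, ← hq] at h2
    have h3 : (D : ℝ) * #B ≤ D * (4000 * q * n) := mul_le_mul_of_nonneg_left hB' hD'.le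
    have h4 : (1 - 8001 * q) * (D * #Bᶜ) ≤ (1 - 8001 * q) * (D * n) := by
      refine mul_le_mul_of_nonneg_left (mul_le_mul_of_nonneg_left ?_ hD'.le) (by linarith)
      rw [hUc]
      have : (0 : ℝ) ≤ #B := Nat.cast_nonneg _
      linarith
    linarith
  set l : ℕ := X ^ 12 * Y ^ 3 with hl
  have hl0 : 0 < l := by positivity
  have hl' : (0 : ℝ) < l := by exact_mod_cast hl0
  -- The relative error η = q/l is chosen so that the accumulated loss 5ηl is 5q.
  have hη : (q / l : ℝ) ≤ 1 := by
    rw [div_le_one hl']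
    have : (1 : ℝ) ≤ l := by exact_mod_cast hl0
    linarith
  have hexp : 2 * (l * (n + 1)) * Real.exp (-((q / l) ^ 2 * D / (36 * l))) < 1 := by
    -- The exponent equals D/(36X⁴⁰Y⁹); the layering makes the heaviest demand on the degree.
    have e1 : (2 * X + 100 : ℝ) ≤ (q / l) ^ 2 * D / (36 * l) := by
      have h1 := h.pow_le (a := 42) (b := 9) (by norm_num) (by norm_num)
      have h2 : (2 ^ 100 * (X ^ 42 * Y ^ 9) : ℝ) ≤ D := by exact_mod_cast h1
      have h3 : (q / l) ^ 2 * D / (36 * l) = D / (36 * (X ^ 40 * Y ^ 9)) := by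
        rw [hq, hl]; push_cast; field_simp
      rw [h3, le_div_iff₀ (by positivity)]
      have h4 : (X : ℝ) ^ 42 * Y ^ 9 = X ^ 2 * (X ^ 40 * Y ^ 9) := by ring
      rw [h4] at h2
      refine le_trans ?_ h2
      have h5 : (0 : ℝ) < X ^ 40 * Y ^ 9 := by positivity
      have h6 : (2 * X + 100) * 36 ≤ (2 ^ 100 * X ^ 2 : ℝ) := by nlinarith
      calc (2 * X + 100) * (36 * (X ^ 40 * Y ^ 9)) = ((2 * X + 100) * 36) * (X ^ 40 * Y ^ 9 : ℝ) := by
            ring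
        _ ≤ (2 ^ 100 * X ^ 2) * (X ^ 40 * Y ^ 9) := mul_le_mul_of_nonneg_right h6 h5.le
        _ = _ := by ring
    have e2 : (l : ℝ) ≤ n := by
      have h1 := h.pow_le (a := 12) (b := 3) (by norm_num) (by norm_num)
      have h2 := h.D_le
      have : l ≤ Fintype.card V := by rw [hl]; omega
      rw [hndef]; exact_mod_cast this
    have hn1 : (1 : ℝ) ≤ n := by rw [hndef]; exact_mod_cast Fintype.card_pos
    have e3 := h.card_mul_exp (a := X + 50) (by linarith)
    rw [← hndef] at e3
    have e4 : Real.exp (-((q / l) ^ 2 * D / (36 * l))) ≤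
        Real.exp (-(X + 50)) * Real.exp (-(X + 50)) := by
      rw [← Real.exp_add]
      exact Real.exp_le_exp.2 (by linarith)
    set z := Real.exp (-((X : ℝ) + 50))
    have hz : 0 < z := Real.exp_pos _
    calc 2 * (l * (n + 1)) * Real.exp (-((q / l) ^ 2 * D / (36 * l)))
        ≤ 2 * (n * (n + n)) * (z * z) := by gcongr
      _ = 4 * ((n * z) * (n * z)) := by ring
      _ ≤ 4 * ((1 / 200) * (1 / 200)) := by gcongr
      _ < 1 := by norm_num
  obtain ⟨I, p, h1, h2, h3, h4⟩ := exists_path_cover hl0 h.pos_degree (by positivity) hη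
    h.degree_le Bᶜ havg (by linarith) hU0 hexp
  refine ⟨I, p, fun v hv k hk => Finset.mem_compl.1 (h1 v hv k hk), h2, h3, le_trans ?_ h4⟩
  have e : 5 * (q / l) * l = 5 * q := by field_simp
  rw [e, hUc]
  have hB0 : (0 : ℝ) ≤ #B := Nat.cast_nonneg _
  nlinarith [mul_nonneg hq0.le hB0, mul_nonneg hq0.le hn.le]

/-- Loss accounting with q = 1/X²: 30000q outside the cover, 4q from paths dropped by the search, 2q
from trimmed ends. The total 30006/X² is below 1/X. -/
lemma uncovered_le {X n a s m l t Q : ℝ} (hX : 10 ^ 20 ≤ X) (hn : 0 ≤ n) (ha : 0 ≤ a) (hl : 0 ≤ l)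
    (h1 : (1 - 30000 / X ^ 2) * n ≤ a * l) (h2 : X ^ 2 * m ≤ 2 * a) (h3 : a ≤ s + 2 * m)
    (h4 : l = X ^ 2 * t) (h5 : s * (l - 2 * t) ≤ Q) : X * (n - Q) ≤ n := by
  have hX' : 0 < X := by linarith
  set q : ℝ := 1 / X ^ 2 with hq
  have hq0 : 0 < q := by positivity
  have hqX : q * X ^ 2 = 1 := by rw [hq]; field_simp
  have hdiv : 30000 / X ^ 2 = 30000 * q := by rw [hq]; ring
  rw [hdiv] at h1
  have e1 : (1 - 4 * q) * a ≤ s := by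
    have h := mul_le_mul_of_nonneg_left h2 hq0.le
    rw [← mul_assoc, hqX, one_mul] at h
    linarith
  have e2 : l - 2 * t = (1 - 2 * q) * l := by
    rw [h4]
    linear_combination (2 * t) * hqX
  have hq4 : q ≤ 1 / 10 ^ 10 := by
    rw [hq]
    exact one_div_le_one_div_of_le (by norm_num) (by nlinarith)
  have hal : 0 ≤ a * l := mul_nonneg ha hl
  have e3 : (1 - 30006 * q) * n ≤ Q := by
    rw [e2] at h5
    refine le_trans ?_ h5
    calc (1 - 30006 * q) * n ≤ (1 - 6 * q) * ((1 - 30000 * q) * n) := by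
          nlinarith [mul_nonneg (mul_pos hq0 hq0).le hn]
      _ ≤ (1 - 6 * q) * (a * l) := mul_le_mul_of_nonneg_left h1 (by linarith)
      _ ≤ ((1 - 4 * q) * a) * ((1 - 2 * q) * l) := by
          nlinarith [mul_nonneg (mul_pos hq0 hq0).le hal]
      _ ≤ s * ((1 - 2 * q) * l) :=
          mul_le_mul_of_nonneg_right e1 (mul_nonneg (by linarith) hl)
  have h6 : X * (n - Q) ≤ X * (30006 * q * n) :=
    mul_le_mul_of_nonneg_left (by linarith) hX'.le
  have h7 : X * (30006 * q) ≤ 1 := by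
    have : X * (30006 * q) = 30006 / X := by rw [hq]; field_simp
    rw [this, div_le_one hX']
    linarith
  nlinarith

/-- A path through almost all vertices which avoids a second, much sparser reservoir. -/
lemma exists_long_path [Nonempty V] (h : RegularExpander G D X Y) (R R' B : Finset V)
    (hRB : R ⊆ B) (hRB' : R' ⊆ B) (hB : X ^ 2 * #B ≤ 4000 * Fintype.card V)
    (hR' : X ^ 13 * Y ^ 3 * #R' ≤ 34 * (X * Y) * Fintype.card V)
    (hjoin : ∀ A B Z : Finset V, A.Nonempty → B.Nonempty → 6 * (X ^ 2 * (X ^ 4 * Y) * Y) * #Z ≤ #A →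
        6 * (X ^ 2 * (X ^ 4 * Y) * Y) * #Z ≤ #B →
        ∃ a ∈ A, ∃ b ∈ B, ∃ S, PathOn G a b S ∧ #S ≤ 35 * (X * Y) ∧
          ∀ x ∈ S, x = a ∨ x = b ∨ x ∈ R \ Z) :
    ∃ x y Q, PathOn G x y Q ∧ (∀ v ∈ Q, v ∉ R' ∧ (v ∈ B → v ∈ R)) ∧
      X * #Qᶜ ≤ Fintype.card V := by
  have hX0 := h.X_pos
  have hY0 := h.Y_pos
  have hXl : 10 ^ 20 ≤ X := le_trans (by norm_num) h.large
  obtain ⟨I, p, hpB, hinj, hadj, hI⟩ := h.exists_cover B hB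
  set l := X ^ 12 * Y ^ 3 with hl
  set t := X ^ 10 * Y ^ 3 with ht
  have hlt : l = X ^ 2 * t := by rw [hl, ht]; ring
  have ht0 : 0 < t := by positivity
  have hX2 : 10 ^ 40 ≤ X ^ 2 := by nlinarith
  have htl : 2 * t ≤ l := by rw [hlt]; exact Nat.mul_le_mul_right _ (by omega)
  -- The search may drop 2m paths, so m should be about |I|/X². Rounding up is harmless since |I| ≥
  -- 10X².
  set m := #I / X ^ 2 + 1 with hm
  have hmX : #I ≤ X ^ 2 * m := by
    rw [hm]
    have := Nat.lt_mul_div_succ #I (show 0 < X ^ 2 by positivity)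
    exact this.le
  have hmX' : X ^ 2 * m ≤ #I + X ^ 2 := by
    rw [hm, mul_add, mul_one]
    exact Nat.add_le_add_right (Nat.mul_div_le _ _) _
  have hn0 : 0 < Fintype.card V := Fintype.card_pos
  have hIn : Fintype.card V ≤ 2 * (#I * l) := by
    have h1 : (30000 / (X : ℝ) ^ 2) ≤ 1 / 2 := by
      have : (10 ^ 40 : ℝ) ≤ X ^ 2 := by exact_mod_cast hX2
      rw [div_le_div_iff₀ (by linarith) (by norm_num)]; linarith
    have h2 : (Fintype.card V : ℝ) ≤ 2 * (#I * (l : ℕ)) := by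
      have : (0 : ℝ) < Fintype.card V := by exact_mod_cast hn0
      nlinarith
    exact_mod_cast h2
  have hIbig : 10 * X ^ 2 ≤ #I := by
    have h1 := h.pow_le (a := 14) (b := 3) (by norm_num) (by norm_num)
    have h2 := h.D_le
    have h3 : 60 * X ^ 2 * l ≤ 6 * #I * l := by
      calc 60 * X ^ 2 * l = 60 * (X ^ 14 * Y ^ 3) := by rw [hl]; ring
        _ ≤ 6 * #I * l := by
          rw [mul_assoc 6]; omega
    have h4 := Nat.le_of_mul_le_mul_right h3 (by positivity)
    omega
  let P : I → ℕ → V := fun i => p i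
  have hPinj : ∀ i j k k', k < l → k' < l → P i k = P j k' → i = j ∧ k = k' :=
    fun i j k k' hk hk' hij => by
      have := hinj i i.2 j j.2 k hk k' hk' hij
      exact ⟨Subtype.ext this.1, this.2⟩
  have hPB : ∀ i k, k < l → P i k ∉ B := fun i k hk => hpB i i.2 k hk
  have hcardI : Fintype.card I = #I := Fintype.card_coe I
  have hmI : 2 * m ≤ Fintype.card I := by
    rw [hcardI]
    have : X ^ 2 * (2 * m) ≤ X ^ 2 * #I := by nlinarith
    exact Nat.le_of_mul_le_mul_left this (by positivity)
  obtain ⟨s, x, y, Q, hs, hQ, hQv, hQc⟩ := exists_merged_path (G := G) (p := P) (l := l) (t := t)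
    (c := 35 * (X * Y)) (R := R \ R') (m := m) hPinj (fun i k hk => hadj i i.2 k hk)
    (fun i k hk hR => hPB i k hk (hRB (Finset.mem_sdiff.1 hR).1)) ht0 htl hmI
    (by
      intro A A' Z hA hA' hZ hZc
      rw [hcardI] at hZc
      -- R' has density about 34/(X¹²Y²), so it is small even against the number of paths and can
      -- simply be added to the obstacles.
      have hR'c : #R' ≤ 68 * Y * #I := by
        have h1 : X ^ 13 * Y ^ 3 * #R' ≤ X ^ 13 * Y ^ 3 * (68 * Y * #I) := by
          calc X ^ 13 * Y ^ 3 * #R' ≤ 34 * (X * Y) * (2 * (#I * l)) :=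
                hR'.trans (Nat.mul_le_mul_left _ hIn)
            _ = _ := by rw [hl]; ring
        exact Nat.le_of_mul_le_mul_left h1 (by positivity)
      have hZ' : #(Z ∪ R') ≤ 36 * (X * Y) * #I := by
        refine (Finset.card_union_le _ _).trans ((Nat.add_le_add hZc hR'c).trans ?_)
        have h1 : 68 * (Y * #I) ≤ X * (Y * #I) := Nat.mul_le_mul_right _ (by omega)
        nlinarith
      have hsz : ∀ m', m ≤ m' → 6 * (X ^ 2 * (X ^ 4 * Y) * Y) * #(Z ∪ R') ≤ m' * t := by
        intro m' hm'
        calc 6 * (X ^ 2 * (X ^ 4 * Y) * Y) * #(Z ∪ R')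
            ≤ 6 * (X ^ 2 * (X ^ 4 * Y) * Y) * (36 * (X * Y) * (X ^ 2 * m)) :=
              Nat.mul_le_mul_left _ (hZ'.trans (Nat.mul_le_mul_left _ hmX))
          _ = 216 * (m * (X ^ 9 * Y ^ 3)) := by ring
          _ ≤ X * (m * (X ^ 9 * Y ^ 3)) := Nat.mul_le_mul_right _ (by omega)
          _ = m * t := by rw [ht]; ring
          _ ≤ m' * t := Nat.mul_le_mul_right _ hm'
      -- The union of one block of t consecutive positions over the paths in A. It has |A|·t
      -- vertices, enough to outweigh the used reservoir, although |A| alone would not be.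
      let seg : Finset I → ℕ → Finset V := fun A a =>
        (A ×ˢ Ico a (a + t)).image fun i => P i.1 i.2
      have hseg : ∀ (A : Finset I) (a : ℕ), a + t ≤ l → #(seg A a) = #A * t := by
        intro A a ha
        rw [Finset.card_image_of_injOn, Finset.card_product, Nat.card_Ico, Nat.add_sub_cancel_left]
        rintro ⟨i, k⟩ hi ⟨j, k'⟩ hj hij
        simp only [coe_product, Set.mem_prod, mem_coe, mem_Ico] at hi hj
        obtain ⟨h1, h2⟩ := hPinj i j k k' (by omega) (by omega) hij
        exact Prod.ext h1 h2
      have hA0 : ∀ (A : Finset I) (a : ℕ), a + t ≤ l → m ≤ #A → (seg A a).Nonempty := by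
        intro A a ha hmA
        rw [← Finset.card_pos, hseg A a ha]
        exact Nat.mul_pos (lt_of_lt_of_le (Nat.succ_pos _) hmA) ht0
      obtain ⟨a, ha, b, hb, S, hS, hSc, hSs⟩ := hjoin (seg A (l - t)) (seg A' 0) (Z ∪ R')
        (hA0 A _ (by omega) hA) (hA0 A' _ (by omega) hA')
        ((hsz _ hA).trans (hseg A _ (by omega)).ge) ((hsz _ hA').trans (hseg A' _ (by omega)).ge)
      obtain ⟨⟨i, e⟩, hi, rfl⟩ := Finset.mem_image.1 ha
      obtain ⟨⟨j, k⟩, hj, rfl⟩ := Finset.mem_image.1 hb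
      simp only [mem_product, mem_Ico] at hi hj
      refine ⟨i, hi.1, j, hj.1, e, k, S, by omega, by omega, by omega, hS, hSc, fun v hv => ?_⟩
      rcases hSs v hv with h | h | h
      · exact Or.inl h
      · exact Or.inr (Or.inl h)
      · refine Or.inr (Or.inr ?_)
        simp only [mem_sdiff, mem_union, not_or] at h ⊢
        exact ⟨⟨h.1, h.2.2⟩, h.2.1⟩)
  refine ⟨x, y, Q, hQ, fun v hv => ?_, ?_⟩
  · rcases hQv v hv with ⟨i, k, hk, rfl⟩ | hv
    · exact ⟨fun h' => hPB i k hk (hRB' h'), fun h' => absurd h' (hPB i k hk)⟩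
    · rw [Finset.mem_sdiff] at hv
      exact ⟨hv.2, fun _ => hv.1⟩
  · have hsub : (s ×ˢ Ico t (l - t)).image (fun i => P i.1 i.2) ⊆ Q := by
      intro v hv
      obtain ⟨⟨i, k⟩, hi, rfl⟩ := Finset.mem_image.1 hv
      simp only [mem_product, mem_Ico] at hi
      exact hQc i hi.1 k hi.2.1 (by omega)
    have hcard : #s * (l - 2 * t) ≤ #Q := by
      refine le_trans (le_of_eq ?_) (Finset.card_le_card hsub)
      rw [Finset.card_image_of_injOn, Finset.card_product, Nat.card_Ico]
      · congr 1; omega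
      · rintro ⟨i, k⟩ hi ⟨j, k'⟩ hj hij
        simp only [coe_product, Set.mem_prod, mem_coe, mem_Ico] at hi hj
        obtain ⟨h1, h2⟩ := hPinj i j k k' (by omega) (by omega) hij
        exact Prod.ext h1 h2
    rw [hcardI] at hs
    have hm2 : X ^ 2 * m ≤ 2 * #I := by omega
    have hQc' : ((#Qᶜ : ℕ) : ℝ) = Fintype.card V - #Q := by
      rw [Finset.card_compl, Nat.cast_sub (Finset.card_le_univ _)]
    have h1 : ((#s * (l - 2 * t) : ℕ) : ℝ) ≤ #Q := by exact_mod_cast hcard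
    have e2 : ((l - 2 * t : ℕ) : ℝ) = (l : ℝ) - 2 * (t : ℝ) := by
      rw [Nat.cast_sub htl, Nat.cast_mul 2 t, Nat.cast_ofNat]
    rw [Nat.cast_mul (#s), e2] at h1
    have h2 := uncovered_le (X := X) (n := Fintype.card V) (a := #I) (s := #s) (m := m) (l := l)
      (t := t) (Q := #Q) (by exact_mod_cast hXl) (Nat.cast_nonneg _) (Nat.cast_nonneg _)
      (Nat.cast_nonneg _) hI (by exact_mod_cast hm2) (by exact_mod_cast hs)
      (by exact_mod_cast hlt) h1
    rw [← hQc'] at h2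
    exact_mod_cast h2

end RegularExpander
end Core
end ExpanderCycle

namespace ExpanderCycle
open Finset
open scoped Classical

/-! ### Assembling the spanning subdivision. -/

section Core

variable {V : Type*} [Fintype V] {G : SimpleGraph V} {D X Y : ℕ}

lemma RegularExpander.exists_spanning_subdivision [Nonempty V] (h : RegularExpander G D X Y)
    {W : Type*} [Fintype W] (F : SimpleGraph W) (hF : F.edgeSet.Nonempty)
    (hk : X ^ 4 * Fintype.card W ^ 2 ≤ 32 * D) :
    ∃ K : G.Subgraph, K.IsSubdivisionOf F ∧ X * K.vertsᶜ.ncard ≤ Fintype.card V := by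
  have hX0 := h.X_pos
  have hY0 := h.Y_pos
  have hXl : 10 ^ 20 ≤ X := le_trans (by norm_num) h.large
  have hDn := h.D_le
  obtain ⟨R, hRc, -, hR⟩ := h.exists_reservoir (P := X ^ 4 * Y) (by positivity)
    (by have := h.pow_le (a := 10) (b := 2) (by norm_num) (by norm_num)
        have e : X ^ 2 * (X ^ 4 * Y) ^ 2 = X ^ 10 * Y ^ 2 := by ring
        rw [e]; omega)
    (by have := h.pow_le (a := 7) (b := 2) (by norm_num) (by norm_num)
        have e : X ^ 3 * (X ^ 4 * Y) * Y = X ^ 7 * Y ^ 2 := by ring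
        rw [e]; omega)
  -- R serves the merging and R' only the two final connections. The parameter X¹³Y³ is X times the
  -- length of the covering paths, which makes R' negligible compared with the number of those
  -- paths.
  obtain ⟨R', hRc', hR', -⟩ := h.exists_reservoir (P := X ^ 13 * Y ^ 3) (by positivity)
    (by have := h.pow_le (a := 28) (b := 6) (by norm_num) (by norm_num)
        have e : X ^ 2 * (X ^ 13 * Y ^ 3) ^ 2 = X ^ 28 * Y ^ 6 := by ring
        rw [e]; omega)
    (by have := h.pow_le (a := 16) (b := 4) (by norm_num) (by norm_num)
        have e : X ^ 3 * (X ^ 13 * Y ^ 3) * Y = X ^ 16 * Y ^ 4 := by ring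
        rw [e]; omega)
  have hRs : X ^ 2 * #R ≤ Fintype.card V := by
    have h1 : (X * Y) * (X * (X ^ 2 * #R)) ≤ (X * Y) * (X * Fintype.card V) := by
      calc (X * Y) * (X * (X ^ 2 * #R)) = X ^ 4 * Y * #R := by ring
        _ ≤ 34 * (X * Y) * Fintype.card V := hRc
        _ = (X * Y) * (34 * Fintype.card V) := by ring
        _ ≤ _ := Nat.mul_le_mul_left _ (Nat.mul_le_mul_right _ (by omega))
    exact Nat.le_of_mul_le_mul_left (Nat.le_of_mul_le_mul_left h1 (by positivity)) hX0
  have hRs' : X ^ 2 * #R' ≤ Fintype.card V := by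
    have h1 : (X * Y) * (X * (X ^ 2 * #R')) ≤ (X * Y) * (X * Fintype.card V) := by
      calc (X * Y) * (X * (X ^ 2 * #R')) = 1 * (X ^ 4 * Y * #R') := by ring
        _ ≤ (X ^ 9 * Y ^ 2) * (X ^ 4 * Y * #R') := Nat.mul_le_mul_right _ (by
            have : 0 < X ^ 9 * Y ^ 2 := by positivity
            omega)
        _ = X ^ 13 * Y ^ 3 * #R' := by ring
        _ ≤ 34 * (X * Y) * Fintype.card V := hRc'
        _ = (X * Y) * (34 * Fintype.card V) := by ring
        _ ≤ _ := Nat.mul_le_mul_left _ (Nat.mul_le_mul_right _ (by omega))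
    exact Nat.le_of_mul_le_mul_left (Nat.le_of_mul_le_mul_left h1 (by positivity)) hX0
  obtain ⟨e₀, he₀⟩ := hF
  obtain ⟨u₀, v₀⟩ := e₀
  change F.Adj u₀ v₀ at he₀
  -- The edge u₀v₀ is reserved for the long path; only the others are linked by short paths.
  set E : Finset (Sym2 W) := F.edgeFinset.erase s(u₀, v₀) with hE
  have hEmem : ∀ e, e ∈ E ↔ e ≠ s(u₀, v₀) ∧ e ∈ F.edgeSet := by
    intro e; rw [hE, Finset.mem_erase, SimpleGraph.mem_edgeFinset]
  set k := Fintype.card W with hkdef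
  have hEk : #E ≤ k ^ 2 :=
    (Finset.card_le_card (Finset.erase_subset _ _)).trans
      (F.card_edgeFinset_le_card_choose_two.trans (Nat.choose_le_pow k 2))
  have hk2 : k ≤ k ^ 2 := Nat.le_self_pow (by norm_num) k
  have hbound : 40 * X ^ 2 * #E + k ≤ 41 * (X ^ 2 * k ^ 2) := by
    have h1 : 1 ≤ X ^ 2 := Nat.one_le_pow _ _ hX0
    have h2 : k ^ 2 ≤ X ^ 2 * k ^ 2 := Nat.le_mul_of_pos_left _ h1
    have h3 : X ^ 2 * #E ≤ X ^ 2 * k ^ 2 := Nat.mul_le_mul_left _ hEk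
    nlinarith
  obtain ⟨b, f, hb, hbB, hfpath, hfB, hfb, hfd⟩ := h.exists_branch_paths (R ∪ R')
    (by
      have h1 := Finset.card_union_le R R'
      have h2 : 16 ≤ X ^ 2 := by nlinarith
      have h3 : 16 * #R ≤ X ^ 2 * #R := Nat.mul_le_mul_right _ h2
      have h4 : 16 * #R' ≤ X ^ 2 * #R' := Nat.mul_le_mul_right _ h2
      omega) E
    (by
      have h1 : X * (256 * X * (41 * (X ^ 2 * k ^ 2))) ≤ X * D := by
        calc X * (256 * X * (41 * (X ^ 2 * k ^ 2))) = 10496 * (X ^ 4 * k ^ 2) := by ring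
          _ ≤ 10496 * (32 * D) := Nat.mul_le_mul_left _ hk
          _ = 335872 * D := by ring
          _ ≤ X * D := Nat.mul_le_mul_right _ (by omega)
      exact (Nat.mul_le_mul_left _ hbound).trans (Nat.le_of_mul_le_mul_left h1 hX0))
  set S := E.biUnion f ∪ univ.image b with hS
  have hSc : X ^ 2 * #S ≤ 3936 * Fintype.card V := by
    have h1 : #(E.biUnion f) ≤ #E * (40 * X ^ 2) :=
      Finset.card_biUnion_le_card_mul _ _ _ fun e he => (hfB e he).2
    have h2 : #(univ.image b) ≤ k := Finset.card_image_le
    have h3 : #S ≤ 41 * (X ^ 2 * k ^ 2) := by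
      have := Finset.card_union_le (E.biUnion f) (univ.image b)
      rw [← hS] at this
      nlinarith
    calc X ^ 2 * #S ≤ X ^ 2 * (41 * (X ^ 2 * k ^ 2)) := Nat.mul_le_mul_left _ h3
      _ = 41 * (X ^ 4 * k ^ 2) := by ring
      _ ≤ _ := by omega
  set B := R ∪ R' ∪ S with hB
  have hRB : R ⊆ B := Finset.subset_union_left.trans Finset.subset_union_left
  have hRB' : R' ⊆ B := Finset.subset_union_right.trans Finset.subset_union_left
  have hSB : S ⊆ B := Finset.subset_union_right
  have hBc : X ^ 2 * #B ≤ 4000 * Fintype.card V := by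
    have h1 := Finset.card_union_le (R ∪ R') S
    rw [← hB] at h1
    have h2 := Finset.card_union_le R R'
    have h3 : X ^ 2 * #B ≤ X ^ 2 * (#R + #R' + #S) := Nat.mul_le_mul_left _ (by omega)
    rw [mul_add, mul_add] at h3
    omega
  obtain ⟨x, y, Q, hQ, hQv, hQc⟩ := h.exists_long_path R R' B hRB hRB' hBc hRc' hR
  have hSR : ∀ v ∈ S, v ∉ R ∧ v ∉ R' := by
    intro v hv
    have : v ∉ R ∪ R' := by
      rcases Finset.mem_union.1 hv with hv | hv
      · obtain ⟨e, he, hve⟩ := Finset.mem_biUnion.1 hv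
        exact Finset.disjoint_left.1 (hfB e he).1 hve
      · obtain ⟨w, -, rfl⟩ := Finset.mem_image.1 hv
        exact hbB w
    rwa [Finset.mem_union, not_or] at this
  have hSQ : ∀ v ∈ S, v ∉ Q := fun v hv hvQ => (hSR v hv).1 ((hQv v hvQ).2 (hSB hv))
  have hbS : ∀ w, b w ∈ S := fun w =>
    Finset.mem_union_right _ (Finset.mem_image_of_mem b (mem_univ w))
  have hbne : b u₀ ≠ b v₀ := fun hh => he₀.ne (hb hh)
  obtain ⟨T, hT, hTc, hTs⟩ := hR' (b u₀) x ∅ (by simp)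
  -- The second connection treats the first as an obstacle; T has at most 35XY vertices, well within
  -- the allowance of R'.
  obtain ⟨T', hT', -, hTs'⟩ := hR' y (b v₀) T (by
    have h1 := h.pow_le (a := 16) (b := 5) (by norm_num) (by norm_num)
    calc 3 * (X ^ 2 * (X ^ 13 * Y ^ 3) * Y) * #T
        ≤ 3 * (X ^ 2 * (X ^ 13 * Y ^ 3) * Y) * (35 * (X * Y)) := Nat.mul_le_mul_left _ hTc
      _ = 105 * (X ^ 16 * Y ^ 5) := by ring
      _ ≤ D := by omega)
  have hTs2 : ∀ v ∈ T, v = b u₀ ∨ v = x ∨ v ∈ R' := by simpa using hTs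
  have hL : PathOn G (b u₀) (b v₀) ((T ∪ Q) ∪ T') := by
    refine (hT.trans hQ fun v hv hvQ => ?_).trans hT' fun v hv hv' => ?_
    · rcases hTs2 v hv with rfl | hh | hh
      · exact absurd hvQ (hSQ _ (hbS _))
      · exact hh
      · exact absurd hh (hQv v hvQ).1
    · rcases hTs' v hv' with hh | rfl | hh
      · exact hh
      · rcases Finset.mem_union.1 hv with hv | hv
        · rcases hTs2 _ hv with hh | hh | hh
          · exact absurd hh.symm hbne
          · exact absurd (hh ▸ hQ.left_mem) (hSQ _ (hbS _))
          · exact absurd hh (hSR _ (hbS _)).2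
        · exact absurd hv (hSQ _ (hbS _))
      · rw [Finset.mem_sdiff] at hh
        rcases Finset.mem_union.1 hv with hv | hv
        · exact absurd hv hh.2
        · exact absurd hh.1 (hQv v hv).1
  have hLS : ∀ v ∈ S, v ∈ (T ∪ Q) ∪ T' → v = b u₀ ∨ v = b v₀ := by
    intro v hvS hv
    simp only [mem_union] at hv
    rcases hv with (hv | hv) | hv
    · rcases hTs2 v hv with hh | hh | hh
      · exact Or.inl hh
      · exact absurd (hh ▸ hQ.left_mem) (hSQ v hvS)
      · exact absurd hh (hSR v hvS).2
    · exact absurd hv (hSQ v hvS)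
    · rcases hTs' v hv with hh | hh | hh
      · exact absurd (hh ▸ hQ.right_mem) (hSQ v hvS)
      · exact Or.inr hh
      · exact absurd (Finset.mem_sdiff.1 hh).1 (hSR v hvS).2
  let g : Sym2 W → Finset V := fun e => if e = s(u₀, v₀) then (T ∪ Q) ∪ T' else f e
  have hg₀ : g s(u₀, v₀) = (T ∪ Q) ∪ T' := if_pos rfl
  have hg : ∀ e, e ≠ s(u₀, v₀) → g e = f e := fun e he => if_neg he
  have hcross : ∀ e ∈ F.edgeSet, e ≠ s(u₀, v₀) → ∀ v ∈ f e, v ∈ (T ∪ Q) ∪ T' →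
      v ∈ Set.range b := by
    intro e he hne v hv hv'
    have hvS : v ∈ S :=
      Finset.mem_union_left _ (Finset.mem_biUnion.2 ⟨e, (hEmem e).2 ⟨hne, he⟩, hv⟩)
    rcases hLS v hvS hv' with hh | hh
    exacts [⟨u₀, hh.symm⟩, ⟨v₀, hh.symm⟩]
  obtain ⟨K, hK, hKv⟩ := exists_subdivision (G := G) (F := F) hb g
    (fun u v huv => by
      by_cases he : s(u, v) = s(u₀, v₀)
      · rw [he, hg₀]
        rcases Sym2.eq_iff.1 he with ⟨rfl, rfl⟩ | ⟨rfl, rfl⟩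
        exacts [hL, hL.symm]
      · rw [hg _ he]
        exact hfpath u v ((hEmem _).2 ⟨he, huv⟩))
    (fun u v huv w hw => by
      by_cases he : s(u, v) = s(u₀, v₀)
      · rw [he, hg₀] at hw
        have := hLS _ (hbS w) hw
        rcases Sym2.eq_iff.1 he with ⟨rfl, rfl⟩ | ⟨rfl, rfl⟩
        exacts [this, this.symm]
      · rw [hg _ he] at hw
        exact hfb u v ((hEmem _).2 ⟨he, huv⟩) w hw)
    (fun e he e' he' hne v hv hv' => by
      by_cases h1 : e = s(u₀, v₀)
      · rw [h1, hg₀] at hv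
        have h2 : e' ≠ s(u₀, v₀) := fun hh => hne (h1.trans hh.symm)
        rw [hg _ h2] at hv'
        exact hcross e' he' h2 v hv' hv
      · rw [hg _ h1] at hv
        by_cases h2 : e' = s(u₀, v₀)
        · rw [h2, hg₀] at hv'
          exact hcross e he h1 v hv hv'
        · rw [hg _ h2] at hv'
          exact hfd e ((hEmem e).2 ⟨h1, he⟩) e' ((hEmem e').2 ⟨h2, he'⟩) hne v hv hv')
  refine ⟨K, hK, (Nat.mul_le_mul_left _ ?_).trans hQc⟩
  rw [← Set.ncard_coe_finset]
  refine Set.ncard_le_ncard (fun v hv => ?_) (Finset.finite_toSet _)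
  rw [Finset.mem_coe, Finset.mem_compl]
  intro hvQ
  refine hv (hKv u₀ v₀ he₀ v ?_)
  rw [hg₀]
  exact Finset.mem_union_left _ (Finset.mem_union_right _ hvQ)

end Core
end ExpanderCycle

namespace ExpanderCycle
open Finset
open scoped Classical

/-! ### From robust vertex expansion to the working hypotheses. -/

section Robust

variable {V : Type*} [Fintype V] {H : SimpleGraph V}

lemma dg_univ_eq_degree [DecidableRel H.Adj] (v : V) : dg H v univ = H.degree v := by
  rw [dg, ← SimpleGraph.card_neighborFinset_eq_degree]
  congr 1
  ext w
  simp

/-- If the boundary were within budget, it could itself serve as the deleted edge set, leaving no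
external neighbours and contradicting the positive expansion rate. -/
lemma lt_sum_dg_compl_of_isRobustExpander {ε c s : ℝ} (h : H.IsRobustExpander ε c s) (hε : 0 < ε)
    (hn : 0 < Real.logb 2 (Fintype.card V)) {U : Finset V} (hU : U.Nonempty)
    (hU2 : 3 * #U ≤ 2 * Fintype.card V) : s * #U < (∑ u ∈ U, dg H u Uᶜ : ℕ) := by
  by_contra! hlt
  set F : Finset (Sym2 V) := U.biUnion fun u => ({w ∈ Uᶜ | H.Adj u w}).image fun w => s(u, w)
  have hF : #F ≤ ∑ u ∈ U, dg H u Uᶜ :=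
    Finset.card_biUnion_le.trans (Finset.sum_le_sum fun u _ => Finset.card_image_le)
  have hUr : (3 : ℝ) * #U ≤ 2 * Fintype.card V := by exact_mod_cast hU2
  have key := h U F hU.card_pos (by linarith) (by
    intro e he
    obtain ⟨u, -, hu⟩ := Finset.mem_biUnion.1 (Finset.mem_coe.1 he)
    obtain ⟨w, hw, rfl⟩ := Finset.mem_image.1 hu
    exact (Finset.mem_filter.1 hw).2) (le_trans (by exact_mod_cast hF) hlt)
  have hempty : (H.deleteEdges (F : Set (Sym2 V))).extNeighborSet (U : Set V) = ∅ := by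
    ext v
    simp only [SimpleGraph.extNeighborSet, Set.mem_ofPred_eq, Set.mem_empty_iff_false, iff_false]
    rintro ⟨hv, u, hu, huv⟩
    rw [SimpleGraph.deleteEdges_adj] at huv
    refine huv.2 (Finset.mem_coe.2 (Finset.mem_biUnion.2 ⟨u, hu, Finset.mem_image.2 ⟨v, ?_, rfl⟩⟩))
    exact Finset.mem_filter.2 ⟨Finset.mem_compl.2 hv, huv.1⟩
  rw [hempty, Set.ncard_empty] at key
  have hUp : (0 : ℝ) < #U := by exact_mod_cast hU.card_pos
  have := mul_pos (div_pos hε (Real.rpow_pos_of_pos hn c)) hUp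
  push_cast at key
  linarith

lemma regularExpander_of_isRobustExpander [DecidableRel H.Adj] {c ε d s : ℝ} (hc : 0 < c)
    (hlog : (2 : ℝ) ^ 101 ≤ Real.logb 2 (Fintype.card V))
    (hε : ε ≤ 1 / Real.logb 2 (Fintype.card V) ^ 4)
    (hd : Real.logb 2 (Fintype.card V) ^ (10 * c + 51) ≤ d)
    (hs : d / (4 * Real.logb 2 (Fintype.card V) ^ c) ≤ s)
    (hH : H.IsRobustExpander (1 / 8) c s) (hmax : (H.maxDegree : ℝ) ≤ d)
    (havg : d * (1 - ε) ≤ H.avgDegree) (hmin : H.avgDegree / 2 ≤ (H.minDegree : ℝ)) :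
    RegularExpander H H.maxDegree ⌈Real.logb 2 (Fintype.card V)⌉₊
      (⌈Real.logb 2 (Fintype.card V) ^ c⌉₊ + 2) ∧ d ≤ 2 * H.maxDegree := by
  set l := Real.logb 2 (Fintype.card V) with hl
  set X := ⌈l⌉₊
  -- The added 2 guarantees Y ≥ 3 without changing the order of magnitude.
  set Y := ⌈l ^ c⌉₊ + 2
  set D := H.maxDegree
  have hl1 : (1 : ℝ) ≤ l := le_trans (by norm_num) hlog
  have hl0 : 0 < l := by linarith
  have hn : 0 < Fintype.card V := by
    rcases Nat.eq_zero_or_pos (Fintype.card V) with h0 | h0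
    · rw [h0] at hl
      norm_num at hl
      linarith
    · exact h0
  have hnr : (0 : ℝ) < Fintype.card V := by exact_mod_cast hn
  have hm1 : 1 ≤ l ^ c := Real.one_le_rpow hl1 hc.le
  have hXl : l ≤ X := Nat.le_ceil l
  have hXu : (X : ℝ) ≤ 2 * l := by
    have := Nat.ceil_lt_add_one hl0.le
    linarith
  have hYl : l ^ c ≤ (Y : ℝ) := by
    have := Nat.le_ceil (l ^ c)
    simp only [Y]
    push_cast
    linarith
  have hYu : (Y : ℝ) ≤ 4 * l ^ c := by
    have := Nat.ceil_lt_add_one (by linarith : 0 ≤ l ^ c)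
    simp only [Y]
    push_cast
    linarith
  have hd' : l ^ 51 * (l ^ c) ^ 10 ≤ d := by
    refine le_trans (le_of_eq ?_) hd
    rw [Real.rpow_add hl0, mul_comm, ← Real.rpow_natCast (l ^ c), ← Real.rpow_mul hl0.le]
    congr 1
    · congr 1
      push_cast
      ring
    · norm_cast
  have hd0 : 0 < d := lt_of_lt_of_le (by positivity) hd'
  have hεX : ε ≤ 1 / (X : ℝ) ^ 2 := by
    refine hε.trans (one_div_le_one_div_of_le (by nlinarith) ?_)
    calc (X : ℝ) ^ 2 ≤ (2 * l) ^ 2 := by gcongr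
      _ = 4 * l ^ 2 := by ring
      _ ≤ l ^ 2 * l ^ 2 := by
        have : (4 : ℝ) ≤ l ^ 2 := by nlinarith
        gcongr
      _ = _ := by ring
  have hX4 : (1 : ℝ) / (X : ℝ) ^ 2 ≤ 1 / 8 :=
    one_div_le_one_div_of_le (by norm_num) (by nlinarith)
  have hsum : (∑ v, (H.degree v : ℝ)) = H.avgDegree * Fintype.card V := by
    rw [SimpleGraph.avgDegree, div_mul_cancel₀ _ hnr.ne']
  have hDavg : H.avgDegree ≤ D := by
    have h1 : (∑ v, (H.degree v : ℝ)) ≤ ∑ _v : V, (D : ℝ) :=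
      Finset.sum_le_sum fun v _ => by exact_mod_cast H.degree_le_maxDegree v
    rw [hsum, Finset.sum_const, nsmul_eq_mul, Finset.card_univ, mul_comm] at h1
    exact le_of_mul_le_mul_left h1 hnr
  have hdD : d ≤ 2 * D := by nlinarith
  have hDD : (X : ℝ) ^ 50 * (Y : ℝ) ^ 10 ≤ D := by
    have h1 : (X : ℝ) ^ 50 * (Y : ℝ) ^ 10 ≤ (2 * l) ^ 50 * (4 * l ^ c) ^ 10 := by gcongr
    have h2 : (2 * l) ^ 50 * (4 * l ^ c) ^ 10 * 2 = 2 ^ 71 * (l ^ 50 * (l ^ c) ^ 10) := by ring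
    -- The spare logarithm in the exponent 51, against the 50 needed, absorbs the constants from
    -- rounding and from replacing d by D ≥ d/2.
    have h3 : 2 ^ 71 * (l ^ 50 * (l ^ c) ^ 10) ≤ l * (l ^ 50 * (l ^ c) ^ 10) :=
      mul_le_mul_of_nonneg_right (le_trans (by norm_num) hlog) (by positivity)
    have h4 : l * (l ^ 50 * (l ^ c) ^ 10) = l ^ 51 * (l ^ c) ^ 10 := by ring
    linarith
  have havgD : (1 - 1 / (X : ℝ) ^ 2) * D ≤ H.avgDegree := by
    have h1 : (1 - 1 / (X : ℝ) ^ 2) * D ≤ (1 - 1 / (X : ℝ) ^ 2) * d :=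
      mul_le_mul_of_nonneg_left hmax (by linarith)
    nlinarith
  refine ⟨⟨⟨?_, ?_, ?_, ?_⟩, ?_, ?_, ?_, ?_, ?_⟩, hdD⟩
  · have : (0 : ℝ) < D := by linarith
    exact_mod_cast this
  · have : 1 ≤ ⌈l ^ c⌉₊ := Nat.one_le_ceil_iff.2 (by linarith)
    omega
  · intro v
    rw [dg_univ_eq_degree]
    exact H.degree_le_maxDegree v
  · intro U hU2
    rcases U.eq_empty_or_nonempty with rfl | hU
    · simp
    have h1 := lt_sum_dg_compl_of_isRobustExpander hH (by norm_num) hl0 hU hU2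
    set m : ℕ := ∑ u ∈ U, dg H u Uᶜ
    have hUp : (0 : ℝ) < #U := by exact_mod_cast hU.card_pos
    have h2 : d * #U ≤ 4 * l ^ c * m := by
      have h3 : d / (4 * l ^ c) * #U ≤ m := (mul_le_mul_of_nonneg_right hs hUp.le).trans h1.le
      rwa [div_mul_eq_mul_div, div_le_iff₀ (by positivity), mul_comm (m : ℝ)] at h3
    have h4 : (D : ℝ) * #U ≤ 4 * Y * m := by
      refine (mul_le_mul_of_nonneg_right hmax hUp.le).trans (h2.trans ?_)
      gcongr
    exact_mod_cast h4
  · have : ((2 ^ 100 : ℕ) : ℝ) ≤ X := by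
      push_cast
      linarith
    exact_mod_cast this
  · have h1 : (Fintype.card V : ℝ) ≤ 2 ^ (X : ℝ) := (Real.logb_le_iff_le_rpow (by norm_num) hnr).1 hXl
    rw [Real.rpow_natCast] at h1
    exact_mod_cast h1
  · exact_mod_cast hDD
  · intro v
    rw [dg_univ_eq_degree]
    have h1 : (H.minDegree : ℝ) ≤ H.degree v := by exact_mod_cast H.minDegree_le_degree v
    have h2 : (D : ℝ) ≤ 3 * H.degree v := by
      have : (0 : ℝ) ≤ D := Nat.cast_nonneg _
      nlinarith
    exact_mod_cast h2
  · simp_rw [dg_univ_eq_degree]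
    push_cast
    rw [hsum, ← mul_assoc]
    exact mul_le_mul_of_nonneg_right havgD hnr.le

end Robust

end ExpanderCycle

/-! ### The theorem, back in real parameters. -/

theorem mainTheorem2 (c : ℝ) (hc : 0 < c) :
    ∃ N : ℕ, ∀ (n : ℕ), N ≤ n → ∀ (ε d s : ℝ),
      0 < ε → ε ≤ 1 / (Real.logb 2 n) ^ 4 →
      (Real.logb 2 n) ^ (10 * c + 51) ≤ d →
      d / (4 * (Real.logb 2 n) ^ c) ≤ s →
      ∀ (V : Type*) [Fintype V] (H : SimpleGraph V) [DecidableRel H.Adj],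
        Fintype.card V = n →
        H.IsRobustExpander (1 / 8) c s →
        (H.maxDegree : ℝ) ≤ d →
        d * (1 - ε) ≤ H.avgDegree →
        H.avgDegree / 2 ≤ (H.minDegree : ℝ) →
        (∀ (W : Type*) [Fintype W] (F : SimpleGraph W),
          F.edgeSet.Nonempty →
          (Fintype.card W : ℝ) ≤ Real.sqrt d / (Real.logb 2 n) ^ 2 →
          ∃ K : H.Subgraph, K.IsSubdivisionOf F ∧
            ((K.vertsᶜ.ncard : ℕ) : ℝ) ≤ n / Real.logb 2 n) ∧
        (∃ (v : V) (C : H.Walk v v), C.IsCycle ∧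
          (({x : V | x ∉ C.support}.ncard : ℕ) : ℝ) ≤ n / Real.logb 2 n) := by
  -- The only requirement on n is log n ≥ 2^101, which also dominates every absolute constant.
  obtain ⟨N, hN⟩ := Filter.eventually_atTop.1 (((Real.tendsto_logb_atTop (b := 2)
    (by norm_num)).comp tendsto_natCast_atTop_atTop).eventually_ge_atTop ((2 : ℝ) ^ 101))
  refine ⟨N, fun n hn ε d s _ hε hd hs V _ H _ hV hH hmax havg hmin => ?_⟩
  have hlog : (2 : ℝ) ^ 101 ≤ Real.logb 2 n := hN n hn
  subst hV
  obtain ⟨hreg, hdD⟩ := ExpanderCycle.regularExpander_of_isRobustExpander hc hlog hε hd hs hH hmax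
    havg hmin
  set l := Real.logb 2 (Fintype.card V) with hl
  have hl0 : 0 < l := lt_of_lt_of_le (by norm_num) hlog
  have hXl : l ≤ (⌈l⌉₊ : ℝ) := Nat.le_ceil l
  have hXu : (⌈l⌉₊ : ℝ) ≤ 2 * l := by
    have := Nat.ceil_lt_add_one hl0.le
    linarith
  have hne : Nonempty V := by
    by_contra h
    have : Fintype.card V = 0 := Fintype.card_eq_zero_iff.2 (not_nonempty_iff.1 h)
    rw [this] at hl
    norm_num at hl
    linarith
  have hcov : ∀ m : ℕ, ⌈l⌉₊ * m ≤ Fintype.card V → (m : ℝ) ≤ Fintype.card V / l := by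
    intro m hm
    rw [le_div_iff₀ hl0]
    have : (⌈l⌉₊ : ℝ) * m ≤ Fintype.card V := by exact_mod_cast hm
    nlinarith [mul_le_mul_of_nonneg_right hXl (Nat.cast_nonneg (α := ℝ) m)]
  refine ⟨fun W _ F hF hW => ?_, ?_⟩
  · have hd0 : 0 ≤ d := (Nat.cast_nonneg _).trans hmax
    have h1 : l ^ 4 * (Fintype.card W : ℝ) ^ 2 ≤ d := by
      rw [le_div_iff₀ (by positivity)] at hW
      calc l ^ 4 * (Fintype.card W : ℝ) ^ 2 = (Fintype.card W * l ^ 2) ^ 2 := by ring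
        _ ≤ Real.sqrt d ^ 2 := by gcongr
        _ = d := Real.sq_sqrt hd0
    have h2 : (⌈l⌉₊ : ℝ) ^ 4 * (Fintype.card W : ℝ) ^ 2 ≤ 32 * H.maxDegree := by
      calc (⌈l⌉₊ : ℝ) ^ 4 * (Fintype.card W : ℝ) ^ 2
          ≤ (2 * l) ^ 4 * (Fintype.card W : ℝ) ^ 2 := by gcongr
        _ = 16 * (l ^ 4 * (Fintype.card W : ℝ) ^ 2) := by ring
        _ ≤ _ := by linarith
    obtain ⟨K, hK, hKc⟩ := hreg.exists_spanning_subdivision F hF (by exact_mod_cast h2)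
    exact ⟨K, hK, hcov _ hKc⟩
  -- For the triangle the size condition is 9X⁴ ≤ 32D, supplied by the lower bound on the degree.
  · have h1 := hreg.pow_le (a := 4) (b := 0) (by norm_num) (by norm_num)
    obtain ⟨K, hK, hKc⟩ := hreg.exists_spanning_subdivision (⊤ : SimpleGraph (Fin 3))
      ⟨s(0, 1), by simp⟩ (by rw [Fintype.card_fin]; rw [pow_zero, mul_one] at h1; omega)
    obtain ⟨v, C, hC, hCK⟩ := ExpanderCycle.exists_cycle_of_subdivision hK
    refine ⟨v, C, hC, le_trans ?_ (hcov _ hKc)⟩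
    have hsub : {x : V | x ∉ C.support} ⊆ K.vertsᶜ := fun x hx hxK => (show x ∉ C.support from hx) (hCK x hxK)
    exact_mod_cast Set.ncard_le_ncard hsub
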